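/- Let $M$ be a smooth $7$-manifold (without boundary) and let $\phi = e^{123}+e^{145}+e^{167}+e^{246}-e^{257}-e^{347}-e^{356}$ be the standard $3$-form on $\mathbb R^7$. A $\mathrm G_2$ structure on $M$ is a smooth $3$-form $\varphi$ such that for every $x\in M$ there is a linear isomorphism $u:T_xM\to\mathbb R^7$ with $\varphi_x=u^*\phi$. It determines a Riemannian metric $g$ and an orientation, with volume form $vol_g$, by $g(u,v)\,vol_g=\frac16 (u\lrcorner\varphi)\wedge(v\lrcorner\varphi)\wedge\varphi$; put $\psi=*\varphi$. Let $\nabla$ be the Levi-Civita connection of $g$, $R_{ij}$ its Ricci tensor, $d^*$ the codifferential and $\Delta_\varphi=dd^*+d^*d$ the Hodge Laplacian. The torsion tensor of $\varphi$ is given in local coordinates by $T_i^{\ j}=\frac1{24}\nabla_i\varphi_{lmn}\psi^{jlmn}$, with $T_{ij}=T_i^{\ k}g_{kj}$, and $|T|^2=T_{ik}T_{jl}g^{ij}g^{kl}$; $\varphi$ is torsion-free if $\nabla\varphi=0$. A Laplacian soliton is a triple $(\varphi,X,\lambda)$ of a $\mathrm G_2$ structure $\varphi$ with $d\varphi=0$,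 a smooth vector field $X$ on $M$ and $\lambda\in\mathbb R$ such that $$\Delta_\varphi\varphi=\lambda\varphi+\mathcal L_X\varphi .$$ It is called steady if $\lambda=0$ and shrinking if $\lambda<0$. **Proposition.** Let $(\varphi,X,\lambda)$ be a Laplacian soliton on $M$. Then, in all local coordinates, $$-R_{ij}-\tfrac13|T|^2g_{ij}-2\,T_i^{\ k}T_{kj}=\tfrac13\lambda g_{ij}+\tfrac12(\mathcal L_Xg)_{ij},$$ and $d^*(X\lrcorner\varphi)=0$ on $M$. Moreover $$7\lambda+3\operatorname{div}(X)=2|T|^2 \quad\text{on } M.$$ If $M$ is compact and non-empty, then the soliton is not shrinking, and it is steady if and only if $\varphi$ is torsion-free. -/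

import Mathlib

open scoped Manifold ContDiff Topology

noncomputable section

namespace G2

/-- The model space `ℝ⁷` of coordinates. -/
abbrev R7 : Type := EuclideanSpace ℝ (Fin 7)

/-- The standard basis vector `∂ᵢ` of `ℝ⁷`. -/
def basisVec (i : Fin 7) : R7 := EuclideanSpace.single i (1 : ℝ)

/-! ### The standard `3`-form on `ℝ⁷` -/

/-- `(eⁱ ∧ eʲ ∧ eᵏ)(v₀, v₁, v₂) = det ((v_a)_{i}, (v_a)_{j}, (v_a)_{k})`, with indices starting
at `0`. -/
def elem3 (i j k : Fin 7) (v : Fin 3 → R7) : ℝ :=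
  Matrix.det (Matrix.of fun a b : Fin 3 => v a ((![i, j, k] : Fin 3 → Fin 7) b))

/-- The standard form `e¹²³ + e¹⁴⁵ + e¹⁶⁷ + e²⁴⁶ - e²⁵⁷ - e³⁴⁷ - e³⁵⁶`, written with indices
starting at `0`. -/
def stdPhi (v : Fin 3 → R7) : ℝ :=
  elem3 0 1 2 v + elem3 0 3 4 v + elem3 0 5 6 v + elem3 1 3 5 v
    - elem3 1 4 6 v - elem3 2 3 6 v - elem3 2 4 5 v

/-! ### Linear algebra of a `3`-form on `ℝ⁷` -/

/-- A `k`-form on (a subset of) `ℝ⁷`, as a function of the coordinates. -/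
abbrev LocalForm (k : ℕ) : Type := R7 → R7 [⋀^Fin k]→L[ℝ] ℝ

/-- The component `α_{i₁ … i_k} = α(∂_{i₁}, …, ∂_{i_k})` of a `k`-form at a point. -/
def comp {k : ℕ} (α : R7 [⋀^Fin k]→L[ℝ] ℝ) (i : Fin k → Fin 7) : ℝ :=
  α fun a => basisVec (i a)

/-- The coefficient `B_{ij}` of `dx¹ ∧ ⋯ ∧ dx⁷` in the `7`-form
`B(∂ᵢ, ∂ⱼ) = (1/6) (∂ᵢ ⌟ α) ∧ (∂ⱼ ⌟ α) ∧ α`.  The wedge product of two `2`-forms and a `3`-form is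
`1 / (2! 2! 3!)` times the alternating sum over all permutations. -/
def bryantForm (α : R7 [⋀^Fin 3]→L[ℝ] ℝ) : Matrix (Fin 7) (Fin 7) ℝ :=
  Matrix.of fun i j => (1 / 6 : ℝ) * ((1 / 24 : ℝ) * ∑ σ : Equiv.Perm (Fin 7),
    ((Equiv.Perm.sign σ : ℤ) : ℝ) *
      (comp α ![i, σ 0, σ 1] * comp α ![j, σ 2, σ 3] * comp α ![σ 4, σ 5, σ 6]))

/-- The coefficient `s` of the volume form `vol = s dx¹ ∧ ⋯ ∧ dx⁷` of the metric and orientation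
determined by `g(u, v) vol = B(u, v)`.  Since `s g = B` and `det g = s²`, it is the real ninth root
of `det B`; it is negative when the coordinates are negatively oriented. -/
def volCoeff (α : R7 [⋀^Fin 3]→L[ℝ] ℝ) : ℝ :=
  Real.sign (bryantForm α).det * |(bryantForm α).det| ^ (1 / 9 : ℝ)

/-- The components `g_{ij}` of the metric determined by `g(u, v) vol = B(u, v)`. -/
def metricOf (α : R7 [⋀^Fin 3]→L[ℝ] ℝ) : Matrix (Fin 7) (Fin 7) ℝ :=
  (volCoeff α)⁻¹ • bryantForm α

/-- The components `ε_{i₁ … i₇} = vol(∂_{i₁}, …, ∂_{i₇})` of the volume form. -/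
def volForm (α : R7 [⋀^Fin 3]→L[ℝ] ℝ) (i : Fin 7 → Fin 7) : ℝ :=
  volCoeff α * ((1 : Matrix (Fin 7) (Fin 7) ℝ).submatrix i id).det

/-- The components with raised indices `α^{p₁ p₂ p₃}` of the `3`-form itself. -/
def raised (α : R7 [⋀^Fin 3]→L[ℝ] ℝ) (p : Fin 3 → Fin 7) : ℝ :=
  ∑ i : Fin 3 → Fin 7, comp α i * ∏ a, (metricOf α)⁻¹ (i a) (p a)

/-- The components `ψ_{j₁ j₂ j₃ j₄} = (1/3!) φ^{p₁p₂p₃} ε_{p₁p₂p₃j₁j₂j₃j₄}` of the Hodge dual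
`ψ = *φ`. -/
def psi (α : R7 [⋀^Fin 3]→L[ℝ] ℝ) (j : Fin 4 → Fin 7) : ℝ :=
  (1 / 6 : ℝ) * ∑ p : Fin 3 → Fin 7, raised α p * volForm α (Fin.append p j : Fin (3 + 4) → Fin 7)

/-! ### Differential geometry of the metric of a `3`-form in coordinates

In this section `φ` is a `3`-form in coordinates, and `g` is the metric determined by `φ`. -/

/-- The partial derivative `∂ᵢ f`. -/
def pderiv (i : Fin 7) (f : R7 → ℝ) (y : R7) : ℝ := fderiv ℝ f y (basisVec i)

/-- The components `g_{ij}` of the metric. -/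
def gMat (φ : LocalForm 3) (y : R7) : Matrix (Fin 7) (Fin 7) ℝ := metricOf (φ y)

/-- The components `g^{ij}` of the inverse metric. -/
def gInv (φ : LocalForm 3) (y : R7) : Matrix (Fin 7) (Fin 7) ℝ := (gMat φ y)⁻¹

/-- The Christoffel symbols `Γᵏᵢⱼ` of the Levi-Civita connection. -/
def christoffel (φ : LocalForm 3) (k i j : Fin 7) (y : R7) : ℝ :=
  (1 / 2 : ℝ) * ∑ l, gInv φ y k l *
    (pderiv i (fun z => gMat φ z j l) y + pderiv j (fun z => gMat φ z i l) y
      - pderiv l (fun z => gMat φ z i j) y)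

/-- The components `R_{ijl}ᵐ` of `R(∂ᵢ, ∂ⱼ)∂ₗ = (∇ᵢ∇ⱼ - ∇ⱼ∇ᵢ)∂ₗ`. -/
def riemannUp (φ : LocalForm 3) (i j l m : Fin 7) (y : R7) : ℝ :=
  pderiv i (christoffel φ m j l) y - pderiv j (christoffel φ m i l) y
    + ∑ p, (christoffel φ m i p y * christoffel φ p j l y
        - christoffel φ m j p y * christoffel φ p i l y)

/-- The curvature tensor `R_{ijkl} = g(R(∂ᵢ, ∂ⱼ)∂ₗ, ∂ₖ)`. -/
def riemann (φ : LocalForm 3) (i j k l : Fin 7) (y : R7) : ℝ :=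
  ∑ m, gMat φ y k m * riemannUp φ i j l m y

/-- The Ricci tensor `R_{ik} = g^{jl} R_{ijkl}`. -/
def ricci (φ : LocalForm 3) (y : R7) : Matrix (Fin 7) (Fin 7) ℝ :=
  Matrix.of fun i k => ∑ j, ∑ l, gInv φ y j l * riemann φ i j k l y

/-- The derivation `(v₀, …, v_k) ↦ ∑ₐ α(v₀, …, A vₐ, …, v_k)` of forms given by an endomorphism
`A`. -/
def act {k : ℕ} (A : R7 →L[ℝ] R7) (α : R7 [⋀^Fin (k + 1)]→L[ℝ] ℝ) : R7 [⋀^Fin (k + 1)]→L[ℝ] ℝ :=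
  ContinuousAlternatingMap.alternatizeUncurryFin (α.curryLeft.comp A)

/-- The formula that describes `act`. -/
theorem act_apply {k : ℕ} (A : R7 →L[ℝ] R7) (α : R7 [⋀^Fin (k + 1)]→L[ℝ] ℝ)
    (v : Fin (k + 1) → R7) :
    act A α v = ∑ a, α (Function.update v a (A (v a))) := by
  rw [act, ContinuousAlternatingMap.alternatizeUncurryFin_apply]
  refine Finset.sum_congr rfl fun i _ => ?_
  have h := ContinuousAlternatingMap.neg_one_pow_smul_map_insertNth α i (A (v i)) (i.removeNth v)
  rw [Fin.insertNth_removeNth] at h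
  have h' : (α.curryLeft.comp A) (v i) (i.removeNth v) =
      α (Matrix.vecCons (A (v i)) (i.removeNth v)) := rfl
  rw [h', ← h, smul_smul, ← pow_add, Even.neg_one_pow ⟨_, rfl⟩, one_smul]

/-- The endomorphism `∂ⱼ ↦ ∇ᵢ∂ⱼ = Γᵏᵢⱼ ∂ₖ`. -/
def connection (φ : LocalForm 3) (i : Fin 7) (y : R7) : R7 →L[ℝ] R7 :=
  Matrix.toEuclideanCLM (𝕜 := ℝ) (Matrix.of fun k j => christoffel φ k i j y)

/-- The covariant derivative `∇ᵢ α` of a form for the Levi-Civita connection of `φ`. -/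
def covDeriv (φ : LocalForm 3) {k : ℕ} (α : LocalForm (k + 1)) (i : Fin 7) : LocalForm (k + 1) :=
  fun y => fderiv ℝ α y (basisVec i) - act (connection φ i y) (α y)

/-- The codifferential `(d*α)_{i₁ … i_k} = -g^{ij} ∇ᵢ α_{j i₁ … i_k}`. -/
def codiff (φ : LocalForm 3) {k : ℕ} (α : LocalForm (k + 1)) : LocalForm k :=
  fun y => -∑ i, ∑ j, gInv φ y i j • (covDeriv φ α i y).curryLeft (basisVec j)

/-- The Hodge Laplacian `dd* + d*d`. -/
def hodgeLaplacian (φ : LocalForm 3) {k : ℕ} (α : LocalForm (k + 1)) : LocalForm (k + 1) :=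
  fun y => extDeriv (codiff φ α) y + codiff φ (extDeriv α) y

/-- The interior product `X ⌟ α`. -/
def interior {k : ℕ} (X : R7 → R7) (α : LocalForm (k + 1)) : LocalForm k :=
  fun y => (α y).curryLeft (X y)

/-- The Lie derivative of a form:
`(L_X α)(v₀, …, v_k) = (D_X α)(v₀, …, v_k) + ∑ₐ α(v₀, …, D_{vₐ} X, …, v_k)`. -/
def lieForm {k : ℕ} (X : R7 → R7) (α : LocalForm (k + 1)) : LocalForm (k + 1) :=
  fun y => fderiv ℝ α y (X y) + act (fderiv ℝ X y) (α y)

/-- The Lie derivative of the metric: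
`(L_X g)_{ij} = Xᵏ ∂ₖ g_{ij} + g_{kj} ∂ᵢ Xᵏ + g_{ik} ∂ⱼ Xᵏ`. -/
def lieMetric (φ : LocalForm 3) (X : R7 → R7) (y : R7) : Matrix (Fin 7) (Fin 7) ℝ :=
  Matrix.of fun i j => ∑ k, (X y k * pderiv k (fun z => gMat φ z i j) y
    + gMat φ y k j * pderiv i (fun z => X z k) y + gMat φ y i k * pderiv j (fun z => X z k) y)

/-- The divergence `div X = ∇ᵢ Xⁱ = ∂ᵢ Xⁱ + Γⁱᵢₖ Xᵏ`. -/
def divergence (φ : LocalForm 3) (X : R7 → R7) (y : R7) : ℝ :=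
  ∑ i, (pderiv i (fun z => X z i) y + ∑ k, christoffel φ i i k y * X y k)

/-- The full torsion tensor, given by
`T_{ij} = (1/24) ∇ᵢ φ_{lmn} ψ_{jabc} g^{la} g^{mb} g^{nc}`. -/
def torsion (φ : LocalForm 3) (y : R7) : Matrix (Fin 7) (Fin 7) ℝ :=
  Matrix.of fun i j => (1 / 24 : ℝ) * ∑ l : Fin 3 → Fin 7, ∑ a : Fin 3 → Fin 7,
    comp (covDeriv φ φ i y) l * psi (φ y) ![j, a 0, a 1, a 2] * ∏ r, gInv φ y (l r) (a r)

/-- The tensor `T_i^k T_{kj} = T_{il} g^{lk} T_{kj}`. -/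
def torsionSq (φ : LocalForm 3) (y : R7) : Matrix (Fin 7) (Fin 7) ℝ :=
  torsion φ y * gInv φ y * torsion φ y

/-- The norm `|T|² = T_{ik} T_{jl} g^{ij} g^{kl}`. -/
def torsionNormSq (φ : LocalForm 3) (y : R7) : ℝ :=
  ∑ i, ∑ j, ∑ k, ∑ l, torsion φ y i k * torsion φ y j l * gInv φ y i j * gInv φ y k l

/-! ### Forms and vector fields on a `7`-manifold -/

section Manifold

variable {M : Type*} [TopologicalSpace M] [ChartedSpace R7 M]

/-- The smooth coordinate charts of `M`: the charts of its maximal smooth atlas. -/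
def charts (M : Type*) [TopologicalSpace M] [ChartedSpace R7 M] :
    Set (OpenPartialHomeomorph M R7) :=
  IsManifold.maximalAtlas (𝓡 7) ∞ M

/-- The expression of a `3`-form in the coordinates of the chart `e`: its pullback by `e⁻¹`
(meaningful on `e.target`). -/
def formInChart (e : OpenPartialHomeomorph M R7)
    (φ : ∀ x : M, TangentSpace (𝓡 7) x [⋀^Fin 3]→L[ℝ] ℝ) : LocalForm 3 :=
  fun y => (φ (e.symm y)).compContinuousLinearMap (mfderiv (𝓡 7) (𝓡 7) e.symm y)

/-- The expression of a vector field in the coordinates of the chart `e`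
(meaningful on `e.target`). -/
def fieldInChart (e : OpenPartialHomeomorph M R7)
    (X : ∀ x : M, TangentSpace (𝓡 7) x) : R7 → R7 :=
  fun y => VectorField.mpullback (𝓡 7) (𝓡 7) e.symm X y

/-- A `G₂` structure: a smooth positive `3`-form. -/
structure IsG2Structure (φ : ∀ x : M, TangentSpace (𝓡 7) x [⋀^Fin 3]→L[ℝ] ℝ) : Prop where
  smooth : ∀ e ∈ charts M, ContDiffOn ℝ ∞ (formInChart e φ) e.target
  positive : ∀ x : M, ∃ u : TangentSpace (𝓡 7) x ≃L[ℝ] R7,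
    ∀ v : Fin 3 → TangentSpace (𝓡 7) x, φ x v = stdPhi fun a => u (v a)

/-- The triple `(φ, X, lam)` is a Laplacian soliton: `φ` is a closed `G₂` structure, `X` a smooth
vector field and `Δ_φ φ = lam φ + L_X φ`. -/
structure IsLaplacianSoliton [IsManifold (𝓡 7) ∞ M]
    (φ : ∀ x : M, TangentSpace (𝓡 7) x [⋀^Fin 3]→L[ℝ] ℝ)
    (X : ∀ x : M, TangentSpace (𝓡 7) x) (lam : ℝ) : Prop where
  isG2 : IsG2Structure φ
  smooth_field : ContMDiff (𝓡 7) (𝓡 7).tangent ∞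
    fun x : M => (⟨x, X x⟩ : TangentBundle (𝓡 7) M)
  closed : ∀ e ∈ charts M, ∀ y ∈ e.target, extDeriv (formInChart e φ) y = 0
  equation : ∀ e ∈ charts M, ∀ y ∈ e.target,
    hodgeLaplacian (formInChart e φ) (formInChart e φ) y =
      lam • formInChart e φ y + lieForm (fieldInChart e X) (formInChart e φ) y

/-- A `G₂` structure is torsion-free if `∇φ = 0`. -/
def IsTorsionFree (φ : ∀ x : M, TangentSpace (𝓡 7) x [⋀^Fin 3]→L[ℝ] ℝ) : Prop :=
  ∀ e ∈ charts M, ∀ y ∈ e.target, ∀ i, covDeriv (formInChart e φ) (formInChart e φ) i y = 0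

end Manifold

end G2

end

/-! Everything local is reduced to algebra at one point. A positive form has, at each point, a frame
in which it is the standard form and its metric is the identity. The components of ∇φ, ∇∇φ and the
curvature in that frame satisfy the relations collected in `IsSecondJet`: both derivatives have
vanishing alternation because dφ = 0; the identity φ_{ipq} φ_{krs} g^{pr} g^{qs} = 6 g_{ik},
differentiated once and twice with ∇g = 0, fixes the symmetric parts of their contractions with φ;
and the Ricci identity relates the two orders of differentiation. `IsLocalG2.isSecondJet` proves
these relations in coordinates.

Under the structure group, 3-forms split into parts of dimension 1, 7 and 27. For a 3-form β, the
symmetric part of the contraction `ctr` (β_{kbc} φ_{dbc}) sees the parts of dimension 1 and 27, and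
`ctrPsi` (β_{abc} ψ_{mabc}) sees the part of dimension 7. The differentiated metric identity leaves
∇φ only the latter, so ∇_i φ = T_{im} ψ_m (`eq_tor`), and closedness makes T skew with T_{jk}
φ_{jkl} = 0 (`ClosedFam.isLambda14_tor`).

At second order the same contractions give the scalar curvature -|T|² (`IsSecondJet.scal`) and
express the remaining curvature contraction R_{bcjm} φ_{dbc} φ_{ajm} through Ricci and T
(`IsSecondJet.curvG_eq`). Hence the symmetric contraction of the Laplacian is -8 R_{ad} + 16 T_{ak}
T_{dk} (`IsSecondJet.ctr_lapArr`), and its part of dimension 7 vanishes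
(`IsSecondJet.ctrPsi_lapArr`).

On the other side, L_X φ is ∇_X φ plus the endomorphism ∇X acting on φ, and λφ is (λ/3) times the
identity acting on φ. Comparing symmetric contractions gives the Ricci equation, and its trace gives
7λ + 3 div X = 2|T|². Comparing the parts of dimension 7 gives d*(X ⌟ φ) = 0.

On a compact manifold, a multiple c · div X that is nowhere negative vanishes identically
(`IsG2Structure.divergence_eq_zero`): its integral is zero by a partition of unity and integration
by parts in charts, with the density |vol|, so that no oriented atlas is needed. If λ ≤ 0, the trace
identity makes div X nonnegative, hence zero, and then 7λ = 2|T|² excludes λ < 0 and forces T = 0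
when λ = 0. If T = 0, then div X is the constant -7λ/3, which must be zero. -/

noncomputable section

namespace G2

/-! ### Integer tables for the standard form and its dual, and their contractions -/

/-- The sign of the product of two imaginary octonion units. -/
def octSign : Fin 7 → Fin 7 → ℤ :=
  ![![0, 1, -1, 1, -1, 1, -1], ![-1, 0, 1, 1, -1, -1, 1], ![1, -1, 0, -1, -1, 1, 1],
    ![-1, -1, 1, 0, 1, 1, -1], ![1, 1, 1, -1, 0, -1, -1], ![-1, 1, -1, -1, 1, 0, 1],
    ![1, -1, -1, 1, 1, -1, 0]]

/-- The integer components of the standard `3`-form. -/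
def phiZ (i j k : Fin 7) : ℤ :=
  if (i.val + 1) ^^^ (j.val + 1) = k.val + 1 then octSign i j else 0

/-- The Kronecker symbol with integer values. -/
def deltaZ (i j : Fin 7) : ℤ := if i = j then 1 else 0

/-- The integer components of the Hodge dual of the standard `3`-form. -/
def psiZ (i j k l : Fin 7) : ℤ :=
  (if (i.val + 1) ^^^ (j.val + 1) = (k.val + 1) ^^^ (l.val + 1) then octSign i j * octSign k l else 0)
    - deltaZ i k * deltaZ j l + deltaZ i l * deltaZ j k

/-- The integer components of an elementary `3`-form. -/
def elemZ (i j k a b c : Fin 7) : ℤ :=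
  deltaZ a i * deltaZ b j * deltaZ c k - deltaZ a i * deltaZ b k * deltaZ c j
    - deltaZ a j * deltaZ b i * deltaZ c k + deltaZ a j * deltaZ b k * deltaZ c i
    + deltaZ a k * deltaZ b i * deltaZ c j - deltaZ a k * deltaZ b j * deltaZ c i

/-- The seven monomials are the lines of the Fano plane. With indices starting at 1, three indices
are collinear exactly when the XOR of two distinct ones is the third, which is the test in `phiZ`.
-/
theorem phiZ_eq_elemZ (a b c : Fin 7) :
    phiZ a b c = elemZ 0 1 2 a b c + elemZ 0 3 4 a b c + elemZ 0 5 6 a b c + elemZ 1 3 5 a b c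
      - elemZ 1 4 6 a b c - elemZ 2 3 6 a b c - elemZ 2 4 5 a b c := by
  revert a b c; decide +kernel

theorem phiZ_swap (a b c : Fin 7) : phiZ a b c = -phiZ b a c := by revert a b c; decide +kernel
theorem phiZ_swap' (a b c : Fin 7) : phiZ a b c = -phiZ a c b := by revert a b c; decide +kernel

theorem psiZ_swap (a b c d : Fin 7) : psiZ a b c d = -psiZ b a c d := by
  revert a b c d; decide +kernel
theorem psiZ_swap' (a b c d : Fin 7) : psiZ a b c d = -psiZ a c b d := by
  revert a b c d; decide +kernel
theorem psiZ_swap'' (a b c d : Fin 7) : psiZ a b c d = -psiZ a b d c := by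
  revert a b c d; decide +kernel

/-- A sum over seven indices, written out so that it evaluates quickly. -/
def sum7 (f : Fin 7 → ℤ) : ℤ := f 0 + f 1 + f 2 + f 3 + f 4 + f 5 + f 6

theorem sum7_eq (f : Fin 7 → ℤ) : ∑ i, f i = sum7 f := Fin.sum_univ_seven f

/-- `psiZ` is this identity solved for ψ. That it is the Hodge dual of φ is a separate computation,
`sum_phiZ_epsZ`. -/
theorem phiZ_phiZ (i j a b : Fin 7) : ∑ k, phiZ i j k * phiZ a b k =
    deltaZ i a * deltaZ j b - deltaZ i b * deltaZ j a + psiZ i j a b := by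
  rw [sum7_eq]; revert i j a b; decide +kernel

theorem phiZ_psiZ (u v x y z : Fin 7) : ∑ m, phiZ u v m * psiZ x y z m =
    -(deltaZ u x * phiZ v y z + deltaZ u y * phiZ x v z + deltaZ u z * phiZ x y v
      - deltaZ v x * phiZ u y z - deltaZ v y * phiZ x u z - deltaZ v z * phiZ x y u) := by
  rw [sum7_eq]; revert u v x y z; decide +kernel

theorem phiZ_psiZ_two (m n a : Fin 7) :
    ∑ b, ∑ c, phiZ m b c * psiZ n a b c = 4 * phiZ m n a := by
  simp only [sum7_eq]; revert m n a; decide +kernel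

theorem psiZ_psiZ_two (m a n d : Fin 7) :
    ∑ b, ∑ c, psiZ m a b c * psiZ n d b c =
      4 * (deltaZ m n * deltaZ a d - deltaZ m d * deltaZ a n) + 2 * psiZ m a n d := by
  simp only [sum7_eq]; revert m a n d; decide +kernel

/-! ### Contraction identities over the reals -/

/-- The components of the standard `3`-form. -/
def phi0 (i j k : Fin 7) : ℝ := phiZ i j k
/-- The components of the Hodge dual of the standard `3`-form. -/
def psi0 (i j k l : Fin 7) : ℝ := psiZ i j k l
/-- The Kronecker symbol. -/
def dl (i j : Fin 7) : ℝ := if i = j then 1 else 0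

theorem deltaZ_cast (i j : Fin 7) : (deltaZ i j : ℝ) = dl i j := by
  unfold deltaZ dl; split_ifs <;> simp

theorem dl_comm (i j : Fin 7) : dl i j = dl j i := by unfold dl; simp only [eq_comm]

theorem phi0_swap (a b c : Fin 7) : phi0 a b c = -phi0 b a c := by
  unfold phi0; rw [phiZ_swap]; push_cast; rfl
theorem phi0_swap' (a b c : Fin 7) : phi0 a b c = -phi0 a c b := by
  unfold phi0; rw [phiZ_swap']; push_cast; rfl
theorem phi0_rot (a b c : Fin 7) : phi0 a b c = phi0 b c a := by
  rw [phi0_swap, phi0_swap' b a c]; ring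
theorem phi0_swap13 (a b c : Fin 7) : phi0 a b c = -phi0 c b a := by
  rw [phi0_rot, phi0_swap]; 
theorem psi0_swap (a b c d : Fin 7) : psi0 a b c d = -psi0 b a c d := by
  unfold psi0; rw [psiZ_swap]; push_cast; rfl
theorem psi0_swap' (a b c d : Fin 7) : psi0 a b c d = -psi0 a c b d := by
  unfold psi0; rw [psiZ_swap']; push_cast; rfl
theorem psi0_swap'' (a b c d : Fin 7) : psi0 a b c d = -psi0 a b d c := by
  unfold psi0; rw [psiZ_swap'']; push_cast; rfl
theorem psi0_rot3 (m a b c : Fin 7) : psi0 m a b c = psi0 m b c a := by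
  rw [psi0_swap', psi0_swap'' m b a c]; ring

theorem phi0_phi0 (i j a b : Fin 7) : ∑ k, phi0 i j k * phi0 a b k =
    dl i a * dl j b - dl i b * dl j a + psi0 i j a b := by
  have := phiZ_phiZ i j a b
  simp only [phi0, psi0, ← deltaZ_cast]; exact_mod_cast this

theorem phi0_psi0 (u v x y z : Fin 7) : ∑ m, phi0 u v m * psi0 x y z m =
    -(dl u x * phi0 v y z + dl u y * phi0 x v z + dl u z * phi0 x y v
      - dl v x * phi0 u y z - dl v y * phi0 x u z - dl v z * phi0 x y u) := by
  have := phiZ_psiZ u v x y z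
  simp only [phi0, psi0, ← deltaZ_cast]; exact_mod_cast this

theorem phi0_psi0_two (m n a : Fin 7) :
    ∑ b, ∑ c, phi0 m b c * psi0 n a b c = 4 * phi0 m n a := by
  have := phiZ_psiZ_two m n a
  simp only [phi0, psi0]; exact_mod_cast this

theorem psi0_psi0_two (m a n d : Fin 7) :
    ∑ b, ∑ c, psi0 m a b c * psi0 n d b c =
      4 * (dl m n * dl a d - dl m d * dl a n) + 2 * psi0 m a n d := by
  have := psiZ_psiZ_two m a n d
  simp only [psi0, ← deltaZ_cast]; exact_mod_cast this

theorem psi0_eq (i j a b : Fin 7) : psi0 i j a b =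
    ∑ k, phi0 i j k * phi0 a b k - dl i a * dl j b + dl i b * dl j a := by
  rw [phi0_phi0]; ring

/-! ### Rearranging sums -/

theorem sum_skew_eq_zero {f : Fin 7 → Fin 7 → ℝ} (h : ∀ a b, f a b = -f b a) :
    ∑ a, ∑ b, f a b = 0 := by
  have h1 : ∑ a, ∑ b, f a b = -∑ a, ∑ b, f a b := by
    conv_lhs => rw [Finset.sum_comm]
    simp only [← Finset.sum_neg_distrib]
    exact Finset.sum_congr rfl fun a _ => Finset.sum_congr rfl fun b _ => h _ _
  linarith

theorem sum_congr2 {f g : Fin 7 → Fin 7 → ℝ} (h : ∀ a b, f a b = g a b) :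
    ∑ a, ∑ b, f a b = ∑ a, ∑ b, g a b := by simp only [h]

theorem sum_congr3 {f g : Fin 7 → Fin 7 → Fin 7 → ℝ} (h : ∀ a b c, f a b c = g a b c) :
    ∑ a, ∑ b, ∑ c, f a b c = ∑ a, ∑ b, ∑ c, g a b c := by simp only [h]

theorem sum3_swap (f : Fin 7 → Fin 7 → Fin 7 → ℝ) :
    ∑ a, ∑ b, ∑ c, f a b c = ∑ a, ∑ b, ∑ c, f b a c := Finset.sum_comm

theorem sum3_swap' (f : Fin 7 → Fin 7 → Fin 7 → ℝ) :
    ∑ a, ∑ b, ∑ c, f a b c = ∑ a, ∑ b, ∑ c, f a c b :=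
  Finset.sum_congr rfl fun _ _ => Finset.sum_comm

theorem sum3_rot (f : Fin 7 → Fin 7 → Fin 7 → ℝ) :
    ∑ a, ∑ b, ∑ c, f a b c = ∑ a, ∑ b, ∑ c, f c a b := by
  rw [sum3_swap, sum3_swap']

theorem sum_dl_mul (a : Fin 7) (f : Fin 7 → ℝ) : ∑ b, dl a b * f b = f a := by simp [dl]
theorem sum_dl_mul' (a : Fin 7) (f : Fin 7 → ℝ) : ∑ b, dl b a * f b = f a := by simp [dl]

/-- Alternating arrays with three indices. -/
structure Alt3 (β : Fin 7 → Fin 7 → Fin 7 → ℝ) : Prop where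
  swap : ∀ a b c, β a b c = -β b a c
  swap' : ∀ a b c, β a b c = -β a c b

theorem Alt3.rot {β : Fin 7 → Fin 7 → Fin 7 → ℝ} (h : Alt3 β) (a b c : Fin 7) :
    β a b c = β b c a := by rw [h.swap, h.swap' b a c]; ring

/-- Reduces an identity of alternating arrays to the 35 increasing triples. -/
theorem Alt3.ext {β γ : Fin 7 → Fin 7 → Fin 7 → ℝ} (hb : Alt3 β) (hc : Alt3 γ)
    (h : ∀ a b c, a < b → b < c → β a b c = γ a b c) (a b c : Fin 7) : β a b c = γ a b c := by
  have key : ∀ {δ : Fin 7 → Fin 7 → Fin 7 → ℝ} (_ : Alt3 δ) (a b : Fin 7), δ a a b = 0 ∧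
      δ b a a = 0 ∧ δ a b a = 0 := fun {δ} hd a b => by
    have h1 := hd.swap a a b
    have h2 := hd.swap' b a a
    have h3 := hd.swap a b a
    refine ⟨by linarith, by linarith, by linarith⟩
  have hne : ∀ {δ : Fin 7 → Fin 7 → Fin 7 → ℝ} (_ : Alt3 δ),
      (a = b ∨ b = c ∨ a = c) → δ a b c = 0 := by
    rintro δ hd (rfl | rfl | rfl)
    exacts [(key hd _ _).1, (key hd _ _).2.1, (key hd _ _).2.2]
  by_cases hd : a = b ∨ b = c ∨ a = c
  · rw [hne hb hd, hne hc hd]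
  push Not at hd
  rcases lt_or_gt_of_ne hd.1 with h1 | h1 <;> rcases lt_or_gt_of_ne hd.2.1 with h2 | h2 <;>
    rcases lt_or_gt_of_ne hd.2.2 with h3 | h3
  · exact h _ _ _ h1 h2
  · exact absurd (h1.trans h2) h3.asymm
  · rw [hb.swap', hc.swap', h _ _ _ h3 h2]
  · rw [hb.rot, hb.rot, hc.rot a, hc.rot b, h _ _ _ h3 h1]
  · rw [hb.swap, hc.swap, h _ _ _ h1 h3]
  · rw [hb.rot, hc.rot, h _ _ _ h2 h3]
  · exact absurd (h2.trans h1) h3.asymm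
  · rw [hb.rot, hb.swap', hb.rot, hb.rot, hc.rot a, hc.swap' b, hc.rot b, hc.rot a, h _ _ _ h2 h1]

theorem alt3_phi0 : Alt3 phi0 := ⟨phi0_swap, phi0_swap'⟩
theorem alt3_psi0 (m : Fin 7) : Alt3 (psi0 m) := ⟨psi0_swap' m, psi0_swap'' m⟩

/-- The contraction `β_{kbc} φ_{dbc}`. -/
def ctr (β : Fin 7 → Fin 7 → Fin 7 → ℝ) (k d : Fin 7) : ℝ := ∑ b, ∑ c, β k b c * phi0 d b c

theorem phi0_phi0_two (i a : Fin 7) : ctr phi0 i a = 6 * dl i a := by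
  unfold ctr
  simp only [phi0_phi0, Finset.sum_add_distrib, Finset.sum_sub_distrib]
  have h : ∀ b, psi0 i b a b = 0 := fun b => by
    have h1 := psi0_swap' i b a b
    have h2 := psi0_swap'' i a b b
    linarith
  simp only [h, Finset.sum_const_zero]
  have h2 : ∑ x, dl i x * dl x a = dl i a := sum_dl_mul i fun x => dl x a
  rw [h2, ← Finset.mul_sum]
  by_cases hia : i = a <;> simp [dl, hia]; norm_num

/-- Each index lies on three Fano lines, so only three entries survive, each counted twice by
skewness. This makes the linear system of `Alt3.exists_eq_psi0` explicit. -/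
theorem sum_mul_phi0 (f : Fin 7 → Fin 7 → ℝ) (hf : ∀ a b, f a b = -f b a) :
    (∑ b, ∑ c, f b c * phi0 0 b c = 2 * (f 1 2 + f 3 4 + f 5 6)) ∧
    (∑ b, ∑ c, f b c * phi0 1 b c = 2 * (-f 0 2 + f 3 5 - f 4 6)) ∧
    (∑ b, ∑ c, f b c * phi0 2 b c = 2 * (f 0 1 - f 3 6 - f 4 5)) ∧
    (∑ b, ∑ c, f b c * phi0 3 b c = 2 * (-f 0 4 - f 1 5 + f 2 6)) ∧
    (∑ b, ∑ c, f b c * phi0 4 b c = 2 * (f 0 3 + f 1 6 + f 2 5)) ∧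
    (∑ b, ∑ c, f b c * phi0 5 b c = 2 * (-f 0 6 + f 1 3 - f 2 4)) ∧
    (∑ b, ∑ c, f b c * phi0 6 b c = 2 * (f 0 5 - f 1 4 - f 2 3)) := by
  refine ⟨?_, ?_, ?_, ?_, ?_, ?_, ?_⟩ <;>
  · simp only [Fin.sum_univ_seven]
    simp [phi0, phiZ, octSign]
    linarith [hf 0 1, hf 0 2, hf 0 3, hf 0 4, hf 0 5, hf 0 6, hf 1 2, hf 1 3, hf 1 4, hf 1 5,
      hf 1 6, hf 2 3, hf 2 4, hf 2 5, hf 2 6, hf 3 4, hf 3 5, hf 3 6, hf 4 5, hf 4 6, hf 5 6]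

/-- The symmetric part of `ctr` is injective on the components of dimension 1 and 27, so its kernel
is the component of dimension 7, spanned by the contractions of ψ with vectors. Concretely, 28
linear equations constrain the 35 components of β. -/
theorem Alt3.exists_eq_psi0 {β : Fin 7 → Fin 7 → Fin 7 → ℝ} (h : Alt3 β)
    (hS : ∀ k d, ctr β k d + ctr β d k = 0) :
    ∃ V : Fin 7 → ℝ, ∀ a b c, β a b c = ∑ m, V m * psi0 m a b c := by
  have h1 : ∀ a b c, b < a → β a b c = -β b a c := fun a b c _ => h.swap a b c
  have h2 : ∀ a b c, c < b → β a b c = -β a c b := fun a b c _ => h.swap' a b c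
  have h3 : ∀ a b, β a a b = 0 := fun a b => by have := h.swap a a b; linarith
  have h4 : ∀ a b, β b a a = 0 := fun a b => by have := h.swap' b a a; linarith
  have r := fun k => sum_mul_phi0 (β k) (h.swap' k)
  have e : ∀ k d, ctr β k d + ctr β d k = 0 := hS
  have s0 : ∀ k, ctr β k 0 = _ := fun k => (r k).1
  have s1 : ∀ k, ctr β k 1 = _ := fun k => (r k).2.1
  have s2 : ∀ k, ctr β k 2 = _ := fun k => (r k).2.2.1
  have s3 : ∀ k, ctr β k 3 = _ := fun k => (r k).2.2.2.1
  have s4 : ∀ k, ctr β k 4 = _ := fun k => (r k).2.2.2.2.1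
  have s5 : ∀ k, ctr β k 5 = _ := fun k => (r k).2.2.2.2.2.1
  have s6 : ∀ k, ctr β k 6 = _ := fun k => (r k).2.2.2.2.2.2
  have e00 := e 0 0
  have e11 := e 1 1
  have e22 := e 2 2
  have e33 := e 3 3
  have e44 := e 4 4
  have e55 := e 5 5
  have e66 := e 6 6
  have e01 := e 0 1
  have e02 := e 0 2
  have e03 := e 0 3
  have e04 := e 0 4
  have e05 := e 0 5
  have e06 := e 0 6
  have e12 := e 1 2
  have e13 := e 1 3
  have e14 := e 1 4
  have e15 := e 1 5
  have e16 := e 1 6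
  have e23 := e 2 3
  have e24 := e 2 4
  have e25 := e 2 5
  have e26 := e 2 6
  have e34 := e 3 4
  have e35 := e 3 5
  have e36 := e 3 6
  have e45 := e 4 5
  have e46 := e 4 6
  have e56 := e 5 6
  simp only [s0, s1, s2, s3, s4, s5, s6] at e00 e11 e22 e33 e44 e55 e66 e01 e02 e03 e04 e05 e06 e12 e13 e14 e15 e16 e23 e24 e25 e26 e34 e35 e36 e45 e46 e56
  -- Brings all components to increasing order of indices; the decided side condition stops the sign
  -- rules from looping.
  simp (disch := decide) only [h1, h2, h3, h4] at e00 e11 e22 e33 e44 e55 e66 e01 e02 e03 e04 e05 e06 e12 e13 e14 e15 e16 e23 e24 e25 e26 e34 e35 e36 e45 e46 e56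
  -- For a triple a, b, c off the Fano lines, exactly one m has ψ_{mabc} ≠ 0, namely the XOR of the
  -- three labels counted from 1. One such triple is chosen for each m, with the sign of ψ.
  refine ⟨![-β 1 3 6, β 0 3 6, β 0 3 5, -β 0 1 6, -β 0 1 5, β 0 1 4, β 0 1 3], ?_⟩
  refine Alt3.ext h ⟨fun a b c => ?_, fun a b c => ?_⟩ ?_
  · simp only [← Finset.sum_neg_distrib]
    exact Finset.sum_congr rfl fun m _ => by rw [psi0_swap']; ring
  · simp only [← Finset.sum_neg_distrib]
    exact Finset.sum_congr rfl fun m _ => by rw [psi0_swap'']; ring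
  intro a b c hab hbc
  rw [Fin.sum_univ_seven]
  simp only [psi0]
  fin_cases a <;> fin_cases b <;> first | (exfalso; revert hab; decide) | skip
  all_goals fin_cases c <;> first | (exfalso; revert hbc; decide) | skip
  all_goals simp [psiZ, octSign, deltaZ]
  all_goals linarith

/-! ### Families of `3`-forms whose alternation vanishes -/

/-- `β_{x;abc}` is alternating in the last three indices and its alternation is zero. -/
structure ClosedFam (β : Fin 7 → Fin 7 → Fin 7 → Fin 7 → ℝ) : Prop where
  alt : ∀ x, Alt3 (β x)
  closed : ∀ x a b c, β x a b c = β a x b c + β b x c a + β c x a b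

/-- Closedness contracted with φ_{kbc}: cyclic symmetry of φ makes the three terms on the right
equal. -/
theorem ClosedFam.sum_ctr {β : Fin 7 → Fin 7 → Fin 7 → Fin 7 → ℝ} (h : ClosedFam β) (j : Fin 7) :
    ∑ k, ctr (β j) k k = 3 * ∑ k, ctr (β k) j k := by
  have e1 : ∑ k, ctr (β j) k k = ∑ k, ∑ b, ∑ c, β k j b c * phi0 k b c
      + ∑ k, ∑ b, ∑ c, β b j c k * phi0 k b c + ∑ k, ∑ b, ∑ c, β c j k b * phi0 k b c := by
    simp only [← Finset.sum_add_distrib, ctr]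
    exact sum_congr3 fun k b c => by rw [h.closed j k b c]; ring
  have e2 : ∑ k, ∑ b, ∑ c, β b j c k * phi0 k b c = ∑ k, ∑ b, ∑ c, β k j b c * phi0 k b c := by
    rw [sum3_rot]
    exact sum_congr3 fun k b c => by rw [phi0_rot]
  have e3 : ∑ k, ∑ b, ∑ c, β c j k b * phi0 k b c = ∑ k, ∑ b, ∑ c, β k j b c * phi0 k b c := by
    rw [sum3_rot, sum3_rot]
    exact sum_congr3 fun k b c => by rw [← phi0_rot]
  rw [e1, e2, e3]; simp only [ctr]; ring

/-- Closedness contracted with φ_{dbc}: exchanging b and c turns one term on the right into minus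
the left side, which accounts for the factor 2. -/
theorem ClosedFam.two_mul_sum {β : Fin 7 → Fin 7 → Fin 7 → Fin 7 → ℝ} (h : ClosedFam β)
    (d a j : Fin 7) :
    2 * ∑ b, ∑ c, phi0 d b c * β b c a j = ctr (β j) a d - ctr (β a) j d := by
  have e1 : ∑ b, ∑ c, phi0 d b c * β b c a j = ∑ b, ∑ c, phi0 d b c * β c b a j
      + ∑ b, ∑ c, phi0 d b c * β a b j c + ∑ b, ∑ c, phi0 d b c * β j b c a := by
    simp only [← Finset.sum_add_distrib]
    exact sum_congr2 fun b c => by rw [h.closed b c a j]; ring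
  have e2 : ∑ b, ∑ c, phi0 d b c * β c b a j = -∑ b, ∑ c, phi0 d b c * β b c a j := by
    rw [Finset.sum_comm]
    simp only [← Finset.sum_neg_distrib]
    exact sum_congr2 fun b c => by rw [phi0_swap' d b c]; ring
  have e3 : ∑ b, ∑ c, phi0 d b c * β a b j c = -ctr (β a) j d := by
    simp only [ctr, ← Finset.sum_neg_distrib]
    exact sum_congr2 fun b c => by rw [(h.alt a).swap]; ring
  have e4 : ∑ b, ∑ c, phi0 d b c * β j b c a = ctr (β j) a d := by
    simp only [ctr]
    exact sum_congr2 fun b c => by rw [(h.alt j).rot a b c]; ring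
  linarith

/-- The contraction `β_{abc} ψ_{mabc}`. -/
def ctrPsi (β : Fin 7 → Fin 7 → Fin 7 → ℝ) (m : Fin 7) : ℝ :=
  ∑ a, ∑ b, ∑ c, β a b c * psi0 m a b c

/-- Applying `ClosedFam.two_mul_sum` to the inner factor of φ_{mxk} β_{x;kyz} φ_{ayz} gives two
terms in which a and m have traded roles; they coincide by skewness of φ. -/
theorem ClosedFam.skew_sum {β : Fin 7 → Fin 7 → Fin 7 → Fin 7 → ℝ} (h : ClosedFam β)
    (m a : Fin 7) :
    ∑ x, ∑ k, phi0 m x k * ctr (β x) k a = -∑ x, ∑ k, phi0 a x k * ctr (β x) k m := by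
  have e1 : ∑ x, ∑ k, phi0 m x k * ctr (β x) k a
      = ∑ y, ∑ z, (∑ x, ∑ k, phi0 m x k * β x k y z) * phi0 a y z := by
    simp only [ctr, Finset.mul_sum, Finset.sum_mul]
    calc _ = ∑ x, ∑ y, ∑ k, ∑ z, phi0 m x k * (β x k y z * phi0 a y z) :=
          Finset.sum_congr rfl fun x _ => Finset.sum_comm
      _ = ∑ y, ∑ x, ∑ k, ∑ z, phi0 m x k * (β x k y z * phi0 a y z) := Finset.sum_comm
      _ = ∑ y, ∑ z, ∑ x, ∑ k, phi0 m x k * (β x k y z * phi0 a y z) :=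
          Finset.sum_congr rfl fun y _ => by rw [sum3_rot, sum3_rot]
      _ = _ := by simp only [mul_assoc]
  have e2 : ∑ y, ∑ z, (2 * ∑ x, ∑ k, phi0 m x k * β x k y z) * phi0 a y z
      = ∑ y, ∑ z, (ctr (β z) y m - ctr (β y) z m) * phi0 a y z :=
    sum_congr2 fun y z => by rw [h.two_mul_sum]
  have e3 : ∑ y, ∑ z, ctr (β z) y m * phi0 a y z = -∑ y, ∑ z, phi0 a y z * ctr (β y) z m := by
    rw [Finset.sum_comm]
    simp only [← Finset.sum_neg_distrib]
    exact sum_congr2 fun b c => by rw [phi0_swap' a c b]; ring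
  simp only [sub_mul, Finset.sum_sub_distrib, e3, mul_assoc, ← Finset.mul_sum] at e2
  have e4 : ∑ y, ∑ z, ctr (β y) z m * phi0 a y z = ∑ y, ∑ z, phi0 a y z * ctr (β y) z m :=
    sum_congr2 fun b c => mul_comm _ _
  rw [e1]; linarith

/-- Closedness contracted with ψ gives three equal terms. Writing ψ as φφ plus Kronecker terms turns
each one into a `ctr` and a trace. -/
theorem ClosedFam.ctrPsi_eq {β : Fin 7 → Fin 7 → Fin 7 → Fin 7 → ℝ} (h : ClosedFam β)
    (a m : Fin 7) :
    ctrPsi (β a) m = 3 * (∑ x, ∑ k, phi0 m x k * ctr (β x) a k - 2 * ∑ x, β x x a m) := by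
  have e1 : ctrPsi (β a) m = ∑ x, ∑ y, ∑ z, β x a y z * psi0 m x y z
      + ∑ x, ∑ y, ∑ z, β y a z x * psi0 m x y z + ∑ x, ∑ y, ∑ z, β z a x y * psi0 m x y z := by
    simp only [← Finset.sum_add_distrib, ctrPsi]
    exact sum_congr3 fun k b c => by rw [h.closed a k b c]; ring
  have e2 : ∑ x, ∑ y, ∑ z, β y a z x * psi0 m x y z
      = ∑ x, ∑ y, ∑ z, β x a y z * psi0 m x y z := by
    rw [sum3_rot]
    exact sum_congr3 fun k b c => by rw [psi0_rot3]
  have e3 : ∑ x, ∑ y, ∑ z, β z a x y * psi0 m x y z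
      = ∑ x, ∑ y, ∑ z, β x a y z * psi0 m x y z := by
    rw [sum3_rot, sum3_rot]
    exact sum_congr3 fun k b c => by rw [← psi0_rot3]
  have e4 : ∀ x, ∑ y, ∑ z, β x a y z * psi0 m x y z
      = ∑ k, phi0 m x k * ctr (β x) a k - 2 * β x x a m := fun x => by
    have f1 : ∑ y, ∑ z, β x a y z * psi0 m x y z = ∑ y, ∑ z, ∑ k, phi0 m x k * (β x a y z * phi0 k y z)
        - ∑ y, ∑ z, dl m y * (dl x z * β x a y z) + ∑ y, ∑ z, dl x y * (dl m z * β x a y z) := by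
      simp only [← Finset.sum_sub_distrib, ← Finset.sum_add_distrib]
      refine sum_congr2 fun y z => ?_
      rw [psi0_eq, mul_add, mul_sub, Finset.mul_sum]
      have : ∀ k, β x a y z * (phi0 m x k * phi0 y z k) = phi0 m x k * (β x a y z * phi0 k y z) :=
        fun k => by rw [phi0_rot k]; ring
      simp only [this]; ring
    rw [f1, sum3_rot, sum3_rot]
    simp only [← Finset.mul_sum, sum_dl_mul]
    have g1 := (h.alt x).rot x a m
    have g2 := (h.alt x).swap' a x m
    simp only [ctr]
    have g3 := (h.alt x).swap x a m
    linarith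
  rw [e1, e2, e3]
  simp only [e4, Finset.sum_sub_distrib, ← Finset.mul_sum]
  ring

/-- In `ClosedFam.ctrPsi_eq` the trace is skew in a and m, and so is the transposed `ctr` term by
`ClosedFam.skew_sum`; only the defect q survives symmetrization. Used with q = 0 for ∇φ and with q
quadratic in the torsion for ∇∇φ. -/
theorem ClosedFam.ctrPsi_symm {β : Fin 7 → Fin 7 → Fin 7 → Fin 7 → ℝ} (h : ClosedFam β)
    {q : Fin 7 → Fin 7 → Fin 7 → ℝ} (hq : ∀ x k d, ctr (β x) k d + ctr (β x) d k = -q x k d)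
    (a m : Fin 7) :
    ctrPsi (β a) m + ctrPsi (β m) a = -3 * (∑ x, ∑ k, phi0 m x k * q x a k
      + ∑ x, ∑ k, phi0 a x k * q x m k) := by
  have e1 : ∀ a m, ∑ x, ∑ k, phi0 m x k * ctr (β x) a k = -∑ x, ∑ k, phi0 m x k * q x a k
      - ∑ x, ∑ k, phi0 m x k * ctr (β x) k a := fun a m => by
    simp only [← Finset.sum_sub_distrib, ← Finset.sum_neg_distrib]
    exact sum_congr2 fun x k => by linear_combination phi0 m x k * hq x a k
  have e2 : ∑ x, β x x a m = -∑ x, β x x m a := by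
    rw [← Finset.sum_neg_distrib]
    exact Finset.sum_congr rfl fun x _ => (h.alt x).swap' _ _ _
  rw [h.ctrPsi_eq, h.ctrPsi_eq, e1, e1, h.skew_sum, e2]
  ring

/-! ### The torsion of a closed `G₂` structure at a point -/

theorem psi0_repeat (m a n : Fin 7) : psi0 m a n a = 0 := by
  have h1 := psi0_swap' m a n a
  have h2 := psi0_swap'' m n a a
  linarith

theorem sum_dl_self : ∑ a, dl a a = 7 := by simp [dl]

theorem psi0_psi0_three (m n : Fin 7) : ctrPsi (psi0 m) n = 24 * dl m n := by
  unfold ctrPsi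
  simp only [psi0_psi0_two, Finset.sum_add_distrib, ← Finset.mul_sum, Finset.sum_sub_distrib,
    psi0_repeat, sum_dl_self, sum_dl_mul]
  simp; ring

theorem ctr_psi0 (m k d : Fin 7) : ctr (psi0 m) k d = 4 * phi0 m k d := by
  have : ctr (psi0 m) k d = ∑ b, ∑ c, phi0 d b c * psi0 m k b c :=
    sum_congr2 fun b c => mul_comm _ _
  rw [this, phi0_psi0_two, phi0_rot]

theorem ctr_sum (V : Fin 7 → ℝ) (β : Fin 7 → Fin 7 → Fin 7 → Fin 7 → ℝ) (k d : Fin 7) :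
    ctr (fun a b c => ∑ m, V m * β m a b c) k d = ∑ m, V m * ctr (β m) k d := by
  simp only [ctr, Finset.sum_mul, Finset.mul_sum]
  rw [sum3_rot, sum3_rot]
  simp only [mul_assoc]

theorem ctrPsi_sum (V : Fin 7 → ℝ) (β : Fin 7 → Fin 7 → Fin 7 → Fin 7 → ℝ) (n : Fin 7) :
    ctrPsi (fun a b c => ∑ m, V m * β m a b c) n = ∑ m, V m * ctrPsi (β m) n := by
  simp only [ctrPsi, Finset.sum_mul, Finset.mul_sum]
  conv_rhs => rw [Finset.sum_comm]
  refine Finset.sum_congr rfl fun a _ => ?_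
  rw [sum3_rot, sum3_rot]
  simp only [mul_assoc]

/-- The algebraic properties of the torsion tensor of a closed `G₂` structure: it is a section of
`Λ²₁₄`. -/
structure IsLambda14 (T : Fin 7 → Fin 7 → ℝ) : Prop where
  skew : ∀ a b, T a b = -T b a
  phi : ∀ l, ∑ j, ∑ k, T j k * phi0 j k l = 0

/-- In ψ = φφ plus Kronecker terms, the φφ part is killed by T. This is the eigenvalue of ψ on the
14-dimensional component of 2-forms. -/
theorem IsLambda14.psi {T : Fin 7 → Fin 7 → ℝ} (h : IsLambda14 T) (b c : Fin 7) :
    ∑ k, ∑ l, T k l * psi0 k l b c = -2 * T b c := by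
  have e1 : ∑ k, ∑ l, T k l * psi0 k l b c = ∑ m, phi0 b c m * ∑ k, ∑ l, T k l * phi0 k l m
      - ∑ k, ∑ l, dl k b * (dl l c * T k l) + ∑ k, ∑ l, dl k c * (dl l b * T k l) := by
    simp only [Finset.mul_sum]
    rw [sum3_rot]
    simp only [← Finset.sum_sub_distrib, ← Finset.sum_add_distrib]
    refine sum_congr2 fun k l => ?_
    rw [psi0_eq, mul_add, mul_sub, Finset.mul_sum]
    have : ∀ m, T k l * (phi0 k l m * phi0 b c m) = phi0 b c m * (T k l * phi0 k l m) :=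
      fun m => by ring
    simp only [this]; ring
  rw [e1]
  simp only [h.phi, ← Finset.mul_sum, sum_dl_mul']
  have := h.skew b c
  simp; linarith

/-- The elements of `Λ²₁₄` annihilate the standard `3`-form. -/
theorem IsLambda14.act {T : Fin 7 → Fin 7 → ℝ} (h : IsLambda14 T) (a b c : Fin 7) :
    ∑ j, T j a * phi0 j b c + ∑ j, T j b * phi0 a j c + ∑ j, T j c * phi0 a b j = 0 := by
  have e0 : ∑ u, ∑ v, T u v * ∑ m, phi0 u v m * psi0 a b c m = 0 := by
    have : ∑ u, ∑ v, T u v * ∑ m, phi0 u v m * psi0 a b c m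
        = ∑ m, psi0 a b c m * ∑ u, ∑ v, T u v * phi0 u v m := by
      simp only [Finset.mul_sum]
      rw [sum3_rot, sum3_rot]
      exact sum_congr3 fun _ _ _ => by ring
    rw [this]; simp [h.phi]
  have e1 : ∑ u, ∑ v, T u v * ∑ m, phi0 u v m * psi0 a b c m =
     -(∑ u, ∑ v, dl u a * (T u v * phi0 v b c) + ∑ u, ∑ v, dl u b * (T u v * phi0 a v c)
      + ∑ u, ∑ v, dl u c * (T u v * phi0 a b v) - ∑ u, ∑ v, dl v a * (T u v * phi0 u b c)
      - ∑ u, ∑ v, dl v b * (T u v * phi0 a u c) - ∑ u, ∑ v, dl v c * (T u v * phi0 a b u)) := by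
    simp only [← Finset.sum_sub_distrib, ← Finset.sum_add_distrib, ← Finset.sum_neg_distrib]
    exact sum_congr2 fun u v => by rw [phi0_psi0]; ring
  rw [e0] at e1
  simp only [← Finset.mul_sum, sum_dl_mul'] at e1
  have e2 : ∀ x, ∀ f : Fin 7 → ℝ, ∑ v, T x v * f v = -∑ v, T v x * f v := fun x f => by
    rw [← Finset.sum_neg_distrib]
    exact Finset.sum_congr rfl fun v _ => by rw [h.skew]; ring
  rw [e2 a, e2 b, e2 c] at e1
  linarith

/-- The torsion tensor of the covariant derivative `F_{i;abc} = ∇ᵢφ_{abc}`. -/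
def tor (F : Fin 7 → Fin 7 → Fin 7 → Fin 7 → ℝ) (i j : Fin 7) : ℝ := ctrPsi (F i) j / 24

/-- Metric compatibility leaves only the component of dimension 7, and the triple contraction ψψ =
24δ identifies its coefficients. -/
theorem eq_tor {F : Fin 7 → Fin 7 → Fin 7 → Fin 7 → ℝ} (hF : ∀ i, Alt3 (F i))
    (hS : ∀ i k d, ctr (F i) k d + ctr (F i) d k = 0) (i a b c : Fin 7) :
    F i a b c = ∑ m, tor F i m * psi0 m a b c := by
  obtain ⟨V, hV⟩ := (hF i).exists_eq_psi0 (hS i)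
  have : ∀ m, tor F i m = V m := fun m => by
    have h1 : F i = fun a b c => ∑ m, V m * psi0 m a b c := by ext a b c; exact hV a b c
    rw [tor, h1, ctrPsi_sum]
    simp only [psi0_psi0_three]
    simp [dl]
  simp only [this, hV]

/-- Skewness is `ClosedFam.ctrPsi_symm` with q = 0; the vanishing of T_{jk} φ_{jkl} is
`ClosedFam.sum_ctr`, where the diagonal of `ctr` is zero. -/
theorem ClosedFam.isLambda14_tor {F : Fin 7 → Fin 7 → Fin 7 → Fin 7 → ℝ} (hF : ClosedFam F)
    (hS : ∀ i k d, ctr (F i) k d + ctr (F i) d k = 0) : IsLambda14 (tor F) := by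
  have hX : ∀ i k d, ctr (F i) k d = 4 * ∑ m, tor F i m * phi0 m k d := fun i k d => by
    have h1 : F i = fun a b c => ∑ m, tor F i m * psi0 m a b c := by
      ext a b c; exact eq_tor hF.alt hS i a b c
    conv_lhs => rw [h1, ctr_sum]
    simp only [ctr_psi0, Finset.mul_sum]
    exact Finset.sum_congr rfl fun _ _ => by ring
  refine ⟨fun a b => ?_, fun l => ?_⟩
  · have := hF.ctrPsi_symm (q := fun _ _ _ => 0) (fun x k d => by rw [hS]; simp) a b
    simp only [mul_zero, Finset.sum_const_zero, add_zero] at this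
    simp only [tor]; linarith
  · have h1 := hF.sum_ctr l
    have h2 : ∀ k, ctr (F l) k k = 0 := fun k => by have := hS l k k; linarith
    simp only [h2, Finset.sum_const_zero, hX, ← Finset.mul_sum] at h1
    have h3 : ∑ j, ∑ k, tor F j k * phi0 j k l = ∑ j, ∑ k, tor F j k * phi0 k l j :=
      sum_congr2 fun j k => by rw [phi0_rot]
    linarith

/-! ### Quadratic expressions in the torsion -/

/-- The inner product `T_{ik} T_{jk}` of two rows. -/
def ip (T : Fin 7 → Fin 7 → ℝ) (i j : Fin 7) : ℝ := ∑ k, T i k * T j k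

theorem ip_comm (T : Fin 7 → Fin 7 → ℝ) (i j : Fin 7) : ip T i j = ip T j i :=
  Finset.sum_congr rfl fun _ _ => mul_comm _ _

theorem IsLambda14.ip_eq {T : Fin 7 → Fin 7 → ℝ} (h : IsLambda14 T) (i j : Fin 7) :
    ∑ k, T k i * T k j = ip T i j :=
  Finset.sum_congr rfl fun k _ => by rw [h.skew k i, h.skew k j]; ring

theorem IsLambda14.ip_eq' {T : Fin 7 → Fin 7 → ℝ} (h : IsLambda14 T) (i j : Fin 7) :
    ∑ k, T k i * T j k = -ip T i j := by
  rw [ip, ← Finset.sum_neg_distrib]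
  exact Finset.sum_congr rfl fun k _ => by rw [h.skew k i]; ring

theorem IsLambda14.diag {T : Fin 7 → Fin 7 → ℝ} (h : IsLambda14 T) (i : Fin 7) : T i i = 0 := by
  have := h.skew i i; linarith

/-- The tensor `q_{ij;kd}` with `q_{ij;kd} = ∇ᵢφ_{kbc} ∇ⱼφ_{dbc} + ∇ᵢφ_{dbc} ∇ⱼφ_{kbc}`. -/
def qf (T : Fin 7 → Fin 7 → ℝ) (i j k d : Fin 7) : ℝ :=
  8 * ip T i j * dl k d - 4 * (T i k * T j d + T i d * T j k)

/-- The double contraction of ψ with itself leaves Kronecker terms and a ψ term that changes sign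
when k and d are exchanged, hence drops out of the sum. -/
theorem qf_eq {F : Fin 7 → Fin 7 → Fin 7 → Fin 7 → ℝ} {T : Fin 7 → Fin 7 → ℝ}
    (hF : ∀ i a b c, F i a b c = ∑ m, T i m * psi0 m a b c) (i j k d : Fin 7) :
    ∑ b, ∑ c, F i k b c * F j d b c + ∑ b, ∑ c, F i d b c * F j k b c = qf T i j k d := by
  have key : ∀ k d, ∑ b, ∑ c, F i k b c * F j d b c =
      4 * ip T i j * dl k d - 4 * (T i d * T j k) + 2 * ∑ m, ∑ n, T i m * T j n * psi0 m k n d := by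
    intro k d
    have e1 : ∑ b, ∑ c, F i k b c * F j d b c
        = ∑ m, ∑ n, T i m * T j n * ∑ b, ∑ c, psi0 m k b c * psi0 n d b c := by
      have f1 : ∀ b c, F i k b c * F j d b c =
          ∑ m, ∑ n, T i m * psi0 m k b c * (T j n * psi0 n d b c) := fun b c => by
        rw [hF, hF, Finset.sum_mul_sum]
      simp only [f1, Finset.mul_sum]
      calc _ = ∑ b, ∑ m, ∑ n, ∑ c, T i m * psi0 m k b c * (T j n * psi0 n d b c) :=
            Finset.sum_congr rfl fun b _ => by rw [sum3_rot, sum3_rot]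
        _ = ∑ m, ∑ n, ∑ b, ∑ c, T i m * psi0 m k b c * (T j n * psi0 n d b c) := by
            rw [sum3_rot, sum3_rot]
        _ = _ := by
          refine sum_congr2 fun m n => sum_congr2 fun b c => by ring
    rw [e1]
    have e2 : ∀ m n, T i m * T j n * ∑ b, ∑ c, psi0 m k b c * psi0 n d b c =
        4 * dl k d * (dl m n * (T i m * T j n)) - 4 * (dl k n * (dl m d * (T i m * T j n)))
          + 2 * (T i m * T j n * psi0 m k n d) := fun m n => by
      rw [psi0_psi0_two]; ring
    simp only [e2, Finset.sum_add_distrib, Finset.sum_sub_distrib, ← Finset.mul_sum, sum_dl_mul,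
      sum_dl_mul']
    rw [ip]; ring
  rw [key, key, qf]
  have h : ∑ m, ∑ n, T i m * T j n * psi0 m k n d = -∑ m, ∑ n, T i m * T j n * psi0 m d n k := by
    simp only [← Finset.sum_neg_distrib]
    refine sum_congr2 fun m n => ?_
    rw [psi0_swap' m k n d, psi0_swap'' m n k d, psi0_swap' m n d k]; ring
  rw [h, dl_comm d k]; ring


theorem sum_qf_diag (T : Fin 7 → Fin 7 → ℝ) (i j : Fin 7) : ∑ k, qf T i j k k = 48 * ip T i j := by
  simp only [qf, Finset.sum_sub_distrib, ← Finset.mul_sum, sum_dl_self, Finset.sum_add_distrib]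
  have : ∑ k, T i k * T j k = ip T i j := rfl
  rw [this]; ring

theorem IsLambda14.sum_qf_snd {T : Fin 7 → Fin 7 → ℝ} (h : IsLambda14 T)
    (i j : Fin 7) : ∑ k, qf T i k j k = 12 * ip T i j := by
  simp only [qf, Finset.sum_sub_distrib, Finset.sum_add_distrib, ← Finset.mul_sum, h.diag, mul_assoc]
  have e1 : ∑ k, ip T i k * dl j k = ip T i j := by simp [dl]
  have e2 : ∑ k, T i k * T k j = -ip T i j := by
    rw [ip_comm, ← h.ip_eq']; exact Finset.sum_congr rfl fun _ _ => mul_comm _ _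
  simp only [e1, e2, mul_zero, Finset.sum_const_zero]; ring

theorem IsLambda14.sum_qf_fst {T : Fin 7 → Fin 7 → ℝ} (h : IsLambda14 T)
    (a d : Fin 7) : ∑ j, qf T j a j d = 12 * ip T a d := by
  have : ∀ j, qf T j a j d = qf T a j d j := fun j => by
    simp only [qf, ip_comm T j a, dl_comm j d]; ring
  simp only [this, h.sum_qf_snd]

theorem sum_ip_psi0 (T : Fin 7 → Fin 7 → ℝ) (a b : Fin 7) : ∑ j, ∑ y, ip T j y * psi0 a j b y = 0 :=
  sum_skew_eq_zero fun j y => by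
    rw [ip_comm, psi0_swap' a j b y, psi0_swap'' a b j y, psi0_swap' a b y j]; ring

/-- The two factors φ share no index, so no contraction identity applies directly. Since T
annihilates φ, `IsLambda14.act` moves T to other slots, and both resulting terms have the common
index k. -/
theorem IsLambda14.cross_sum {T : Fin 7 → Fin 7 → ℝ} (h : IsLambda14 T)
    (d a : Fin 7) :
    ∑ x, ∑ y, ∑ k, phi0 a y k * T y x * ∑ j, T j k * phi0 d j x
      = (∑ k, ip T k k) * dl a d - 4 * ip T a d := by
  have e0 : ∀ k x, ∑ j, T j k * phi0 d j x = -∑ j, T j d * phi0 j k x - ∑ j, T j x * phi0 d k j :=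
    fun k x => by have := h.act d k x; linarith
  simp only [e0, mul_sub, Finset.sum_sub_distrib, mul_neg, Finset.sum_neg_distrib]
  have E1 : ∑ x, ∑ y, ∑ k, phi0 a y k * T y x * ∑ j, T j d * phi0 j k x = 3 * ip T a d := by
    have f1 : ∑ x, ∑ y, ∑ k, phi0 a y k * T y x * ∑ j, T j d * phi0 j k x
        = ∑ j, ∑ x, ∑ y, T y x * T j d * ∑ k, phi0 a y k * phi0 x j k := by
      simp only [Finset.mul_sum]
      rw [sum3_rot]
      calc _ = ∑ x, ∑ y, ∑ j, ∑ k, T y x * T j d * (phi0 a y k * phi0 x j k) := by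
            rw [sum3_rot, sum3_rot]
            refine sum_congr2 fun x y => ?_
            rw [Finset.sum_comm]
            exact sum_congr2 fun j k => by rw [phi0_swap13 j k x, phi0_swap' x k j]; ring
        _ = _ := by rw [sum3_rot, sum3_rot]
    have f2 : ∀ j, ∑ x, ∑ y, T y x * T j d * ∑ k, phi0 a y k * phi0 x j k = 3 * (T j a * T j d) := by
      intro j
      have g1 : ∀ x y, T y x * T j d * ∑ k, phi0 a y k * phi0 x j k =
        dl a x * (dl y j * (T y x * T j d)) - dl a j * T j d * (dl y x * T y x)
          - T j d * (T y x * psi0 y x j a) := fun x y => by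
        rw [phi0_phi0, psi0_swap a y x j, psi0_swap' y a x j, psi0_swap'' y x a j]; ring
      simp only [g1, Finset.sum_sub_distrib, ← Finset.mul_sum, sum_dl_mul, sum_dl_mul']
      rw [Finset.sum_comm (f := fun x y => T y x * psi0 y x j a), h.psi]
      simp only [h.diag, Finset.sum_const_zero]
      ring
    rw [f1]
    simp only [f2, ← Finset.mul_sum, h.ip_eq]
  have E2 : ∑ x, ∑ y, ∑ k, phi0 a y k * T y x * ∑ j, T j x * phi0 d k j
      = ip T a d - (∑ k, ip T k k) * dl a d := by
    have f1 : ∑ x, ∑ y, ∑ k, phi0 a y k * T y x * ∑ j, T j x * phi0 d k j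
        = ∑ y, ∑ j, ip T y j * ∑ k, phi0 a y k * phi0 j d k := by
      rw [sum3_rot]
      refine Finset.sum_congr rfl fun y _ => ?_
      have g1 : ∀ j, ip T y j * ∑ k, phi0 a y k * phi0 j d k
          = ∑ x, ∑ k, phi0 a y k * T y x * (T j x * phi0 d k j) := fun j => by
        rw [ip, Finset.sum_mul_sum]
        exact sum_congr2 fun x k => by rw [phi0_rot j d k]; ring
      simp only [g1, Finset.mul_sum]
      rw [sum3_rot]
      exact sum3_swap _
    have g1 : ∀ y j, ip T y j * ∑ k, phi0 a y k * phi0 j d k =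
        dl a j * (dl y d * ip T y j) - dl a d * (dl y j * ip T y j)
          - ip T y j * psi0 a y d j := fun y j => by
      rw [phi0_phi0, psi0_swap'' a y j d]; ring
    rw [f1]
    simp only [g1, Finset.sum_sub_distrib, ← Finset.mul_sum, sum_dl_mul, sum_dl_mul', sum_ip_psi0 T]
    rw [ip_comm]; ring
  rw [E1, E2]; ring

theorem qf_comm (T : Fin 7 → Fin 7 → ℝ) (i j k d : Fin 7) : qf T i j k d = qf T j i k d := by
  simp only [qf, ip_comm T i j]; ring

theorem qf_comm' (T : Fin 7 → Fin 7 → ℝ) (i j k d : Fin 7) : qf T i j k d = qf T i j d k := by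
  simp only [qf, dl_comm k d]; ring

/-- Of the three terms of `qf`, the Kronecker one is a φφ contraction, one contains T_{jx} φ_{djx} =
0, and the last is `IsLambda14.cross_sum`. -/
theorem IsLambda14.sum_qf_phi0 {T : Fin 7 → Fin 7 → ℝ} (h : IsLambda14 T) (a d : Fin 7) :
    ∑ j, ∑ x, phi0 d j x * ∑ y, ∑ k, phi0 a y k * qf T j y x k
      = 4 * (∑ k, ip T k k) * dl a d + 8 * ip T a d := by
  have e1 : ∀ j x, phi0 d j x * ∑ y, ∑ k, phi0 a y k * qf T j y x k =
      8 * ∑ y, ip T j y * (phi0 a y x * phi0 d j x)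
      - 4 * (T j x * phi0 d j x * ∑ y, ∑ k, phi0 a y k * T y k)
      - 4 * ∑ y, ∑ k, phi0 a y k * T y x * (T j k * phi0 d j x) := fun j x => by
    have f1 : ∀ y, ∑ k, phi0 a y k * qf T j y x k = 8 * (ip T j y * phi0 a y x)
        - 4 * (T j x * ∑ k, phi0 a y k * T y k) - 4 * ∑ k, phi0 a y k * T y x * T j k := fun y => by
      have g1 : ∀ k, phi0 a y k * qf T j y x k = 8 * (dl x k * (ip T j y * phi0 a y k))
          - 4 * (T j x * (phi0 a y k * T y k)) - 4 * (phi0 a y k * T y x * T j k) := fun k => by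
        rw [qf]; ring
      simp only [g1, Finset.sum_sub_distrib, ← Finset.mul_sum, sum_dl_mul]
    simp only [f1, Finset.sum_sub_distrib, ← Finset.mul_sum, mul_sub]
    simp only [Finset.mul_sum]
    congr 1
    · congr 1
      · exact Finset.sum_congr rfl fun y _ => by ring
      · exact sum_congr2 fun y k => by ring
    · exact sum_congr2 fun y k => by ring
  have e2 : ∑ j, ∑ x, T j x * phi0 d j x = 0 := by
    rw [← h.phi d]; exact sum_congr2 fun j x => by rw [phi0_rot]
  have e3 : ∑ j, ∑ x, ∑ y, ip T j y * (phi0 a y x * phi0 d j x)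
      = (∑ k, ip T k k) * dl a d - ip T a d := by
    rw [sum3_swap']
    have g1 : ∀ j y, ∑ x, ip T j y * (phi0 a y x * phi0 d j x) =
        dl a d * (dl y j * ip T j y) - dl a j * (dl y d * ip T j y)
          + ip T y j * psi0 a y d j := fun j y => by
      rw [← Finset.mul_sum, phi0_phi0, ip_comm T y j]; ring
    simp only [g1, Finset.sum_sub_distrib, Finset.sum_add_distrib, ← Finset.mul_sum, sum_dl_mul,
      sum_dl_mul']
    rw [Finset.sum_comm, sum_ip_psi0]; ring
  have e4 : ∑ j, ∑ x, ∑ y, ∑ k, phi0 a y k * T y x * (T j k * phi0 d j x)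
      = (∑ k, ip T k k) * dl a d - 4 * ip T a d := by
    rw [← h.cross_sum]
    simp only [Finset.mul_sum]
    rw [Finset.sum_comm]
    refine Finset.sum_congr rfl fun x _ => ?_
    rw [sum3_rot, sum3_rot]
  have e5 : ∑ j, ∑ x, T j x * phi0 d j x * ∑ y, ∑ k, phi0 a y k * T y k = 0 := by
    simp only [← Finset.sum_mul, e2, zero_mul]
  simp only [e1, Finset.sum_sub_distrib]
  simp only [← Finset.mul_sum (a := (8 : ℝ)), ← Finset.mul_sum (a := (4 : ℝ))]
  rw [e3, e5, e4]; ring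

theorem IsLambda14.sum_qf_phi0' {T : Fin 7 → Fin 7 → ℝ} (h : IsLambda14 T) (a d : Fin 7) :
    ∑ j, ∑ x, phi0 d j x * ∑ y, ∑ k, phi0 x y k * qf T j y a k
      = 20 * ip T a d - 8 * (∑ k, ip T k k) * dl a d := by
  have e1 : ∑ j, ∑ x, phi0 d j x * ∑ y, ∑ k, phi0 x y k * qf T j y a k
      = ∑ j, ∑ y, ∑ k, qf T j y a k * ∑ x, phi0 d j x * phi0 y k x := by
    refine Finset.sum_congr rfl fun j _ => ?_
    simp only [Finset.mul_sum]
    rw [sum3_rot]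
    exact sum_congr3 fun y k x => by rw [phi0_rot x y k]; ring
  have e2 : ∀ j y k, qf T j y a k * ∑ x, phi0 d j x * phi0 y k x = dl d y * (dl j k * qf T j y a k)
      - dl d k * (dl j y * qf T j y a k) + qf T j y a k * psi0 d j y k := fun j y k => by
    rw [phi0_phi0]; ring
  have e3 : ∑ j, ∑ y, ∑ k, qf T j y a k * psi0 d j y k = 0 := by
    have : ∀ j, ∑ y, ∑ k, qf T j y a k * psi0 d j y k = ∑ y, ∑ k, qf T j y a k * psi0 d j y k :=
      fun _ => rfl
    have := sum_skew_eq_zero (f := fun j y => ∑ k, qf T j y a k * psi0 d j y k) fun j y => by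
      rw [← Finset.sum_neg_distrib]
      exact Finset.sum_congr rfl fun k _ => by rw [qf_comm, psi0_swap']; ring
    exact this
  have e4 : ∀ k, qf T k d a k = qf T k d k a := fun k => qf_comm' _ _ _ _ _
  rw [e1]
  simp only [e2, Finset.sum_add_distrib, Finset.sum_sub_distrib, e3]
  simp only [← Finset.mul_sum, sum_dl_mul, e4, h.sum_qf_fst]
  have e6 : ∑ j, qf T j j a d = 8 * (∑ k, ip T k k) * dl a d - 8 * ip T a d := by
    have : ∀ j, qf T j j a d = 8 * dl a d * ip T j j - 8 * (T j a * T j d) := fun j => by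
      rw [qf]; ring
    simp only [this, Finset.sum_sub_distrib, ← Finset.mul_sum, h.ip_eq]; ring
  rw [e6, ip_comm T d a]; ring

/-! ### Endomorphisms acting on the standard form -/

/-- The components of the derivation defined by the matrix `A`, applied to the standard form. -/
def actArr (A : Fin 7 → Fin 7 → ℝ) (p q r : Fin 7) : ℝ :=
  ∑ m, (A m p * phi0 m q r + A m q * phi0 p m r + A m r * phi0 p q m)

/-- The ψ term is skew in k and d, so the symmetric part of the contraction is 4(A + Aᵀ) + 4 tr A
and retains only the symmetric part of A. -/
theorem ctr_actArr (A : Fin 7 → Fin 7 → ℝ) (k d : Fin 7) :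
    ctr (actArr A) k d = 4 * A d k + 2 * (∑ m, A m m) * dl k d
      + 2 * ∑ m, ∑ b, A m b * psi0 k m d b := by
  have e1 : ctr (actArr A) k d = ∑ b, ∑ c, ∑ m, A m k * (phi0 m b c * phi0 d b c)
      + ∑ b, ∑ c, ∑ m, A m b * (phi0 k m c * phi0 d b c)
      + ∑ b, ∑ c, ∑ m, A m c * (phi0 k b m * phi0 d b c) := by
    simp only [ctr, actArr, Finset.sum_mul, ← Finset.sum_add_distrib]
    exact sum_congr3 fun b c m => by ring
  have e2 : ∑ b, ∑ c, ∑ m, A m k * (phi0 m b c * phi0 d b c) = 6 * A d k := by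
    rw [sum3_rot, sum3_rot]
    have := phi0_phi0_two
    simp only [ctr] at this
    simp only [← Finset.mul_sum, this]
    simp [dl, mul_comm]
  have e3 : ∑ b, ∑ c, ∑ m, A m c * (phi0 k b m * phi0 d b c)
      = ∑ b, ∑ c, ∑ m, A m b * (phi0 k m c * phi0 d b c) := by
    rw [sum3_swap]
    exact sum_congr3 fun b c m => by rw [phi0_swap' k c m, phi0_swap' d c b]; ring
  have e4 : ∑ b, ∑ c, ∑ m, A m b * (phi0 k m c * phi0 d b c)
      = (∑ m, A m m) * dl k d - A d k + ∑ m, ∑ b, A m b * psi0 k m d b := by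
    rw [sum3_rot, sum3_rot]
    have g : ∀ m b, ∑ c, A m b * (phi0 k m c * phi0 d b c) = dl k d * (dl m b * A m b)
        - dl k b * (dl m d * A m b) + A m b * psi0 k m d b := fun m b => by
      rw [← Finset.mul_sum, phi0_phi0]; ring
    simp only [g, Finset.sum_sub_distrib, Finset.sum_add_distrib, ← Finset.mul_sum, sum_dl_mul,
      sum_dl_mul']
    ring
  rw [e1, e2, e3, e4]; ring

/-- Complement to `ctr_actArr`: only the skew part of A enters, through its contraction with φ. -/
theorem ctrPsi_actArr (A : Fin 7 → Fin 7 → ℝ) (a : Fin 7) :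
    ctrPsi (actArr A) a = 12 * ∑ m, ∑ p, A m p * phi0 m a p := by
  have e1 : ctrPsi (actArr A) a = ∑ p, ∑ q, ∑ r, (∑ m, A m p * phi0 m q r) * psi0 a p q r
      + ∑ p, ∑ q, ∑ r, (∑ m, A m q * phi0 p m r) * psi0 a p q r
      + ∑ p, ∑ q, ∑ r, (∑ m, A m r * phi0 p q m) * psi0 a p q r := by
    simp only [ctrPsi, actArr, ← Finset.sum_add_distrib, ← add_mul]
  have e2 : ∑ p, ∑ q, ∑ r, (∑ m, A m q * phi0 p m r) * psi0 a p q r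
      = ∑ p, ∑ q, ∑ r, (∑ m, A m p * phi0 m q r) * psi0 a p q r := by
    rw [sum3_swap]
    refine sum_congr3 fun p q r => ?_
    rw [psi0_swap', Finset.sum_mul, Finset.sum_mul]
    exact Finset.sum_congr rfl fun m _ => by rw [phi0_swap]; ring
  have e3 : ∑ p, ∑ q, ∑ r, (∑ m, A m r * phi0 p q m) * psi0 a p q r
      = ∑ p, ∑ q, ∑ r, (∑ m, A m p * phi0 m q r) * psi0 a p q r := by
    rw [sum3_rot, sum3_rot]
    refine sum_congr3 fun p q r => ?_
    rw [← psi0_rot3, Finset.sum_mul, Finset.sum_mul]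
    exact Finset.sum_congr rfl fun m _ => by rw [← phi0_rot]
  have e4 : ∑ p, ∑ q, ∑ r, (∑ m, A m p * phi0 m q r) * psi0 a p q r
      = 4 * ∑ m, ∑ p, A m p * phi0 m a p := by
    rw [Finset.sum_comm (f := fun m p => A m p * phi0 m a p), Finset.mul_sum]
    refine Finset.sum_congr rfl fun p _ => ?_
    simp only [Finset.sum_mul, Finset.mul_sum]
    rw [sum3_rot, sum3_rot]
    refine Finset.sum_congr rfl fun m _ => ?_
    simp only [mul_assoc, ← Finset.mul_sum, phi0_psi0_two]; ring
  rw [e1, e2, e3, e4]; ring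

/-! ### Curvature tensors -/

/-- The symmetries of `R_{ijkl} = g(R(∂ᵢ, ∂ⱼ)∂ₗ, ∂ₖ)`. -/
structure IsCurv (R : Fin 7 → Fin 7 → Fin 7 → Fin 7 → ℝ) : Prop where
  skew : ∀ i j k l, R i j k l = -R j i k l
  skew' : ∀ i j k l, R i j k l = -R i j l k
  bianchi : ∀ i j k l, R i j k l + R j l k i + R l i k j = 0

/-- The Ricci contraction. -/
def ric (R : Fin 7 → Fin 7 → Fin 7 → Fin 7 → ℝ) (i k : Fin 7) : ℝ := ∑ j, R i j k j

section
variable {R : Fin 7 → Fin 7 → Fin 7 → Fin 7 → ℝ}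

theorem IsCurv.pair (h : IsCurv R) (i j k l : Fin 7) : R i j k l = R k l i j := by
  have b1 := h.bianchi i j k l
  have b2 := h.bianchi j k l i
  have b3 := h.bianchi k l i j
  have b4 := h.bianchi l i j k
  have s1 := h.skew j l k i
  have s2 := h.skew l i k j
  have s3 := h.skew' j k l i
  have s4 := h.skew k i l j
  have s5 := h.skew' k l i j
  have s6 := h.skew' l j i k
  have s7 := h.skew j k i l
  have s8 := h.skew' j l k i
  have s9 := h.skew' l i j k
  have s10 := h.skew' i k j l
  have s11 := h.skew i j l k
  have s12 := h.skew' i j k l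
  have s13 := h.skew' k i l j
  have s14 := h.skew i k j l
  have s15 := h.skew' i k l j
  have s16 := h.skew l j i k
  have s17 := h.skew' l j k i
  have s18 := h.skew' j k i l
  linarith

theorem IsCurv.ric_comm (h : IsCurv R) (i k : Fin 7) : ric R i k = ric R k i :=
  Finset.sum_congr rfl fun j _ => h.pair i j k j

theorem IsCurv.bianchi' (h : IsCurv R) (i j k l : Fin 7) :
    R i j k l + R i k l j + R i l j k = 0 := by
  have := h.bianchi j k i l
  rw [h.pair i j k l, h.pair i k l j, h.pair i l j k]
  have s1 := h.skew' k l i j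
  have s2 := h.skew' l j i k
  have s3 := h.skew' j k i l
  have s4 := h.pair j k i l
  linarith [h.bianchi k l i j, h.pair k l i j, h.pair l j i k, h.pair j k i l]

/-- Rotating the summation indices fixes c and permutes the three terms of the Bianchi identity, so
three times the sum is zero. -/
theorem IsCurv.sum_alt (h : IsCurv R) {c : Fin 7 → Fin 7 → Fin 7 → ℝ} (hc : Alt3 c) (i : Fin 7) :
    ∑ j, ∑ m, ∑ b, R i j m b * c j m b = 0 := by
  have e1 : ∑ j, ∑ m, ∑ b, R i j m b * c j m b = ∑ j, ∑ m, ∑ b, R i m b j * c j m b := by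
    rw [sum3_rot, sum3_rot]
    exact sum_congr3 fun j m b => by rw [hc.rot j m b]
  have e2 : ∑ j, ∑ m, ∑ b, R i j m b * c j m b = ∑ j, ∑ m, ∑ b, R i b j m * c j m b := by
    rw [sum3_rot]
    exact sum_congr3 fun j m b => by rw [← hc.rot b j m]
  have e3 : ∑ j, ∑ m, ∑ b, R i j m b * c j m b + ∑ j, ∑ m, ∑ b, R i m b j * c j m b
      + ∑ j, ∑ m, ∑ b, R i b j m * c j m b = 0 := by
    simp only [← Finset.sum_add_distrib, ← add_mul, h.bianchi']
    simp
  linarith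

theorem IsCurv.sum_alt' (h : IsCurv R) {c : Fin 7 → Fin 7 → Fin 7 → ℝ} (hc : Alt3 c) (a : Fin 7) :
    ∑ b, ∑ j, ∑ m, R b j m a * c b j m = 0 := by
  rw [← neg_eq_zero, ← h.sum_alt hc a, sum3_rot, sum3_rot]
  simp only [← Finset.sum_neg_distrib]
  exact sum_congr3 fun m b j => by rw [h.pair, h.skew, hc.rot m b j]; ring

theorem IsCurv.sum_skew_diag (h : IsCurv R) (j m : Fin 7) : ∑ a, R a j m a = -ric R j m := by
  rw [ric, ← Finset.sum_neg_distrib]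
  exact Finset.sum_congr rfl fun a _ => h.skew _ _ _ _

/-- The curvature endomorphism acting on the standard form. -/
def curvAct (R : Fin 7 → Fin 7 → Fin 7 → Fin 7 → ℝ) (i j : Fin 7) : Fin 7 → Fin 7 → Fin 7 → ℝ :=
  actArr (R i j)

/-- In `ctr_actArr` the trace vanishes because the curvature endomorphism is skew, and the ψ term
vanishes by Bianchi. -/
theorem IsCurv.sum_ctr_curvAct (h : IsCurv R) (i d : Fin 7) :
    ∑ j, ctr (curvAct R i j) j d = 4 * ric R i d := by
  have e1 : ∀ j, ∑ m, R i j m m = 0 := fun j =>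
    Finset.sum_eq_zero fun m _ => by have := h.skew' i j m m; linarith
  simp only [curvAct, ctr_actArr, e1, Finset.sum_add_distrib, ← Finset.mul_sum]
  have e2 : ∑ j, ∑ m, ∑ b, R i j m b * psi0 j m d b = 0 := by
    have := h.sum_alt (alt3_psi0 d) i
    rw [← this]
    exact sum_congr3 fun j m b => by rw [psi0_swap' j, psi0_swap j]; ring
  rw [e2, ric]; simp

/-- The contraction `R_{bcjm} φ_{dbc} φ_{ajm}`. -/
def curvG (R : Fin 7 → Fin 7 → Fin 7 → Fin 7 → ℝ) (a d : Fin 7) : ℝ :=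
  ∑ b, ∑ c, phi0 d b c * ∑ j, ∑ m, R b c j m * phi0 a j m

theorem IsCurv.curvG_comm (h : IsCurv R) (a d : Fin 7) : curvG R a d = curvG R d a := by
  simp only [curvG, Finset.mul_sum]
  calc _ = ∑ b, ∑ j, ∑ m, ∑ c, phi0 d b c * (R b c j m * phi0 a j m) :=
        Finset.sum_congr rfl fun b _ => by rw [sum3_rot]
    _ = ∑ j, ∑ m, ∑ b, ∑ c, phi0 d b c * (R b c j m * phi0 a j m) := by rw [sum3_rot]
    _ = _ := by
      refine sum_congr2 fun j m => sum_congr2 fun b c => ?_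
      rw [h.pair]; ring

/-- One term for each slot of φ. The outer two reduce to Ricci and scalar curvature by φφ
contractions; in the middle one Bianchi turns R_{bjmc} into R_{bcjm}, with the factor -1/2. -/
theorem IsCurv.sum_phi0_curvAct (h : IsCurv R) (a d : Fin 7) :
    ∑ b, ∑ c, phi0 d b c * ∑ j, curvAct R b j j c a =
      (∑ b, ric R b b) * dl a d - 2 * ric R a d - 1 / 2 * curvG R a d := by
  have e1 : ∑ b, ∑ c, phi0 d b c * ∑ j, curvAct R b j j c a
      = ∑ b, ∑ m, ∑ c, ric R b m * (phi0 a m c * phi0 d b c)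
      + ∑ b, ∑ c, phi0 d b c * ∑ j, ∑ m, R b j m c * phi0 a j m
      + ∑ b, ∑ j, ∑ m, ∑ c, R b j m a * (phi0 m j c * phi0 d b c) := by
    have f1 : ∑ b, ∑ m, ∑ c, ric R b m * (phi0 a m c * phi0 d b c)
        = ∑ b, ∑ c, phi0 d b c * ∑ j, ∑ m, R b j m j * phi0 m c a := by
      refine Finset.sum_congr rfl fun b _ => ?_
      rw [Finset.sum_comm]
      refine Finset.sum_congr rfl fun c _ => ?_
      rw [Finset.sum_comm (f := fun j m => R b j m j * phi0 m c a), Finset.mul_sum]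
      refine Finset.sum_congr rfl fun m _ => ?_
      rw [← Finset.sum_mul, phi0_rot a m c, ric]; ring
    have f2 : ∑ b, ∑ j, ∑ m, ∑ c, R b j m a * (phi0 m j c * phi0 d b c)
        = ∑ b, ∑ c, phi0 d b c * ∑ j, ∑ m, R b j m a * phi0 j c m := by
      refine Finset.sum_congr rfl fun b _ => ?_
      simp only [Finset.mul_sum]
      rw [sum3_rot, sum3_rot]
      exact sum_congr3 fun c j m => by rw [← phi0_rot m j c]; ring
    rw [f1, f2]
    simp only [← Finset.sum_add_distrib, ← mul_add, curvAct, actArr]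
    refine sum_congr2 fun b c => ?_
    congr 1
    exact sum_congr2 fun j m => by rw [← phi0_rot a j m]
  have e2 : ∑ b, ∑ m, ∑ c, ric R b m * (phi0 a m c * phi0 d b c)
      = (∑ b, ric R b b) * dl a d - ric R a d := by
    have g : ∀ b m, ∑ c, ric R b m * (phi0 a m c * phi0 d b c) = dl a d * (dl m b * ric R b m)
        - dl a b * (dl m d * ric R b m) + ric R b m * psi0 a m d b := fun b m => by
      rw [← Finset.mul_sum, phi0_phi0]; ring
    have g2 : ∑ b, ∑ m, ric R b m * psi0 a m d b = 0 := sum_skew_eq_zero fun b m => by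
      rw [h.ric_comm b m, psi0_swap' a m d b, psi0_swap'' a d m b, psi0_swap' a d b m]; ring
    simp only [g, Finset.sum_sub_distrib, Finset.sum_add_distrib, ← Finset.mul_sum, sum_dl_mul,
      sum_dl_mul', g2]
    ring
  have e3 : ∑ b, ∑ c, phi0 d b c * ∑ j, ∑ m, R b j m c * phi0 a j m = -(1 / 2) * curvG R a d := by
    rw [curvG, Finset.mul_sum]
    refine Finset.sum_congr rfl fun b _ => ?_
    rw [Finset.mul_sum]
    refine Finset.sum_congr rfl fun c _ => ?_
    have g : ∑ j, ∑ m, R b j m c * phi0 a j m = -∑ j, ∑ m, R b m j c * phi0 a j m := by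
      rw [Finset.sum_comm]
      simp only [← Finset.sum_neg_distrib]
      exact sum_congr2 fun j m => by rw [phi0_swap']; ring
    have g2 : ∑ j, ∑ m, R b j m c * phi0 a j m - ∑ j, ∑ m, R b m j c * phi0 a j m
        + ∑ j, ∑ m, R b c j m * phi0 a j m = 0 := by
      simp only [← Finset.sum_add_distrib, ← Finset.sum_sub_distrib, ← sub_mul, ← add_mul]
      refine Finset.sum_eq_zero fun j _ => Finset.sum_eq_zero fun m _ => ?_
      have := h.bianchi' b j m c
      have := h.skew' b m j c
      have e : R b j m c - R b m j c + R b c j m = 0 := by linarith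
      rw [e, zero_mul]
    have g3 : ∑ j, ∑ m, R b j m c * phi0 a j m = -(1 / 2) * ∑ j, ∑ m, R b c j m * phi0 a j m := by
      linarith
    rw [g3]; ring
  have e4 : ∑ b, ∑ j, ∑ m, ∑ c, R b j m a * (phi0 m j c * phi0 d b c) = -ric R a d := by
    have g : ∀ b j m, ∑ c, R b j m a * (phi0 m j c * phi0 d b c) = dl m d * (dl j b * R b j m a)
        - dl j d * (dl m b * R b j m a) - R b j m a * psi0 d b j m := fun b j m => by
      rw [← Finset.mul_sum, phi0_phi0]
      have : psi0 m j d b = -psi0 d b j m := by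
        rw [psi0_swap' m, psi0_swap m, psi0_swap'' d, psi0_swap' d, psi0_swap'' d]; ring
      rw [this]; ring
    simp only [g, Finset.sum_sub_distrib, ← Finset.mul_sum, sum_dl_mul']
    rw [h.sum_alt' (alt3_psi0 d) a]
    have g1 : ∀ b, R b b d a = 0 := fun b => by have := h.skew b b d a; linarith
    have g2 : ∑ b, R b d b a = ric R a d := by
      rw [h.ric_comm, ric]
      exact Finset.sum_congr rfl fun b _ => by rw [h.skew, h.skew']; ring
    simp only [g1, g2]; simp
  rw [e1, e2, e3, e4]; ring

theorem IsCurv.sum_sum_curvAct (h : IsCurv R) (n : Fin 7) :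
    ∑ a, ∑ j, curvAct R a j j a n = 0 := by
  have e1 : ∑ a, ∑ j, curvAct R a j j a n = ∑ a, ∑ m, ric R a m * phi0 m a n
      + ∑ j, ∑ m, (∑ a, R a j m a) * phi0 j m n + ∑ a, ∑ j, ∑ m, R a j m n * phi0 j a m := by
    have f1 : ∑ a, ∑ m, ric R a m * phi0 m a n = ∑ a, ∑ j, ∑ m, R a j m j * phi0 m a n := by
      refine Finset.sum_congr rfl fun a _ => ?_
      rw [Finset.sum_comm]
      exact Finset.sum_congr rfl fun m _ => by rw [ric, Finset.sum_mul]
    have f2 : ∑ j, ∑ m, (∑ a, R a j m a) * phi0 j m n = ∑ a, ∑ j, ∑ m, R a j m a * phi0 j m n := by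
      simp only [Finset.sum_mul]
      rw [sum3_rot, sum3_rot]
    rw [f1, f2]
    simp only [← Finset.sum_add_distrib, curvAct, actArr]
  have e2 : ∑ a, ∑ m, ric R a m * phi0 m a n = 0 := sum_skew_eq_zero fun a m => by
    rw [h.ric_comm, phi0_swap]; ring
  have e3 : ∑ j, ∑ m, (∑ a, R a j m a) * phi0 j m n = 0 := sum_skew_eq_zero fun a m => by
    rw [h.sum_skew_diag, h.sum_skew_diag, h.ric_comm, phi0_swap]; ring
  have e4 : ∑ a, ∑ j, ∑ m, R a j m n * phi0 j a m = 0 := by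
    have := h.sum_alt' alt3_phi0 n
    rw [← neg_eq_zero, ← this]
    simp only [← Finset.sum_neg_distrib]
    exact sum_congr3 fun a j m => by rw [phi0_swap j a]; ring
  rw [e1, e2, e3, e4]; simp

end

/-! ### The second jet of a closed `G₂` structure -/

/-- The skew part of `ctr` is governed by the component of dimension 7 alone; this is the φψ
identity contracted with β. -/
theorem Alt3.ctr_sub {β : Fin 7 → Fin 7 → Fin 7 → ℝ} (h : Alt3 β) (k d : Fin 7) :
    ctr β k d - ctr β d k = 1 / 3 * ∑ m, ctrPsi β m * phi0 m k d := by
  have e1 : ∑ m, ctrPsi β m * phi0 m k d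
      = ∑ a, ∑ b, ∑ c, -(β a b c * ∑ m, phi0 k d m * psi0 a b c m) := by
    simp only [ctrPsi, Finset.sum_mul, Finset.mul_sum, ← Finset.sum_neg_distrib]
    rw [Finset.sum_comm]
    refine Finset.sum_congr rfl fun a _ => ?_
    rw [sum3_rot]
    refine sum_congr3 fun b c m => ?_
    rw [psi0_swap, psi0_swap', psi0_swap'', phi0_rot m]; ring
  have e2 : ∀ a b c, -(β a b c * ∑ m, phi0 k d m * psi0 a b c m) =
      dl k a * (β a b c * phi0 d b c) + dl k b * (β b c a * phi0 d c a)
      + dl k c * (β c a b * phi0 d a b) - dl d a * (β a b c * phi0 k b c)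
      - dl d b * (β b c a * phi0 k c a) - dl d c * (β c a b * phi0 k a b) := fun a b c => by
    rw [phi0_psi0, ← h.rot a b c, h.rot c a b, phi0_swap a d c, phi0_swap' d a c, phi0_rot d a b,
      phi0_swap a k c, phi0_swap' k a c, phi0_rot k a b]; ring
  have e3 : ∀ k d, ∑ a, ∑ b, ∑ c, dl k a * (β a b c * phi0 d b c) = ctr β k d := fun k d => by
    simp only [← Finset.mul_sum, sum_dl_mul]; rfl
  have e4 : ∀ k d, ∑ a, ∑ b, ∑ c, dl k b * (β b c a * phi0 d c a) = ctr β k d := fun k d => by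
    rw [sum3_rot, e3]
  have e5 : ∀ k d, ∑ a, ∑ b, ∑ c, dl k c * (β c a b * phi0 d a b) = ctr β k d := fun k d => by
    rw [sum3_rot, sum3_rot, e3]
  rw [e1]
  simp only [e2, Finset.sum_sub_distrib, Finset.sum_add_distrib, e3, e4, e5]
  ring

/-- The components at a point of `∇φ`, `∇∇φ` and the curvature tensor, for a closed
`G₂` structure `φ` with the standard value at the point. -/
structure IsSecondJet (F : Fin 7 → Fin 7 → Fin 7 → Fin 7 → ℝ)
    (W : Fin 7 → Fin 7 → Fin 7 → Fin 7 → Fin 7 → ℝ) (R : Fin 7 → Fin 7 → Fin 7 → Fin 7 → ℝ) :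
    Prop where
  closed : ClosedFam F
  metric : ∀ i k d, ctr (F i) k d + ctr (F i) d k = 0
  closed' : ∀ i, ClosedFam (W i)
  metric' : ∀ i j k d, ctr (W i j) k d + ctr (W i j) d k =
    -(∑ b, ∑ c, F i k b c * F j d b c + ∑ b, ∑ c, F i d b c * F j k b c)
  comm : ∀ i j a b c, W i j a b c - W j i a b c = -curvAct R i j a b c
  curv : IsCurv R

/-- The components of `dd*φ` in terms of those of `∇∇φ`. -/
def lapArr (W : Fin 7 → Fin 7 → Fin 7 → Fin 7 → Fin 7 → ℝ) (a b c : Fin 7) : ℝ :=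
  -∑ j, (W a j j b c + W b j j c a + W c j j a b)

section
variable {F : Fin 7 → Fin 7 → Fin 7 → Fin 7 → ℝ}
  {W : Fin 7 → Fin 7 → Fin 7 → Fin 7 → Fin 7 → ℝ} {R : Fin 7 → Fin 7 → Fin 7 → Fin 7 → ℝ}

theorem IsSecondJet.lambda14 (h : IsSecondJet F W R) : IsLambda14 (tor F) :=
  h.closed.isLambda14_tor h.metric

theorem IsSecondJet.ctr_symm (h : IsSecondJet F W R) (i j k d : Fin 7) :
    ctr (W i j) k d + ctr (W i j) d k = -qf (tor F) i j k d := by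
  rw [h.metric', qf_eq (eq_tor h.closed.alt h.metric)]

/-- `ClosedFam.sum_ctr` for W_i: the diagonal of `ctr` is half of its symmetric part, which is
quadratic in the torsion. -/
theorem IsSecondJet.sum_ctr (h : IsSecondJet F W R) (i j : Fin 7) :
    ∑ k, ctr (W i k) j k = -8 * ip (tor F) i j := by
  have h1 := (h.closed' i).sum_ctr j
  have h2 : ∀ k, ctr (W i j) k k = -(1 / 2) * qf (tor F) i j k k := fun k => by
    have := h.ctr_symm i j k k; linarith
  simp only [h2, ← Finset.mul_sum, sum_qf_diag] at h1
  linarith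

theorem IsSecondJet.sum_ctr' (h : IsSecondJet F W R) (i j : Fin 7) :
    ∑ k, ctr (W i k) k j = -4 * ip (tor F) i j := by
  have h1 : ∀ k, ctr (W i k) k j = -qf (tor F) i k j k - ctr (W i k) j k := fun k => by
    have := h.ctr_symm i k j k; linarith
  simp only [h1, Finset.sum_sub_distrib, Finset.sum_neg_distrib, h.lambda14.sum_qf_snd, h.sum_ctr]
  ring

theorem ctr_sub_of {β γ δ : Fin 7 → Fin 7 → Fin 7 → ℝ}
    (h : ∀ a b c, β a b c - γ a b c = -δ a b c) (k d : Fin 7) :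
    ctr β k d - ctr γ k d = -ctr δ k d := by
  simp only [ctr, ← Finset.sum_sub_distrib, ← Finset.sum_neg_distrib, ← sub_mul, h, neg_mul]

theorem ctrPsi_sub_of {β γ δ : Fin 7 → Fin 7 → Fin 7 → ℝ}
    (h : ∀ a b c, β a b c - γ a b c = -δ a b c) (m : Fin 7) :
    ctrPsi β m - ctrPsi γ m = -ctrPsi δ m := by
  simp only [ctrPsi, ← Finset.sum_sub_distrib, ← Finset.sum_neg_distrib, ← sub_mul, h, neg_mul]

/-- Ricci enters here, from exchanging the two derivatives. -/
theorem IsSecondJet.sum_ctr_fst (h : IsSecondJet F W R) (i d : Fin 7) :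
    ∑ j, ctr (W j i) j d = 4 * ric R i d - 4 * ip (tor F) i d := by
  have h1 : ∀ j, ctr (W j i) j d = ctr (W i j) j d + ctr (curvAct R i j) j d := fun j => by
    have := ctr_sub_of (h.comm i j) j d; linarith
  simp only [h1, Finset.sum_add_distrib, h.sum_ctr', h.curv.sum_ctr_curvAct]; ring

/-- One double trace of ∇∇φ computed in two ways, by `IsSecondJet.sum_ctr` and by
`IsSecondJet.sum_ctr_fst`. -/
theorem IsSecondJet.scal (h : IsSecondJet F W R) :
    ∑ i, ric R i i = -∑ i, ip (tor F) i i := by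
  have h1 : ∑ i, ∑ j, ctr (W j i) j i = ∑ i, (4 * ric R i i - 4 * ip (tor F) i i) :=
    Finset.sum_congr rfl fun i _ => h.sum_ctr_fst i i
  rw [Finset.sum_comm] at h1
  simp only [h.sum_ctr, Finset.sum_sub_distrib, ← Finset.mul_sum] at h1
  linarith

/-- Contraction with φ_{djx} antisymmetrizes the two derivatives, and the Ricci identity converts
the result into curvature. -/
theorem IsSecondJet.curvG_eq_sum (h : IsSecondJet F W R) (a d : Fin 7) :
    12 * curvG R a d = 2 * ∑ j, ∑ x, phi0 d j x * ctrPsi (W j x) a := by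
  have h1 : ∀ j x, ctrPsi (W j x) a - ctrPsi (W x j) a
      = 12 * ∑ m, ∑ p, R j x m p * phi0 a m p := fun j x => by
    rw [ctrPsi_sub_of (h.comm j x), curvAct, ctrPsi_actArr, ← mul_neg, ← Finset.sum_neg_distrib]
    congr 1
    refine Finset.sum_congr rfl fun m _ => ?_
    rw [← Finset.sum_neg_distrib]
    exact Finset.sum_congr rfl fun p _ => by rw [phi0_swap m a p]; ring
  have h2 : ∑ j, ∑ x, phi0 d j x * (ctrPsi (W j x) a - ctrPsi (W x j) a) = 12 * curvG R a d := by
    simp only [h1, curvG, Finset.mul_sum (a := (12 : ℝ))]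
    exact sum_congr2 fun j x => by simp only [Finset.mul_sum]; exact sum_congr2 fun _ _ => by ring
  have h3 : ∑ j, ∑ x, phi0 d j x * ctrPsi (W x j) a = -∑ j, ∑ x, phi0 d j x * ctrPsi (W j x) a := by
    rw [Finset.sum_comm]
    simp only [← Finset.sum_neg_distrib]
    exact sum_congr2 fun j x => by rw [phi0_swap']; ring
  simp only [mul_sub, Finset.sum_sub_distrib, h3] at h2
  linarith

/-- The sum over j of the skew part of ctr(W_{ja}) is computed twice: from
`IsSecondJet.sum_ctr_fst`, which yields Ricci, and from `Alt3.ctr_sub`, where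
`ClosedFam.ctrPsi_symm` exchanges two indices and leads to `curvG` plus terms quadratic in T. -/
theorem IsSecondJet.curvG_eq (h : IsSecondJet F W R) (a d : Fin 7) :
    curvG R a d = 4 * ric R a d - 12 * ip (tor F) a d
      + 2 * (∑ k, ip (tor F) k k) * dl a d := by
  have h1 : ∀ j, 2 * ctr (W j a) j d + qf (tor F) j a j d
      = 1 / 3 * ∑ m, ctrPsi (W j a) m * phi0 m j d := fun j => by
    rw [← ((h.closed' j).alt a).ctr_sub]
    have := h.ctr_symm j a j d; linarith
  have h2 : ∑ j, (2 * ctr (W j a) j d + qf (tor F) j a j d)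
      = 8 * ric R a d + 4 * ip (tor F) a d := by
    simp only [Finset.sum_add_distrib, ← Finset.mul_sum, h.sum_ctr_fst, h.lambda14.sum_qf_fst]
    ring
  have h3 : ∀ j m, ctrPsi (W j a) m * phi0 m j d = phi0 d j m * ctrPsi (W j m) a
      + 3 * (phi0 d j m * ∑ y, ∑ k, phi0 m y k * qf (tor F) j y a k)
      + 3 * (phi0 d j m * ∑ y, ∑ k, phi0 a y k * qf (tor F) j y m k) := fun j m => by
    have := (h.closed' j).ctrPsi_symm (q := qf (tor F) j) (h.ctr_symm j) a m
    rw [phi0_swap13 m j d]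
    linear_combination -(phi0 d j m) * this
  simp only [h1, h3, ← Finset.mul_sum, Finset.sum_add_distrib, h.lambda14.sum_qf_phi0,
    h.lambda14.sum_qf_phi0'] at h2
  have h4 := h.curvG_eq_sum a d
  linarith

/-- Divergence terms are known from the traces above. The terms whose outer derivative is contracted
with φ are brought to the form of `ClosedFam.two_mul_sum` by commuting derivatives, and the
curvature so produced is `IsCurv.sum_phi0_curvAct`. The multiples of |T|² δ cancel. -/
theorem IsSecondJet.ctr_lapArr (h : IsSecondJet F W R) (a d : Fin 7) :
    ctr (lapArr W) a d + ctr (lapArr W) d a = -8 * ric R a d + 16 * ip (tor F) a d := by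
  have key : ∀ a d, ctr (lapArr W) a d = 4 * ip (tor F) a d - ∑ j, ctr (W j j) a d
      + ∑ j, ctr (W j a) j d + 2 * ∑ b, ∑ c, phi0 d b c * ∑ j, curvAct R b j j c a := by
    intro a d
    have e1 : ctr (lapArr W) a d = -∑ j, ctr (W a j) j d
        - ∑ b, ∑ c, phi0 d b c * ∑ j, W b j j c a - ∑ b, ∑ c, phi0 d b c * ∑ j, W c j j a b := by
      have f : ∑ j, ctr (W a j) j d = ∑ b, ∑ c, phi0 d b c * ∑ j, W a j j b c := by
        simp only [ctr, Finset.mul_sum]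
        rw [sum3_rot]
        exact sum_congr3 fun b c j => mul_comm _ _
      rw [f]
      simp only [ctr, lapArr, ← Finset.sum_sub_distrib, ← Finset.sum_neg_distrib]
      refine sum_congr2 fun b c => ?_
      simp only [Finset.sum_neg_distrib, Finset.sum_add_distrib]
      ring
    have e2 : ∑ b, ∑ c, phi0 d b c * ∑ j, W c j j a b = ∑ b, ∑ c, phi0 d b c * ∑ j, W b j j c a := by
      rw [Finset.sum_comm]
      refine sum_congr2 fun b c => ?_
      rw [phi0_swap', neg_mul, ← mul_neg, ← Finset.sum_neg_distrib]
      congr 1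
      exact Finset.sum_congr rfl fun j _ => by rw [((h.closed' b).alt j).swap']; ring
    have e3 : ∑ b, ∑ c, phi0 d b c * ∑ j, W b j j c a = ∑ j, ∑ b, ∑ c, phi0 d b c * W j b c a j
        - ∑ b, ∑ c, phi0 d b c * ∑ j, curvAct R b j j c a := by
      rw [sum3_rot (f := fun j b c => phi0 d b c * W j b c a j)]
      simp only [← Finset.sum_sub_distrib, ← Finset.mul_sum, ← mul_sub]
      refine sum_congr2 fun b c => ?_
      congr 1
      refine Finset.sum_congr rfl fun j _ => ?_
      have := h.comm b j j c a
      rw [← ((h.closed' j).alt b).rot j c a]; linarith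
    have e4 : ∀ j, ∑ b, ∑ c, phi0 d b c * W j b c a j
        = 1 / 2 * (ctr (W j j) a d - ctr (W j a) j d) := fun j => by
      rw [← (h.closed' j).two_mul_sum]; ring
    rw [e1, e2, e3]
    simp only [e4, h.sum_ctr', ← Finset.mul_sum, Finset.sum_sub_distrib]
    ring
  have e5 : ∑ j, ctr (W j j) a d + ∑ j, ctr (W j j) d a
      = -8 * (∑ k, ip (tor F) k k) * dl a d + 8 * ip (tor F) a d := by
    rw [← Finset.sum_add_distrib]
    simp only [h.ctr_symm]
    have : ∀ j, -qf (tor F) j j a d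
        = -8 * dl a d * ip (tor F) j j + 8 * (tor F j a * tor F j d) := fun j => by
      rw [qf]; ring
    simp only [this, Finset.sum_add_distrib, ← Finset.mul_sum, h.lambda14.ip_eq]; ring
  rw [key, key, h.sum_ctr_fst, h.sum_ctr_fst, h.curv.sum_phi0_curvAct, h.curv.sum_phi0_curvAct,
    h.curv.curvG_comm d a, h.curvG_eq, h.scal, h.curv.ric_comm d a, dl_comm d a, ip_comm _ d a]
  linear_combination -e5

/-- Expanding ψ leaves a symmetric tensor paired with the skew φ, and the trace of W_{aj;jan}.
Commuting the derivatives in that trace costs nothing by `IsCurv.sum_sum_curvAct`, while skewness of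
the form makes it equal to its negative. -/
theorem IsSecondJet.ctrPsi_lapArr (h : IsSecondJet F W R) (n : Fin 7) :
    ctrPsi (lapArr W) n = 0 := by
  have e0 : ctrPsi (lapArr W) n = -3 * ∑ a, ∑ b, ∑ c, (∑ j, W a j j b c) * psi0 n a b c := by
    have f2 : ∑ a, ∑ b, ∑ c, (∑ j, W b j j c a) * psi0 n a b c
        = ∑ a, ∑ b, ∑ c, (∑ j, W a j j b c) * psi0 n a b c := by
      rw [sum3_rot]
      exact sum_congr3 fun a b c => by rw [psi0_rot3]
    have f3 : ∑ a, ∑ b, ∑ c, (∑ j, W c j j a b) * psi0 n a b c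
        = ∑ a, ∑ b, ∑ c, (∑ j, W a j j b c) * psi0 n a b c := by
      rw [sum3_rot, sum3_rot]
      exact sum_congr3 fun a b c => by rw [← psi0_rot3]
    have f1 : ctrPsi (lapArr W) n = -(∑ a, ∑ b, ∑ c, (∑ j, W a j j b c) * psi0 n a b c
        + ∑ a, ∑ b, ∑ c, (∑ j, W b j j c a) * psi0 n a b c
        + ∑ a, ∑ b, ∑ c, (∑ j, W c j j a b) * psi0 n a b c) := by
      simp only [ctrPsi, lapArr, ← Finset.sum_add_distrib, ← Finset.sum_neg_distrib, ← add_mul,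
        ← neg_mul]
    rw [f1, f2, f3]; ring
  have e1 : ∑ a, ∑ b, ∑ c, (∑ j, W a j j b c) * psi0 n a b c
      = ∑ a, ∑ k, phi0 n a k * ∑ j, ctr (W a j) j k + 2 * ∑ a, ∑ j, W a j j a n := by
    rw [Finset.mul_sum, ← Finset.sum_add_distrib]
    refine Finset.sum_congr rfl fun a _ => ?_
    have g : ∀ b c, (∑ j, W a j j b c) * psi0 n a b c = ∑ k, phi0 n a k * ∑ j, W a j j b c * phi0 k b c
        - dl n b * (dl a c * ∑ j, W a j j b c) + dl n c * (dl a b * ∑ j, W a j j b c) :=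
      fun b c => by
        rw [psi0_eq]
        have : ∑ k, phi0 n a k * ∑ j, W a j j b c * phi0 k b c
            = (∑ j, W a j j b c) * ∑ k, phi0 n a k * phi0 b c k := by
          rw [Finset.mul_sum]
          exact Finset.sum_congr rfl fun k _ => by rw [← Finset.sum_mul, phi0_rot k b c]; ring
        rw [this]; ring
    have g1 : ∑ b, ∑ c, ∑ k, phi0 n a k * ∑ j, W a j j b c * phi0 k b c
        = ∑ k, phi0 n a k * ∑ j, ctr (W a j) j k := by
      rw [sum3_rot, sum3_rot]
      refine Finset.sum_congr rfl fun k _ => ?_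
      simp only [← Finset.mul_sum, ctr]
      rw [sum3_rot, sum3_rot]
    have g2 : ∑ b, ∑ c, dl n c * (dl a b * ∑ j, W a j j b c) = ∑ j, W a j j a n := by
      rw [Finset.sum_comm]; simp only [← Finset.mul_sum, sum_dl_mul]
    have g3 : ∑ j, W a j j n a = -∑ j, W a j j a n := by
      rw [← Finset.sum_neg_distrib]
      exact Finset.sum_congr rfl fun j _ => ((h.closed' a).alt j).swap' _ _ _
    simp only [g, Finset.sum_sub_distrib, Finset.sum_add_distrib, g1, g2]
    simp only [← Finset.mul_sum, sum_dl_mul, g3]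
    ring
  have e2 : ∑ a, ∑ k, phi0 n a k * ∑ j, ctr (W a j) j k = 0 := sum_skew_eq_zero fun a k => by
    rw [h.sum_ctr', h.sum_ctr', ip_comm, phi0_swap']; ring
  have e3 : ∑ a, ∑ j, W a j j a n = 0 := by
    have f1 : ∑ a, ∑ j, W a j j a n = -∑ a, ∑ j, W j a j a n := by
      rw [Finset.sum_comm]
      simp only [← Finset.sum_neg_distrib]
      exact sum_congr2 fun a j => ((h.closed' j).alt a).swap _ _ _
    have f2 : ∑ a, ∑ j, W a j j a n - ∑ a, ∑ j, W j a j a n = 0 := by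
      rw [← neg_eq_zero, ← h.curv.sum_sum_curvAct n]
      simp only [← Finset.sum_sub_distrib, ← Finset.sum_neg_distrib]
      exact sum_congr2 fun a j => by have := h.comm a j j a n; linarith
    linarith
  rw [e0, e1, e2, e3]; simp

end

/-! ### The totally antisymmetric symbol -/

/-- The sign of `b - a`. -/
def sgZ (a b : Fin 7) : ℤ := if a = b then 0 else if a < b then 1 else -1

/-- The totally antisymmetric symbol with values in `ℤ`. -/
def epsZ (x : Fin 7 → Fin 7) : ℤ := ∏ j, ∏ i ∈ Finset.Iio j, sgZ (x i) (x j)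

theorem epsZ_perm (σ : Equiv.Perm (Fin 7)) : epsZ σ = Equiv.Perm.sign σ := by
  rw [Equiv.Perm.sign_eq_prod_prod_Iio, epsZ]
  push_cast
  refine Finset.prod_congr rfl fun j _ => Finset.prod_congr rfl fun i hi => ?_
  have : σ i ≠ σ j := fun h => (Finset.mem_Iio.1 hi).ne (σ.injective h)
  rw [sgZ, if_neg this]
  split_ifs <;> simp

theorem epsZ_of_not_injective {x : Fin 7 → Fin 7} (h : ¬ Function.Injective x) : epsZ x = 0 := by
  have : ∃ i j, i < j ∧ x i = x j := by
    simp only [Function.Injective, not_forall] at h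
    obtain ⟨a, b, hab, hne⟩ := h
    rcases lt_or_gt_of_ne hne with h1 | h1
    exacts [⟨a, b, h1, hab⟩, ⟨b, a, h1, hab.symm⟩]
  obtain ⟨i, j, hij, hx⟩ := this
  exact Finset.prod_eq_zero (Finset.mem_univ j)
    (Finset.prod_eq_zero (Finset.mem_Iio.2 hij) (by simp [sgZ, hx]))

theorem det_submatrix_one (x : Fin 7 → Fin 7) :
    ((1 : Matrix (Fin 7) (Fin 7) ℝ).submatrix x id).det = epsZ x := by
  by_cases h : Function.Injective x
  · obtain ⟨σ, rfl⟩ : ∃ σ : Equiv.Perm (Fin 7), ⇑σ = x :=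
      ⟨Equiv.ofBijective x (Finite.injective_iff_bijective.1 h), rfl⟩
    rw [Matrix.det_permute, epsZ_perm]; simp
  · rw [epsZ_of_not_injective h]
    simp only [Function.Injective, not_forall] at h
    obtain ⟨a, b, hab, hne⟩ := h
    rw [Matrix.det_zero_of_row_eq hne]
    · simp
    · ext k; exact congrArg (fun t => (1 : Matrix (Fin 7) (Fin 7) ℝ) t k) hab

/-- A sum over all maps can be nested index by index, which a sum over permutations cannot;
noninjective maps contribute zero. -/
theorem sum_perm_eq {R : Type*} [CommRing R] (f : (Fin 7 → Fin 7) → R) :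
    ∑ σ : Equiv.Perm (Fin 7), ((Equiv.Perm.sign σ : ℤ) : R) * f σ
      = ∑ x : Fin 7 → Fin 7, (epsZ x : R) * f x := by
  classical
  have h1 : ∑ x : Fin 7 → Fin 7, (epsZ x : R) * f x
      = ∑ x ∈ Finset.univ.filter (fun x : Fin 7 → Fin 7 => Function.Injective x),
        (epsZ x : R) * f x := by
    rw [Finset.sum_filter]
    refine Finset.sum_congr rfl fun x _ => ?_
    split_ifs with h
    · rfl
    · rw [epsZ_of_not_injective h]; simp
  rw [h1]
  refine Finset.sum_bij (fun σ _ => ⇑σ) (fun σ _ => by simp [σ.injective])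
    (fun σ _ τ _ h => Equiv.coe_fn_injective h) (fun x hx => ?_) (fun σ _ => by rw [epsZ_perm])
  have h : Function.Injective x := by simpa using hx
  exact ⟨Equiv.ofBijective x (Finite.injective_iff_bijective.1 h), Finset.mem_univ _, rfl⟩

theorem sum_fin_succ_arrow {R : Type*} [AddCommMonoid R] {n : ℕ} (f : (Fin (n + 1) → Fin 7) → R) :
    ∑ x, f x = ∑ a, ∑ y : Fin n → Fin 7, f (Matrix.vecCons a y) := by
  rw [← Fintype.sum_prod_type', ← (Fin.consEquiv fun _ => Fin 7).sum_comp]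
  rfl

theorem sum_fin_zero_arrow {R : Type*} [AddCommMonoid R] (f : (Fin 0 → Fin 7) → R) :
    ∑ x, f x = f ![] := by
  rw [Fintype.sum_unique]; congr 1

/-- The factor that the last index contributes to the antisymmetric symbol. -/
def sgs (l : List (Fin 7)) (b : Fin 7) : ℤ := l.foldr (fun a r => sgZ a b * r) 1

theorem epsZ_vec (a b c d e f g : Fin 7) : epsZ ![a, b, c, d, e, f, g] =
    sgs [a] b * sgs [a, b] c * sgs [a, b, c] d * sgs [a, b, c, d] e * sgs [a, b, c, d, e] f
      * sgs [a, b, c, d, e, f] g := by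
  have h1 : Finset.Iio (0 : Fin 7) = ∅ := by decide
  have h2 : Finset.Iio (1 : Fin 7) = {0} := by decide
  have h3 : Finset.Iio (2 : Fin 7) = {0, 1} := by decide
  have h4 : Finset.Iio (3 : Fin 7) = {0, 1, 2} := by decide
  have h5 : Finset.Iio (4 : Fin 7) = {0, 1, 2, 3} := by decide
  have h6 : Finset.Iio (5 : Fin 7) = {0, 1, 2, 3, 4} := by decide
  have h7 : Finset.Iio (6 : Fin 7) = {0, 1, 2, 3, 4, 5} := by decide
  rw [epsZ, Fin.prod_univ_seven, h1, h2, h3, h4, h5, h6, h7]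
  simp [sgs]

/-- Evaluate the second factor only if the first one is nonzero. -/
def lazyMul (a : ℤ) (b : Unit → ℤ) : ℤ := if a = 0 then 0 else a * b ()

theorem mul_eq_lazyMul (a b : ℤ) : a * b = lazyMul a fun _ => b := by
  unfold lazyMul; split_ifs with h <;> simp [h]

/-- Each factor stands as soon as its indices are bound, so a zero factor prunes the whole branch
and the enumeration of seven indices becomes feasible. The value 144 = 6 · 24 cancels the
normalization of `bryantForm`. -/
theorem sum_phiZ_aux (i j : Fin 7) :
    (sum7 fun a => sum7 fun b => lazyMul (phiZ i a b) fun _ => sum7 fun c =>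
      lazyMul (sgs [a, b] c) fun _ => sum7 fun d => lazyMul (phiZ j c d) fun _ =>
      lazyMul (sgs [a, b, c] d) fun _ => sum7 fun e => lazyMul (sgs [a, b, c, d] e) fun _ =>
      sum7 fun f => lazyMul (sgs [a, b, c, d, e] f) fun _ => sum7 fun g =>
      lazyMul (phiZ e f g) fun _ => sgs [a] b * sgs [a, b, c, d, e, f] g) = 144 * deltaZ i j := by
  revert i j; decide +kernel

theorem sum_epsZ_phiZ (i j : Fin 7) : ∑ x : Fin 7 → Fin 7,
    epsZ x * (phiZ i (x 0) (x 1) * phiZ j (x 2) (x 3) * phiZ (x 4) (x 5) (x 6))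
      = 144 * deltaZ i j := by
  rw [← sum_phiZ_aux]
  simp only [sum_fin_succ_arrow, sum_fin_zero_arrow, ← sum7_eq, ← mul_eq_lazyMul, Finset.mul_sum]
  repeat' refine Finset.sum_congr rfl fun _ _ => ?_
  rw [epsZ_vec]
  simp only [Matrix.cons_val]
  ring

theorem sum_epsZ_phiZ_aux (a b c d : Fin 7) :
    (sum7 fun p => sum7 fun q => lazyMul (sgs [p] q) fun _ => sum7 fun r =>
      lazyMul (phiZ p q r) fun _ => lazyMul (sgs [p, q] r) fun _ => lazyMul (sgs [p, q, r] a) fun _ =>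
      lazyMul (sgs [p, q, r, a] b) fun _ => lazyMul (sgs [p, q, r, a, b] c) fun _ =>
      sgs [p, q, r, a, b, c] d) = 6 * psiZ a b c d := by
  revert a b c d; decide +kernel

/-- Identifies the table `psiZ` with the Hodge dual of φ for the standard metric and orientation. -/
theorem sum_phiZ_epsZ (a b c d : Fin 7) : ∑ p : Fin 3 → Fin 7,
    phiZ (p 0) (p 1) (p 2) * epsZ ![p 0, p 1, p 2, a, b, c, d] = 6 * psiZ a b c d := by
  rw [← sum_epsZ_phiZ_aux]
  simp only [sum_fin_succ_arrow, sum_fin_zero_arrow, ← sum7_eq, ← mul_eq_lazyMul, Finset.mul_sum]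
  repeat' refine Finset.sum_congr rfl fun _ _ => ?_
  rw [epsZ_vec]
  simp only [Matrix.cons_val]
  ring

/-! ### Forms on `ℝ⁷` and their components -/

/-- The value of a `3`-form, as an iterated contraction. -/
def tri (α : R7 [⋀^Fin 3]→L[ℝ] ℝ) (u v w : R7) : ℝ :=
  (((α.curryLeft u).curryLeft v).curryLeft w) ![]

theorem tri_eq (α : R7 [⋀^Fin 3]→L[ℝ] ℝ) (u v w : R7) : tri α u v w = α ![u, v, w] := rfl

theorem apply_eq_tri (α : R7 [⋀^Fin 3]→L[ℝ] ℝ) (v : Fin 3 → R7) :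
    α v = tri α (v 0) (v 1) (v 2) := by
  rw [tri_eq]; congr 1; ext i; fin_cases i <;> rfl

section
variable (α : R7 [⋀^Fin 3]→L[ℝ] ℝ)

theorem tri_add_left (u u' v w : R7) : tri α (u + u') v w = tri α u v w + tri α u' v w := by
  simp [tri]
theorem tri_add_mid (u v v' w : R7) : tri α u (v + v') w = tri α u v w + tri α u v' w := by
  simp [tri]
theorem tri_add_right (u v w w' : R7) : tri α u v (w + w') = tri α u v w + tri α u v w' := by
  simp [tri]
theorem tri_smul_left (c : ℝ) (u v w : R7) : tri α (c • u) v w = c * tri α u v w := by simp [tri]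
theorem tri_smul_mid (c : ℝ) (u v w : R7) : tri α u (c • v) w = c * tri α u v w := by simp [tri]
theorem tri_smul_right (c : ℝ) (u v w : R7) : tri α u v (c • w) = c * tri α u v w := by simp [tri]

theorem tri_sum_left {ι : Type*} (s : Finset ι) (c : ι → ℝ) (f : ι → R7) (v w : R7) :
    tri α (∑ i ∈ s, c i • f i) v w = ∑ i ∈ s, c i * tri α (f i) v w := by
  classical
  induction s using Finset.induction_on with
  | empty => simp [tri]
  | insert a s ha ih => rw [Finset.sum_insert ha, Finset.sum_insert ha, tri_add_left, ih, tri_smul_left]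

theorem tri_sum_mid {ι : Type*} (s : Finset ι) (c : ι → ℝ) (f : ι → R7) (u w : R7) :
    tri α u (∑ i ∈ s, c i • f i) w = ∑ i ∈ s, c i * tri α u (f i) w := by
  classical
  induction s using Finset.induction_on with
  | empty => simp [tri]
  | insert a s ha ih => rw [Finset.sum_insert ha, Finset.sum_insert ha, tri_add_mid, ih, tri_smul_mid]

theorem tri_sum_right {ι : Type*} (s : Finset ι) (c : ι → ℝ) (f : ι → R7) (u v : R7) :
    tri α u v (∑ i ∈ s, c i • f i) = ∑ i ∈ s, c i * tri α u v (f i) := by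
  classical
  induction s using Finset.induction_on with
  | empty => simp [tri]
  | insert a s ha ih =>
    rw [Finset.sum_insert ha, Finset.sum_insert ha, tri_add_right, ih, tri_smul_right]

theorem tri_swap (u v w : R7) : tri α u v w = -tri α v u w := by
  rw [tri_eq, tri_eq]
  have := α.toAlternatingMap.map_swap ![v, u, w] (i := 0) (j := 1) (by decide)
  refine Eq.trans ?_ this
  exact congrArg α (by ext i; fin_cases i <;> rfl)

theorem tri_swap' (u v w : R7) : tri α u v w = -tri α u w v := by
  rw [tri_eq, tri_eq]
  have := α.toAlternatingMap.map_swap ![u, w, v] (i := 1) (j := 2) (by decide)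
  refine Eq.trans ?_ this
  exact congrArg α (by ext i; fin_cases i <;> rfl)

theorem comp_eq_tri (i j k : Fin 7) :
    comp α ![i, j, k] = tri α (basisVec i) (basisVec j) (basisVec k) := by
  rw [comp, apply_eq_tri]; rfl

/-- The array of components of a `3`-form. -/
def arr (i j k : Fin 7) : ℝ := tri α (basisVec i) (basisVec j) (basisVec k)

theorem tri_comp (A : R7 →L[ℝ] R7) (u v w : R7) :
    tri (α.compContinuousLinearMap A) u v w = tri α (A u) (A v) (A w) := by
  rw [tri_eq, tri_eq, ContinuousAlternatingMap.compContinuousLinearMap_apply]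
  congr 1; ext i; fin_cases i <;> rfl

end

theorem sum_basisVec (v : R7) : ∑ i, v i • basisVec i = v := by
  ext j
  simp [basisVec, Finset.sum_apply, Pi.single_apply]

theorem basisVec_apply (i j : Fin 7) : basisVec i j = dl i j := by
  simp [basisVec, dl, eq_comm]

theorem ext_arr {α β : R7 [⋀^Fin 3]→L[ℝ] ℝ} (h : ∀ i j k, arr α i j k = arr β i j k) : α = β := by
  ext v
  rw [apply_eq_tri, apply_eq_tri, ← sum_basisVec (v 0), ← sum_basisVec (v 1), ← sum_basisVec (v 2)]
  simp only [tri_sum_left, tri_sum_mid, tri_sum_right]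
  simp only [arr] at h
  simp only [h]

/-- The matrix of an endomorphism of `ℝ⁷`. -/
def mat (A : R7 →L[ℝ] R7) : Matrix (Fin 7) (Fin 7) ℝ := Matrix.of fun i j => A (basisVec j) i

theorem mat_apply (A : R7 →L[ℝ] R7) (i j : Fin 7) : mat A i j = A (basisVec j) i := rfl

theorem apply_basisVec (A : R7 →L[ℝ] R7) (j : Fin 7) :
    A (basisVec j) = ∑ i, mat A i j • basisVec i := (sum_basisVec _).symm

theorem apply_coord (A : R7 →L[ℝ] R7) (v : R7) (i : Fin 7) : A v i = ∑ j, mat A i j * v j := by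
  conv_lhs => rw [← sum_basisVec v, map_sum]
  simp [mat, mul_comm]

theorem mat_comp (A B : R7 →L[ℝ] R7) : mat (A.comp B) = mat A * mat B := by
  ext i j
  rw [mat_apply, ContinuousLinearMap.comp_apply, apply_coord, Matrix.mul_apply]; rfl

theorem mat_id : mat (ContinuousLinearMap.id ℝ R7) = 1 := by
  ext i j
  rw [mat_apply, ContinuousLinearMap.id_apply, basisVec_apply, Matrix.one_apply, dl]
  simp only [eq_comm]

theorem mat_injective {A B : R7 →L[ℝ] R7} (h : mat A = mat B) : A = B := by
  ext v i; rw [apply_coord, apply_coord, h]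

theorem mat_toEuclideanCLM (M : Matrix (Fin 7) (Fin 7) ℝ) :
    mat (Matrix.toEuclideanCLM (𝕜 := ℝ) M) = M := by
  ext i j
  rw [mat_apply, Matrix.ofLp_toEuclideanCLM]
  simp [basisVec]

theorem mat_toContinuousLinearEquiv_mul (A : R7 ≃L[ℝ] R7) :
    mat (A.symm : R7 →L[ℝ] R7) * mat (A : R7 →L[ℝ] R7) = 1 := by
  rw [← mat_comp, ← mat_id]; congr 1; ext v; simp

theorem det_mat (A : R7 →L[ℝ] R7) : (mat A).det = A.det := by
  rw [ContinuousLinearMap.det, ← LinearMap.det_toMatrix (EuclideanSpace.basisFun (Fin 7) ℝ).toBasis]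
  congr 1

theorem det_mat_ne_zero (A : R7 ≃L[ℝ] R7) : (mat (A : R7 →L[ℝ] R7)).det ≠ 0 := by
  intro h
  have := congrArg Matrix.det (mat_toContinuousLinearEquiv_mul A)
  rw [Matrix.det_mul, h] at this
  simp at this

/-! ### The Bryant form -/

/-- The integrand of the wedge product `(u ⌟ α) ∧ (v ⌟ α) ∧ α`. -/
def bryMult (α : R7 [⋀^Fin 3]→L[ℝ] ℝ) (u v : R7) : MultilinearMap ℝ (fun _ : Fin 7 => R7) ℝ where
  toFun w := tri α u (w 0) (w 1) * tri α v (w 2) (w 3) * tri α (w 4) (w 5) (w 6)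
  map_update_add' := by
    intro inst w i x y
    obtain rfl : inst = instDecidableEqFin 7 := Subsingleton.elim _ _
    fin_cases i <;> simp [tri_add_left, tri_add_mid, tri_add_right] <;> ring
  map_update_smul' := by
    intro inst w i c x
    obtain rfl : inst = instDecidableEqFin 7 := Subsingleton.elim _ _
    fin_cases i <;> simp [tri_smul_left, tri_smul_mid, tri_smul_right] <;> ring

/-- The wedge product `(u ⌟ α) ∧ (v ⌟ α) ∧ α`, up to a factor. -/
def bryAlt (α : R7 [⋀^Fin 3]→L[ℝ] ℝ) (u v : R7) : R7 [⋀^Fin 7]→ₗ[ℝ] ℝ :=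
  (bryMult α u v).alternatization

theorem bryAlt_apply (α : R7 [⋀^Fin 3]→L[ℝ] ℝ) (u v : R7) (w : Fin 7 → R7) :
    bryAlt α u v w = ∑ σ : Equiv.Perm (Fin 7), ((Equiv.Perm.sign σ : ℤ) : ℝ) *
      (tri α u (w (σ 0)) (w (σ 1)) * tri α v (w (σ 2)) (w (σ 3))
        * tri α (w (σ 4)) (w (σ 5)) (w (σ 6))) := by
  rw [bryAlt, MultilinearMap.alternatization_apply]
  refine Finset.sum_congr rfl fun σ _ => ?_
  rw [Units.smul_def, zsmul_eq_mul]; rfl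

theorem bryantForm_apply (α : R7 [⋀^Fin 3]→L[ℝ] ℝ) (i j : Fin 7) :
    bryantForm α i j = 1 / 144 * bryAlt α (basisVec i) (basisVec j) basisVec := by
  rw [bryAlt_apply, bryantForm, Matrix.of_apply, ← mul_assoc]
  congr 1
  · norm_num
  · simp only [comp_eq_tri]

/-- An alternating form of top degree is a multiple of the determinant. -/
theorem bryAlt_det (α : R7 [⋀^Fin 3]→L[ℝ] ℝ) (u v : R7) (A : R7 →L[ℝ] R7) :
    bryAlt α u v (fun i => A (basisVec i)) = (mat A).det * bryAlt α u v basisVec := by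
  let b := (EuclideanSpace.basisFun (Fin 7) ℝ).toBasis
  have hb : ⇑b = basisVec := by ext i; simp [b, basisVec]
  have h := (bryAlt α u v).eq_smul_basis_det b
  rw [h, AlternatingMap.smul_apply, AlternatingMap.smul_apply, hb]
  have h1 : b.det basisVec = 1 := by rw [← hb]; exact b.det_self
  have h2 : b.det (fun i => A (basisVec i)) = (mat A).det := by
    rw [Module.Basis.det_apply]; congr 1
  rw [h1, h2]; simp [mul_comm]

theorem bryAlt_comp (α : R7 [⋀^Fin 3]→L[ℝ] ℝ) (u v : R7) (A : R7 →L[ℝ] R7) (w : Fin 7 → R7) :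
    bryAlt (α.compContinuousLinearMap A) u v w = bryAlt α (A u) (A v) fun i => A (w i) := by
  simp only [bryAlt_apply, tri_comp]

theorem bryAlt_sum (α : R7 [⋀^Fin 3]→L[ℝ] ℝ) (a : Matrix (Fin 7) (Fin 7) ℝ) (i j : Fin 7)
    (w : Fin 7 → R7) :
    bryAlt α (∑ k, a k i • basisVec k) (∑ l, a l j • basisVec l) w
      = ∑ k, ∑ l, a k i * a l j * bryAlt α (basisVec k) (basisVec l) w := by
  simp only [bryAlt_apply, tri_sum_left, Finset.sum_mul_sum]
  simp only [Finset.sum_mul, Finset.mul_sum]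
  conv_rhs => enter [2, k]; rw [Finset.sum_comm]
  conv_rhs => rw [Finset.sum_comm]
  refine Finset.sum_congr rfl fun σ _ => Finset.sum_congr rfl fun k _ =>
    Finset.sum_congr rfl fun l _ => by ring

theorem bryAlt_comp_basis (α : R7 [⋀^Fin 3]→L[ℝ] ℝ) (A : R7 →L[ℝ] R7) (i j : Fin 7) :
    bryAlt (α.compContinuousLinearMap A) (basisVec i) (basisVec j) basisVec =
      (mat A).det * ∑ k, ∑ l, mat A k i * mat A l j *
        bryAlt α (basisVec k) (basisVec l) basisVec := by
  rw [bryAlt_comp, bryAlt_det]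
  congr 1
  conv_lhs => rw [apply_basisVec A i, apply_basisVec A j]
  exact bryAlt_sum α (mat A) i j basisVec

/-- The two contracted vectors give the congruence by A, and pulling back the 7-form gives the
determinant. -/
theorem bryantForm_comp (α : R7 [⋀^Fin 3]→L[ℝ] ℝ) (A : R7 →L[ℝ] R7) :
    bryantForm (α.compContinuousLinearMap A)
      = (mat A).det • ((mat A).transpose * bryantForm α * mat A) := by
  ext i j
  have h : ∀ k l, bryAlt α (basisVec k) (basisVec l) basisVec = 144 * bryantForm α k l :=
    fun k l => by rw [bryantForm_apply]; ring
  rw [bryantForm_apply, bryAlt_comp_basis]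
  simp only [h]
  generalize bryantForm α = B
  rw [Matrix.smul_apply, smul_eq_mul, Matrix.mul_apply]
  simp only [Matrix.mul_apply, Matrix.transpose_apply, Finset.sum_mul, Finset.mul_sum]
  rw [Finset.sum_comm]
  exact Finset.sum_congr rfl fun k _ => Finset.sum_congr rfl fun l _ => by ring

/-- A `3`-form is standard if it is the standard `3`-form. -/
def IsStd (α : R7 [⋀^Fin 3]→L[ℝ] ℝ) : Prop := ∀ v, α v = stdPhi v

theorem elem3_basisVec (i j k a b c : Fin 7) :
    elem3 i j k ![basisVec a, basisVec b, basisVec c] = elemZ i j k a b c := by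
  rw [elem3, Matrix.det_fin_three, elemZ]
  push_cast
  simp [basisVec_apply, deltaZ_cast]

theorem IsStd.arr {α : R7 [⋀^Fin 3]→L[ℝ] ℝ} (h : IsStd α) (a b c : Fin 7) :
    arr α a b c = phi0 a b c := by
  rw [G2.arr, tri_eq, h, phi0, phiZ_eq_elemZ, stdPhi]
  simp only [elem3_basisVec, Int.cast_add, Int.cast_sub]

theorem sum_perm_phi0 (i j : Fin 7) :
    ∑ σ : Equiv.Perm (Fin 7), ((Equiv.Perm.sign σ : ℤ) : ℝ) *
      (phi0 i (σ 0) (σ 1) * phi0 j (σ 2) (σ 3) * phi0 (σ 4) (σ 5) (σ 6)) = 144 * dl i j := by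
  have h1 := sum_perm_eq (R := ℝ) fun x : Fin 7 → Fin 7 =>
    phi0 i (x 0) (x 1) * phi0 j (x 2) (x 3) * phi0 (x 4) (x 5) (x 6)
  refine h1.trans ?_
  have h2 := congrArg (Int.cast : ℤ → ℝ) (sum_epsZ_phiZ i j)
  rw [Int.cast_sum, Int.cast_mul, deltaZ_cast] at h2
  refine Eq.trans ?_ (h2.trans ?_)
  · refine Finset.sum_congr rfl fun x _ => ?_
    rw [Int.cast_mul, Int.cast_mul, Int.cast_mul]; rfl
  · norm_num

theorem IsStd.bryantForm {α : R7 [⋀^Fin 3]→L[ℝ] ℝ} (h : IsStd α) : bryantForm α = 1 := by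
  ext i j
  have h1 : ∀ a b c, tri α (basisVec a) (basisVec b) (basisVec c) = phi0 a b c := h.arr
  rw [bryantForm_apply, bryAlt_apply]
  simp only [h1, sum_perm_phi0]
  rw [Matrix.one_apply, dl]; ring

/-! ### Linear algebra of positive `3`-forms -/

/-- The isomorphism `A` takes `α` to the standard `3`-form. -/
def IsFrame (α : R7 [⋀^Fin 3]→L[ℝ] ℝ) (A : R7 ≃L[ℝ] R7) : Prop :=
  ∀ v : Fin 3 → R7, α v = stdPhi fun a => A (v a)

/-- A `3`-form is positive if it is equivalent to the standard `3`-form. -/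
def IsPositive (α : R7 [⋀^Fin 3]→L[ℝ] ℝ) : Prop := ∃ A, IsFrame α A

/-- The matrix of the frame defined by an isomorphism. -/
def frameMat (A : R7 ≃L[ℝ] R7) : Matrix (Fin 7) (Fin 7) ℝ := mat (A.symm : R7 →L[ℝ] R7)

/-- The frame vectors defined by an isomorphism. -/
def frameVec (A : R7 ≃L[ℝ] R7) (i : Fin 7) : R7 := A.symm (basisVec i)

theorem frameMat_apply (A : R7 ≃L[ℝ] R7) (i j : Fin 7) : frameMat A i j = frameVec A j i := rfl

theorem frameMat_mul (A : R7 ≃L[ℝ] R7) : frameMat A * mat (A : R7 →L[ℝ] R7) = 1 :=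
  mat_toContinuousLinearEquiv_mul A

theorem mul_frameMat (A : R7 ≃L[ℝ] R7) : mat (A : R7 →L[ℝ] R7) * frameMat A = 1 :=
  mul_eq_one_comm.mp (frameMat_mul A)

theorem real_sign_mul_rpow (d : ℝ) (hd : d ≠ 0) :
    Real.sign (d ^ 9) * |d ^ 9| ^ (1 / 9 : ℝ) = d := by
  have h1 : |d ^ 9| ^ (1 / 9 : ℝ) = |d| := by
    rw [abs_pow, ← Real.rpow_natCast, ← Real.rpow_mul (abs_nonneg d)]; norm_num
  rw [h1]
  rcases lt_or_gt_of_ne hd with h | h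
  · rw [Real.sign_of_neg (Odd.pow_neg (by decide) h), abs_of_neg h]; ring
  · rw [Real.sign_of_pos (by positivity), abs_of_pos h]; ring

section
variable {α : R7 [⋀^Fin 3]→L[ℝ] ℝ} {A : R7 ≃L[ℝ] R7}

theorem IsFrame.isStd (h : IsFrame α A) :
    IsStd (α.compContinuousLinearMap (A.symm : R7 →L[ℝ] R7)) := by
  intro v
  rw [ContinuousAlternatingMap.compContinuousLinearMap_apply, h]
  simp

theorem IsFrame.eq_comp (_ : IsFrame α A) :
    α = (α.compContinuousLinearMap (A.symm : R7 →L[ℝ] R7)).compContinuousLinearMap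
      (A : R7 →L[ℝ] R7) := by
  ext v; simp [Function.comp_def]

theorem IsFrame.tri (h : IsFrame α A) (i j k : Fin 7) :
    tri α (frameVec A i) (frameVec A j) (frameVec A k) = phi0 i j k := by
  rw [← h.isStd.arr, arr, tri_comp]; rfl

theorem IsFrame.bryantForm (h : IsFrame α A) : bryantForm α =
    (mat (A : R7 →L[ℝ] R7)).det • ((mat (A : R7 →L[ℝ] R7)).transpose * mat (A : R7 →L[ℝ] R7)) := by
  rw [IsFrame.eq_comp h, bryantForm_comp, h.isStd.bryantForm, Matrix.mul_one]

/-- Seven powers come from the scalar factor of a 7 × 7 matrix and two from AᵀA; hence the ninth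
root in `volCoeff`. -/
theorem IsFrame.det_bryantForm (h : IsFrame α A) :
    (G2.bryantForm α).det = (mat (A : R7 →L[ℝ] R7)).det ^ 9 := by
  rw [h.bryantForm, Matrix.det_smul, Matrix.det_mul, Matrix.det_transpose, Fintype.card_fin]
  ring

theorem IsFrame.volCoeff (h : IsFrame α A) : volCoeff α = (mat (A : R7 →L[ℝ] R7)).det := by
  rw [G2.volCoeff, h.det_bryantForm, real_sign_mul_rpow _ (det_mat_ne_zero A)]

theorem IsFrame.metricOf (h : IsFrame α A) :
    metricOf α = (mat (A : R7 →L[ℝ] R7)).transpose * mat (A : R7 →L[ℝ] R7) := by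
  rw [G2.metricOf, h.volCoeff, h.bryantForm, smul_smul, inv_mul_cancel₀ (det_mat_ne_zero A),
    one_smul]

/-- The columns of `frameMat A` form an orthonormal frame; this factorization turns every
contraction with g⁻¹ into a plain sum over frame indices. -/
theorem IsFrame.inv_metricOf (h : IsFrame α A) :
    (G2.metricOf α)⁻¹ = frameMat A * (frameMat A).transpose := by
  refine Matrix.inv_eq_right_inv ?_
  rw [h.metricOf, Matrix.mul_assoc, ← Matrix.mul_assoc (mat _) (frameMat A), mul_frameMat,
    Matrix.one_mul, ← Matrix.transpose_mul, frameMat_mul, Matrix.transpose_one]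

theorem IsFrame.transpose_mul_metricOf_mul (h : IsFrame α A) :
    (frameMat A).transpose * G2.metricOf α * frameMat A = 1 := by
  rw [h.metricOf, Matrix.mul_assoc, Matrix.mul_assoc, mul_frameMat, Matrix.mul_one,
    ← Matrix.transpose_mul, mul_frameMat, Matrix.transpose_one]

theorem IsFrame.transpose_metricOf (h : IsFrame α A) :
    (G2.metricOf α).transpose = G2.metricOf α := by
  rw [h.metricOf, Matrix.transpose_mul, Matrix.transpose_transpose]

theorem IsFrame.metricOf_mul_inv (h : IsFrame α A) : G2.metricOf α * (G2.metricOf α)⁻¹ = 1 := by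
  rw [h.inv_metricOf, h.metricOf, Matrix.mul_assoc, ← Matrix.mul_assoc (mat _) (frameMat A),
    mul_frameMat, Matrix.one_mul, ← Matrix.transpose_mul, frameMat_mul, Matrix.transpose_one]

theorem IsFrame.det_bryantForm_ne_zero (h : IsFrame α A) : (G2.bryantForm α).det ≠ 0 := by
  rw [h.det_bryantForm]; exact pow_ne_zero _ (det_mat_ne_zero A)

theorem IsFrame.volCoeff_ne_zero (h : IsFrame α A) : G2.volCoeff α ≠ 0 := by
  rw [h.volCoeff]; exact det_mat_ne_zero A

theorem IsFrame.det_metricOf (h : IsFrame α A) : (G2.metricOf α).det = G2.volCoeff α ^ 2 := by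
  rw [h.metricOf, h.volCoeff, Matrix.det_mul, Matrix.det_transpose, sq]

theorem IsFrame.volCoeff_mul_det (h : IsFrame α A) : G2.volCoeff α * (frameMat A).det = 1 := by
  rw [h.volCoeff, ← Matrix.det_mul, mul_frameMat, Matrix.det_one]

/-- Pullback of the coefficient of the volume form. -/
theorem IsFrame.volCoeff_comp (h : IsFrame α A) (B : R7 ≃L[ℝ] R7) :
    G2.volCoeff (α.compContinuousLinearMap (B : R7 →L[ℝ] R7))
      = (mat (B : R7 →L[ℝ] R7)).det * G2.volCoeff α := by
  have h' : IsFrame (α.compContinuousLinearMap (B : R7 →L[ℝ] R7)) (B.trans A) := by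
    intro v
    rw [ContinuousAlternatingMap.compContinuousLinearMap_apply, h]; rfl
  rw [h'.volCoeff, h.volCoeff, mul_comm, ← Matrix.det_mul, ← mat_comp]
  rfl

theorem sum_prod_mul_det {n : Type*} [Fintype n] [DecidableEq n] (P : Matrix n n ℝ) (y : n → n) :
    ∑ x : n → n, (∏ r, P (x r) (y r)) * ((1 : Matrix n n ℝ).submatrix x id).det
      = P.det * ((1 : Matrix n n ℝ).submatrix y id).det := by
  have h := Matrix.detRowAlternating.toMultilinearMap.map_sum (R := ℝ)
    (fun (r : n) (x : n) => P x (y r) • (1 : Matrix n n ℝ) x)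
  have h1 : (fun r : n => ∑ x, P x (y r) • (1 : Matrix n n ℝ) x)
      = (1 : Matrix n n ℝ).submatrix y id * P.transpose := by
    ext r s
    simp [Matrix.mul_apply, Matrix.one_apply, Finset.sum_apply]
  rw [h1] at h
  have h2 : Matrix.detRowAlternating.toMultilinearMap
      ((1 : Matrix n n ℝ).submatrix y id * P.transpose)
      = P.det * ((1 : Matrix n n ℝ).submatrix y id).det := by
    refine (Matrix.det_mul _ _).trans ?_
    rw [Matrix.det_transpose, mul_comm]
  rw [← h2, h]
  refine Finset.sum_congr rfl fun x _ => ?_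
  rw [MultilinearMap.map_smul_univ, smul_eq_mul]; rfl

/-- Contraction of every index of an array with a matrix. -/
def contract {k : ℕ} (P : Matrix (Fin 7) (Fin 7) ℝ) (a : (Fin k → Fin 7) → ℝ) (y : Fin k → Fin 7) :
    ℝ := ∑ x : Fin k → Fin 7, (∏ r, P (x r) (y r)) * a x

theorem sum_tri_frame (β : R7 [⋀^Fin 3]→L[ℝ] ℝ) (A : R7 ≃L[ℝ] R7) (y : Fin 3 → Fin 7) :
    contract (frameMat A) (comp β) y
      = G2.tri β (frameVec A (y 0)) (frameVec A (y 1)) (frameVec A (y 2)) := by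
  have h := β.toMultilinearMap.map_sum (R := ℝ)
    (fun (r : Fin 3) (x : Fin 7) => frameMat A x (y r) • basisVec x)
  have h1 : (fun r : Fin 3 => ∑ x, frameMat A x (y r) • basisVec x)
      = fun r => frameVec A (y r) := by
    funext r
    exact sum_basisVec (frameVec A (y r))
  rw [h1] at h
  rw [← apply_eq_tri β (fun r => frameVec A (y r))]
  refine Eq.trans ?_ h.symm
  refine Finset.sum_congr rfl fun x _ => ?_
  rw [MultilinearMap.map_smul_univ, smul_eq_mul]; rfl

theorem prod_mul_transpose {k : ℕ} (P : Matrix (Fin 7) (Fin 7) ℝ) (l x : Fin k → Fin 7) :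
    ∏ r, (P * P.transpose) (l r) (x r)
      = ∑ y : Fin k → Fin 7, (∏ r, P (l r) (y r)) * ∏ r, P (x r) (y r) := by
  simp only [Matrix.mul_apply, Matrix.transpose_apply, Finset.prod_univ_sum,
    Fintype.piFinset_univ, Finset.prod_mul_distrib]

/-- With g⁻¹ = PPᵀ, raising all the indices amounts to a dot product of frame components. -/
theorem contract_mul_transpose {k : ℕ} (P : Matrix (Fin 7) (Fin 7) ℝ) (a b : (Fin k → Fin 7) → ℝ) :
    ∑ l, ∑ x, a l * b x * ∏ r, (P * P.transpose) (l r) (x r)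
      = ∑ y, contract P a y * contract P b y := by
  simp only [prod_mul_transpose, contract, Finset.sum_mul_sum]
  simp only [Finset.mul_sum]
  conv_rhs => rw [Finset.sum_comm]
  refine Finset.sum_congr rfl fun l _ => ?_
  conv_rhs => rw [Finset.sum_comm]
  exact Finset.sum_congr rfl fun x _ => Finset.sum_congr rfl fun y _ => by ring

theorem IsFrame.contract_comp (h : IsFrame α A) (y : Fin 3 → Fin 7) :
    contract (frameMat A) (comp α) y = phi0 (y 0) (y 1) (y 2) := by
  rw [sum_tri_frame, h.tri]

theorem IsFrame.raised (h : IsFrame α A) (p : Fin 3 → Fin 7) :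
    raised α p = ∑ q : Fin 3 → Fin 7, phi0 (q 0) (q 1) (q 2) * ∏ r, frameMat A (p r) (q r) := by
  simp only [G2.raised, h.inv_metricOf, prod_mul_transpose, ← h.contract_comp, contract,
    Finset.mul_sum, Finset.sum_mul]
  rw [Finset.sum_comm]
  exact Finset.sum_congr rfl fun x _ => Finset.sum_congr rfl fun y _ => by ring

theorem sum_append {m n : ℕ} (f : (Fin (m + n) → Fin 7) → ℝ) :
    ∑ x, f x = ∑ p : Fin m → Fin 7, ∑ j : Fin n → Fin 7, f (Fin.append p j) := by
  rw [← Fintype.sum_prod_type']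
  exact ((Fin.appendEquiv m n).sum_comp f).symm

theorem sum_phi0_det (y : Fin 4 → Fin 7) :
    ∑ q : Fin 3 → Fin 7, phi0 (q 0) (q 1) (q 2) *
      ((1 : Matrix (Fin 7) (Fin 7) ℝ).submatrix (Fin.append q y : Fin (3 + 4) → Fin 7) id).det
      = 6 * psi0 (y 0) (y 1) (y 2) (y 3) := by
  have h := congrArg (Int.cast : ℤ → ℝ) (sum_phiZ_epsZ (y 0) (y 1) (y 2) (y 3))
  rw [Int.cast_sum, Int.cast_mul] at h
  refine Eq.trans ?_ (h.trans ?_)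
  · refine Finset.sum_congr rfl fun q _ => ?_
    rw [det_submatrix_one, Int.cast_mul]
    congr 3
    ext i; fin_cases i <;> rfl
  · norm_num [psi0]

theorem IsFrame.contract_psi (h : IsFrame α A) (y : Fin 4 → Fin 7) :
    contract (frameMat A) (psi α) y = psi0 (y 0) (y 1) (y 2) (y 3) := by
  have h1 : ∀ j, psi α j = 1 / 6 * G2.volCoeff α * ∑ q : Fin 3 → Fin 7, phi0 (q 0) (q 1) (q 2) *
      ∑ p : Fin 3 → Fin 7, (∏ r, frameMat A (p r) (q r)) *
      ((1 : Matrix (Fin 7) (Fin 7) ℝ).submatrix (Fin.append p j : Fin (3 + 4) → Fin 7) id).det := by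
    intro j
    simp only [psi, h.raised, volForm, Finset.mul_sum, Finset.sum_mul]
    rw [Finset.sum_comm]
    exact Finset.sum_congr rfl fun x _ => Finset.sum_congr rfl fun y _ => by ring
  -- The three frame factors from the raised indices and the four from evaluating ψ on the frame
  -- fill all slots of the volume symbol, so they collapse into one determinant.
  have h2 : ∀ q : Fin 3 → Fin 7, ∑ j : Fin 4 → Fin 7, (∏ r, frameMat A (j r) (y r)) *
      ∑ p : Fin 3 → Fin 7, (∏ r, frameMat A (p r) (q r)) *
      ((1 : Matrix (Fin 7) (Fin 7) ℝ).submatrix (Fin.append p j : Fin (3 + 4) → Fin 7) id).det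
      = (frameMat A).det * ((1 : Matrix (Fin 7) (Fin 7) ℝ).submatrix
        (Fin.append q y : Fin (3 + 4) → Fin 7) id).det := by
    intro q
    have e := sum_prod_mul_det (frameMat A) (Fin.append q y : Fin (3 + 4) → Fin 7)
    rw [← e]
    refine Eq.trans ?_ (sum_append (m := 3) (n := 4) _).symm
    simp only [Finset.mul_sum]
    rw [Finset.sum_comm]
    refine Finset.sum_congr rfl fun p _ => Finset.sum_congr rfl fun j _ => ?_
    have e2 := Fin.prod_univ_add (a := 3) (b := 4) fun r => frameMat A
      ((Fin.append p j : Fin (3 + 4) → Fin 7) r) ((Fin.append q y : Fin (3 + 4) → Fin 7) r)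
    simp only [Fin.append_left, Fin.append_right] at e2
    refine Eq.trans ?_ (congrArg (· * _) e2.symm)
    ring
  calc contract (frameMat A) (psi α) y
      = 1 / 6 * G2.volCoeff α * ∑ q : Fin 3 → Fin 7, phi0 (q 0) (q 1) (q 2) *
        ((frameMat A).det * ((1 : Matrix (Fin 7) (Fin 7) ℝ).submatrix
        (Fin.append q y : Fin (3 + 4) → Fin 7) id).det) := by
        simp only [← h2]
        simp only [contract, h1, Finset.mul_sum]
        rw [Finset.sum_comm]
        refine Finset.sum_congr rfl fun q _ => ?_
        refine Finset.sum_congr rfl fun j _ => ?_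
        refine Finset.sum_congr rfl fun p _ => ?_
        ring
    _ = 1 / 6 * (G2.volCoeff α * (frameMat A).det) * (6 * psi0 (y 0) (y 1) (y 2) (y 3)) := by
        rw [← sum_phi0_det]
        simp only [Finset.mul_sum]
        exact Finset.sum_congr rfl fun q _ => by ring
    _ = psi0 (y 0) (y 1) (y 2) (y 3) := by rw [h.volCoeff_mul_det]; ring

end

/-! ### The bilinear contraction that recovers the metric -/

/-- The matrix `(v, w) ↦ β(∂ᵢ, v, w)`. -/
def slice (β : R7 [⋀^Fin 3]→L[ℝ] ℝ) (i : Fin 7) : Matrix (Fin 7) (Fin 7) ℝ :=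
  Matrix.of fun p q => arr β i p q

/-- The contraction `β_{ipq} γ_{krs} h^{pr} h^{qs}`. -/
def contraction (h : Matrix (Fin 7) (Fin 7) ℝ) (β γ : R7 [⋀^Fin 3]→L[ℝ] ℝ) :
    Matrix (Fin 7) (Fin 7) ℝ :=
  Matrix.of fun i k => (slice β i * h * (slice γ k).transpose * h).trace

/-- The contraction of two `3`-forms in a frame. -/
def frameContraction (A : R7 ≃L[ℝ] R7) (β γ : R7 [⋀^Fin 3]→L[ℝ] ℝ) (u v : R7) : ℝ :=
  ∑ b, ∑ c, tri β u (frameVec A b) (frameVec A c) * tri γ v (frameVec A b) (frameVec A c)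

theorem sum_frameMat (A : R7 ≃L[ℝ] R7) (b : Fin 7) :
    ∑ p, frameMat A p b • basisVec p = frameVec A b := sum_basisVec (frameVec A b)

theorem sum_mat_frameVec (A : R7 ≃L[ℝ] R7) (i : Fin 7) :
    ∑ j, mat (A : R7 →L[ℝ] R7) j i • frameVec A j = basisVec i := by
  have h := congrArg A.symm (sum_basisVec (A (basisVec i)))
  rw [ContinuousLinearEquiv.symm_apply_apply, map_sum] at h
  rw [← h]
  exact Finset.sum_congr rfl fun j _ => by rw [map_smul]; rfl

theorem transpose_mul_slice_mul (A : R7 ≃L[ℝ] R7) (β : R7 [⋀^Fin 3]→L[ℝ] ℝ) (i b c : Fin 7) :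
    ((frameMat A).transpose * slice β i * frameMat A) b c
      = tri β (basisVec i) (frameVec A b) (frameVec A c) := by
  rw [← sum_frameMat A b, ← sum_frameMat A c]
  simp only [tri_sum_mid, tri_sum_right, Matrix.mul_apply, Matrix.transpose_apply, slice,
    Matrix.of_apply, Finset.sum_mul, Finset.mul_sum, arr]
  exact Finset.sum_congr rfl fun p _ => Finset.sum_congr rfl fun q _ => by ring

theorem contraction_frame (A : R7 ≃L[ℝ] R7) (β γ : R7 [⋀^Fin 3]→L[ℝ] ℝ) (i k : Fin 7) :
    contraction (frameMat A * (frameMat A).transpose) β γ i k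
      = frameContraction A β γ (basisVec i) (basisVec k) := by
  have h : (slice β i * (frameMat A * (frameMat A).transpose) * (slice γ k).transpose *
      (frameMat A * (frameMat A).transpose)).trace =
      (((frameMat A).transpose * slice β i * frameMat A) *
        ((frameMat A).transpose * slice γ k * frameMat A).transpose).trace := by
    rw [Matrix.transpose_mul, Matrix.transpose_mul, Matrix.transpose_transpose]
    simp only [Matrix.mul_assoc]
    rw [Matrix.trace_mul_comm (frameMat A).transpose]
    simp only [Matrix.mul_assoc]
  rw [contraction, Matrix.of_apply, h, Matrix.trace]
  simp only [Matrix.diag_apply, Matrix.mul_apply (M := (frameMat A).transpose * slice β i * _),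
    Matrix.transpose_apply, transpose_mul_slice_mul]
  rfl

theorem frameContraction_sum_left {ι : Type*} (s : Finset ι) (A : R7 ≃L[ℝ] R7)
    (β γ : R7 [⋀^Fin 3]→L[ℝ] ℝ) (c : ι → ℝ) (f : ι → R7) (v : R7) :
    frameContraction A β γ (∑ i ∈ s, c i • f i) v
      = ∑ i ∈ s, c i * frameContraction A β γ (f i) v := by
  simp only [frameContraction, tri_sum_left, Finset.sum_mul, Finset.mul_sum, mul_assoc]
  conv_rhs => rw [Finset.sum_comm]
  refine Finset.sum_congr rfl fun b _ => ?_
  conv_rhs => rw [Finset.sum_comm]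

theorem frameContraction_comm (A : R7 ≃L[ℝ] R7) (β γ : R7 [⋀^Fin 3]→L[ℝ] ℝ) (u v : R7) :
    frameContraction A β γ u v = frameContraction A γ β v u := by
  simp only [frameContraction]
  exact Finset.sum_congr rfl fun p _ => Finset.sum_congr rfl fun q _ => mul_comm _ _

theorem frameContraction_sum_right {ι : Type*} (s : Finset ι) (A : R7 ≃L[ℝ] R7)
    (β γ : R7 [⋀^Fin 3]→L[ℝ] ℝ) (c : ι → ℝ) (f : ι → R7) (u : R7) :
    frameContraction A β γ u (∑ i ∈ s, c i • f i)
      = ∑ i ∈ s, c i * frameContraction A β γ u (f i) := by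
  simp only [frameContraction_comm A β γ, frameContraction_sum_left]

/-- The contraction in a frame, evaluated on vectors with given components. -/
theorem frameContraction_eq (A : R7 ≃L[ℝ] R7) (β γ : R7 [⋀^Fin 3]→L[ℝ] ℝ) (u v : R7) :
    frameContraction A β γ u v
      = ∑ i, ∑ k, u i * (v k * contraction (frameMat A * (frameMat A).transpose) β γ i k) := by
  conv_lhs => rw [← sum_basisVec u, ← sum_basisVec v]
  rw [frameContraction_sum_left]
  simp only [frameContraction_sum_right, contraction_frame]
  refine Finset.sum_congr rfl fun i _ => ?_
  rw [Finset.mul_sum]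

/-- The result mentions no frame, so it can be differentiated on an open set without choosing frames
smoothly. It is the source of all metric constraints on ∇φ and ∇∇φ. -/
theorem IsFrame.contraction_eq {α : R7 [⋀^Fin 3]→L[ℝ] ℝ} {A : R7 ≃L[ℝ] R7} (h : IsFrame α A) :
    contraction (G2.metricOf α)⁻¹ α α = (6 : ℝ) • G2.metricOf α := by
  ext i k
  rw [h.inv_metricOf, contraction_frame, h.metricOf, ← sum_mat_frameVec A i,
    ← sum_mat_frameVec A k]
  have e : ∀ j l, ∑ b, ∑ c, phi0 j b c * phi0 l b c = 6 * dl j l := phi0_phi0_two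
  simp only [frameContraction_sum_left, frameContraction_sum_right]
  simp only [frameContraction, h.tri, e, Matrix.smul_apply, Matrix.mul_apply, Matrix.transpose_apply, smul_eq_mul,
    Finset.mul_sum]
  refine Finset.sum_congr rfl fun j _ => ?_
  simp [dl]
  ring

/-! ### Derivatives of matrix-valued functions -/

/-- The entries of `M` have the entries of `M'` as derivatives at `t`. -/
def HasMatDeriv {m n : Type*} (M : ℝ → Matrix m n ℝ) (M' : Matrix m n ℝ) (t : ℝ) : Prop :=
  ∀ i j, HasDerivAt (fun s => M s i j) (M' i j) t

section
variable {l m n : Type*} {t : ℝ}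

theorem HasMatDeriv.mul [Fintype m] {M : ℝ → Matrix l m ℝ} {N : ℝ → Matrix m n ℝ} {M' : Matrix l m ℝ}
    {N' : Matrix m n ℝ} (hM : HasMatDeriv M M' t) (hN : HasMatDeriv N N' t) :
    HasMatDeriv (fun s => M s * N s) (M' * N t + M t * N') t := by
  intro i j
  simp only [Matrix.mul_apply, Matrix.add_apply, ← Finset.sum_add_distrib]
  exact HasDerivAt.fun_sum fun k _ => (hM i k).mul (hN k j)

theorem HasMatDeriv.transpose {M : ℝ → Matrix l m ℝ} {M' : Matrix l m ℝ}
    (hM : HasMatDeriv M M' t) : HasMatDeriv (fun s => (M s).transpose) M'.transpose t :=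
  fun i j => hM j i

theorem HasMatDeriv.trace [Fintype m] {M : ℝ → Matrix m m ℝ} {M' : Matrix m m ℝ}
    (hM : HasMatDeriv M M' t) : HasDerivAt (fun s => (M s).trace) M'.trace t :=
  HasDerivAt.fun_sum fun k _ => hM k k

theorem HasMatDeriv.unique {M : ℝ → Matrix l m ℝ} {M' M'' : Matrix l m ℝ}
    (h : HasMatDeriv M M' t) (h' : HasMatDeriv M M'' t) : M' = M'' := by
  ext i j; exact (h i j).unique (h' i j)

end

/-- The infinitesimal invariance of the contraction under the general linear group. -/
theorem hasMatDeriv_contraction {Γ : Matrix (Fin 7) (Fin 7) ℝ} {h : ℝ → Matrix (Fin 7) (Fin 7) ℝ}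
    {a b : ℝ → R7 [⋀^Fin 3]→L[ℝ] ℝ} {a' b' : R7 [⋀^Fin 3]→L[ℝ] ℝ} {t : ℝ}
    (hh : HasMatDeriv h (-(Γ * h t + h t * Γ.transpose)) t)
    (ha : ∀ i, HasMatDeriv (fun s => slice (a s) i)
      (slice a' i + (∑ m, Γ m i • slice (a t) m) + Γ.transpose * slice (a t) i + slice (a t) i * Γ) t)
    (hb : ∀ i, HasMatDeriv (fun s => slice (b s) i)
      (slice b' i + (∑ m, Γ m i • slice (b t) m) + Γ.transpose * slice (b t) i + slice (b t) i * Γ) t) :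
    HasMatDeriv (fun s => contraction (h s) (a s) (b s))
      (contraction (h t) a' (b t) + contraction (h t) (a t) b'
        + Γ.transpose * contraction (h t) (a t) (b t) + contraction (h t) (a t) (b t) * Γ) t := by
  intro i k
  have key := ((((ha i).mul hh).mul (hb k).transpose).mul hh).trace
  refine key.congr_deriv ?_
  have e1 : (Γ.transpose * contraction (h t) (a t) (b t)) i k
      = ((∑ m, Γ m i • slice (a t) m) * h t * (slice (b t) k).transpose * h t).trace := by
    simp only [Matrix.mul_apply (M := Γ.transpose), contraction, Matrix.of_apply, Finset.sum_mul,
      Matrix.trace_sum, Matrix.smul_mul, Matrix.trace_smul, smul_eq_mul, Matrix.transpose_apply]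
  have e2 : (contraction (h t) (a t) (b t) * Γ) i k
      = (slice (a t) i * h t * (∑ m, Γ m k • slice (b t) m).transpose * h t).trace := by
    simp only [Matrix.mul_apply (N := Γ), contraction, Matrix.of_apply, Finset.sum_mul,
      Finset.mul_sum, Matrix.transpose_sum, Matrix.transpose_smul, Matrix.mul_smul,
      Matrix.trace_sum, Matrix.smul_mul, Matrix.trace_smul, smul_eq_mul, mul_comm]
  simp only [Matrix.add_apply, e1, e2]
  simp only [contraction, Matrix.of_apply]
  generalize (∑ m, Γ m i • slice (a t) m) = x
  generalize (∑ m, Γ m k • slice (b t) m) = z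
  simp only [Matrix.transpose_add, Matrix.transpose_mul, Matrix.transpose_transpose,
    Matrix.add_mul, Matrix.mul_add, Matrix.trace_add, Matrix.neg_mul, Matrix.mul_neg,
    Matrix.trace_neg, Matrix.mul_assoc, neg_add]
  -- The terms with Γ on a contracted index cancel against the derivative of h; this pair needs a
  -- cyclic rotation under the trace.
  have e3 : (Γ.transpose * (slice (a t) i * (h t * ((slice (b t) k).transpose * h t)))).trace
      = (slice (a t) i * (h t * ((slice (b t) k).transpose * (h t * Γ.transpose)))).trace := by
    rw [Matrix.trace_mul_comm]; simp only [Matrix.mul_assoc]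
  rw [e3]
  ring

/-! ### Smoothness of the tensors of a positive form -/

/-- Evaluation of `3`-forms at three vectors. -/
def triCLM (u v w : R7) : (R7 [⋀^Fin 3]→L[ℝ] ℝ) →L[ℝ] ℝ :=
  ContinuousAlternatingMap.apply ℝ R7 ℝ ![u, v, w]

theorem triCLM_apply (α : R7 [⋀^Fin 3]→L[ℝ] ℝ) (u v w : R7) : triCLM u v w α = tri α u v w := rfl

/-- A smooth positive closed `3`-form on an open set. -/
structure IsLocalG2 (U : Set R7) (φ : LocalForm 3) : Prop where
  isOpen : IsOpen U
  smooth : ContDiffOn ℝ ∞ φ U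
  positive : ∀ y ∈ U, IsPositive (φ y)
  closed : ∀ y ∈ U, extDeriv φ y = 0

section
variable {U : Set R7}

theorem contDiffOn_tri {α : LocalForm 3} (h : ContDiffOn ℝ ∞ α U) (u v w : R7) :
    ContDiffOn ℝ ∞ (fun z => tri (α z) u v w) U :=
  (triCLM u v w).contDiff.comp_contDiffOn h

theorem contDiffOn_det {n : Type*} [Fintype n] [DecidableEq n] {M : R7 → Matrix n n ℝ}
    (h : ∀ i j, ContDiffOn ℝ ∞ (fun z => M z i j) U) : ContDiffOn ℝ ∞ (fun z => (M z).det) U := by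
  simp only [Matrix.det_apply']
  exact ContDiffOn.sum fun σ _ => contDiffOn_const.mul (contDiffOn_prod fun i _ => h _ _)

theorem contDiffOn_matrix_inv {n : Type*} [Fintype n] [DecidableEq n] {M : R7 → Matrix n n ℝ}
    (h : ∀ i j, ContDiffOn ℝ ∞ (fun z => M z i j) U) (h0 : ∀ z ∈ U, (M z).det ≠ 0) (i j : n) :
    ContDiffOn ℝ ∞ (fun z => (M z)⁻¹ i j) U := by
  simp only [Matrix.inv_def, Matrix.smul_apply, Ring.inverse_eq_inv, smul_eq_mul,
    Matrix.adjugate_apply]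
  refine ((contDiffOn_det h).inv h0).mul (contDiffOn_det fun a b => ?_)
  by_cases hj : a = j
  · subst hj; simpa only [Matrix.updateRow_self] using contDiffOn_const
  · simpa only [Matrix.updateRow_ne hj] using h a b

theorem contDiffOn_bryantForm {φ : LocalForm 3} (h : ContDiffOn ℝ ∞ φ U) (i j : Fin 7) :
    ContDiffOn ℝ ∞ (fun z => bryantForm (φ z) i j) U := by
  simp only [bryantForm, Matrix.of_apply, comp_eq_tri]
  exact contDiffOn_const.mul (contDiffOn_const.mul (ContDiffOn.sum fun σ _ =>
    contDiffOn_const.mul (((contDiffOn_tri h _ _ _).mul (contDiffOn_tri h _ _ _)).mul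
      (contDiffOn_tri h _ _ _))))

/-- The signed root is smooth off zero, and the determinant of the Bryant form of a positive form is
never zero. -/
theorem contDiffAt_signed_root {d : ℝ} (hd : d ≠ 0) :
    ContDiffAt ℝ ∞ (fun x : ℝ => Real.sign x * |x| ^ (1 / 9 : ℝ)) d := by
  rcases lt_or_gt_of_ne hd with h | h
  · have h1 : ContDiffAt ℝ ∞ (fun x : ℝ => -(-x) ^ (1 / 9 : ℝ)) d :=
      ((contDiffAt_id.neg).rpow_const_of_ne (by simpa using hd)).neg
    refine h1.congr_of_eventuallyEq ?_
    filter_upwards [eventually_lt_nhds h] with x hx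
    rw [Real.sign_of_neg hx, abs_of_neg hx]; ring
  · have h1 : ContDiffAt ℝ ∞ (fun x : ℝ => x ^ (1 / 9 : ℝ)) d :=
      contDiffAt_id.rpow_const_of_ne hd
    refine h1.congr_of_eventuallyEq ?_
    filter_upwards [eventually_gt_nhds h] with x hx
    rw [Real.sign_of_pos hx, abs_of_pos hx]; ring

/-- Currying of the first argument as a continuous linear map. -/
def curryCLM (k : ℕ) :
    (R7 [⋀^Fin (k + 1)]→L[ℝ] ℝ) →L[ℝ] (R7 →L[ℝ] R7 [⋀^Fin k]→L[ℝ] ℝ) :=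
  (ContinuousAlternatingMap.curryLeftLI (𝕜 := ℝ) (E := R7) (F := ℝ)
    (n := k)).toContinuousLinearMap

theorem contDiffOn_curryLeft {k : ℕ} {α : LocalForm (k + 1)} (hα : ContDiffOn ℝ ∞ α U) :
    ContDiffOn ℝ ∞ (fun z => (α z).curryLeft) U := by
  have hc : ContDiff ℝ ∞ (curryCLM k) := by apply ContinuousLinearMap.contDiff
  exact hc.comp_contDiffOn hα

theorem contDiffOn_act {k : ℕ} {A : R7 → R7 →L[ℝ] R7} {α : LocalForm (k + 1)}
    (hA : ContDiffOn ℝ ∞ A U) (hα : ContDiffOn ℝ ∞ α U) :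
    ContDiffOn ℝ ∞ (fun z => act (A z) (α z)) U := by
  have h1 : ContDiffOn ℝ ∞ (fun z => (α z).curryLeft) U := contDiffOn_curryLeft hα
  exact (ContinuousAlternatingMap.alternatizeUncurryFinCLM ℝ R7 ℝ (n := k)).contDiff.comp_contDiffOn
    (h1.clm_comp hA)

theorem contDiffOn_toEuclideanCLM {M : R7 → Matrix (Fin 7) (Fin 7) ℝ}
    (h : ∀ i j, ContDiffOn ℝ ∞ (fun z => M z i j) U) :
    ContDiffOn ℝ ∞ (fun z => Matrix.toEuclideanCLM (𝕜 := ℝ) (M z)) U := by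
  rw [contDiffOn_clm_apply]
  intro v
  rw [contDiffOn_euclidean]
  intro i
  simp only [apply_coord, mat_toEuclideanCLM]
  exact ContDiffOn.sum fun j _ => (h i j).mul contDiffOn_const

theorem contDiffOn_pderiv (hU : IsOpen U) {f : R7 → ℝ} (hf : ContDiffOn ℝ ∞ f U) (i : Fin 7) :
    ContDiffOn ℝ ∞ (pderiv i f) U :=
  (hf.fderiv_of_isOpen hU (by norm_num)).clm_apply contDiffOn_const

/-- Tensor identities are differentiated along straight lines, where one-variable product rules and
uniqueness of derivatives suffice. -/
theorem hasDerivAt_line {E : Type*} [NormedAddCommGroup E] [NormedSpace ℝ E] (hU : IsOpen U)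
    {f : R7 → E} (hf : ContDiffOn ℝ ∞ f U) {y : R7} (hy : y ∈ U) (w : R7) :
    HasDerivAt (fun t : ℝ => f (y + t • w)) (fderiv ℝ f y w) 0 :=
  ((hf.contDiffAt (hU.mem_nhds hy)).differentiableAt (by simp)).hasFDerivAt.hasLineDerivAt w

theorem pderiv_mul (hU : IsOpen U) {f g : R7 → ℝ} (hf : ContDiffOn ℝ ∞ f U)
    (hg : ContDiffOn ℝ ∞ g U) {y : R7} (hy : y ∈ U) (i : Fin 7) :
    pderiv i (fun z => f z * g z) y = pderiv i f y * g y + f y * pderiv i g y := by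
  have h1 := (hasDerivAt_line hU hf hy (basisVec i)).mul (hasDerivAt_line hU hg hy (basisVec i))
  have h2 := hasDerivAt_line hU (hf.mul hg) hy (basisVec i)
  have := h2.unique h1
  simpa [pderiv] using this

theorem fderiv_coord (hU : IsOpen U) {X : R7 → R7} (hX : ContDiffOn ℝ ∞ X U) {y : R7} (hy : y ∈ U)
    (w : R7) (k : Fin 7) : fderiv ℝ (fun z => X z k) y w = fderiv ℝ X y w k := by
  have h1 := (EuclideanSpace.proj k : R7 →L[ℝ] ℝ).hasFDerivAt.comp_hasDerivAt
    (0 : ℝ) (hasDerivAt_line hU hX hy w)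
  exact (hasDerivAt_line hU (contDiffOn_euclidean.1 hX k) hy w).unique h1

theorem tri_fderiv (hU : IsOpen U) {α : LocalForm 3} (hα : ContDiffOn ℝ ∞ α U) {y : R7}
    (hy : y ∈ U) (w u v x : R7) :
    HasDerivAt (fun t : ℝ => tri (α (y + t • w)) u v x) (tri (fderiv ℝ α y w) u v x) 0 :=
  (triCLM u v x).hasFDerivAt.comp_hasDerivAt (0 : ℝ) (hasDerivAt_line hU hα hy w)

end

section
variable {U : Set R7} {φ : LocalForm 3}

theorem IsLocalG2.volCoeff_smooth (h : IsLocalG2 U φ) :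
    ContDiffOn ℝ ∞ (fun z => volCoeff (φ z)) U := by
  intro z hz
  obtain ⟨A, hA⟩ := h.positive z hz
  exact (contDiffAt_signed_root hA.det_bryantForm_ne_zero).comp_contDiffWithinAt z
    (contDiffOn_det (contDiffOn_bryantForm h.smooth) z hz)

theorem IsLocalG2.volCoeff_ne_zero (h : IsLocalG2 U φ) {z : R7} (hz : z ∈ U) :
    volCoeff (φ z) ≠ 0 := by
  obtain ⟨A, hA⟩ := h.positive z hz
  exact hA.volCoeff_ne_zero

theorem IsLocalG2.gMat_smooth (h : IsLocalG2 U φ) (i j : Fin 7) :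
    ContDiffOn ℝ ∞ (fun z => gMat φ z i j) U := by
  simp only [gMat, metricOf, Matrix.smul_apply, smul_eq_mul]
  exact (h.volCoeff_smooth.inv fun z hz => h.volCoeff_ne_zero hz).mul
    (contDiffOn_bryantForm h.smooth i j)

theorem IsLocalG2.gMat_symm (h : IsLocalG2 U φ) {z : R7} (hz : z ∈ U) (i j : Fin 7) :
    gMat φ z i j = gMat φ z j i := by
  obtain ⟨A, hA⟩ := h.positive z hz
  exact congrFun (congrFun hA.transpose_metricOf j) i

theorem IsLocalG2.gMat_mul_gInv (h : IsLocalG2 U φ) {z : R7} (hz : z ∈ U) :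
    gMat φ z * gInv φ z = 1 := by
  obtain ⟨A, hA⟩ := h.positive z hz
  exact hA.metricOf_mul_inv

theorem IsLocalG2.gInv_mul_gMat (h : IsLocalG2 U φ) {z : R7} (hz : z ∈ U) :
    gInv φ z * gMat φ z = 1 := mul_eq_one_comm.mp (h.gMat_mul_gInv hz)

theorem IsLocalG2.gInv_smooth (h : IsLocalG2 U φ) (i j : Fin 7) :
    ContDiffOn ℝ ∞ (fun z => gInv φ z i j) U := by
  refine contDiffOn_matrix_inv h.gMat_smooth (fun z hz => ?_) i j
  have := congrArg Matrix.det (h.gMat_mul_gInv hz)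
  rw [Matrix.det_mul, Matrix.det_one] at this
  exact left_ne_zero_of_mul_eq_one this

theorem IsLocalG2.christoffel_smooth (h : IsLocalG2 U φ) (k i j : Fin 7) :
    ContDiffOn ℝ ∞ (christoffel φ k i j) U := by
  have hd : ∀ a b c, ContDiffOn ℝ ∞ (pderiv a fun z => gMat φ z b c) U := fun a b c =>
    contDiffOn_pderiv h.isOpen (h.gMat_smooth b c) a
  exact contDiffOn_const.mul (ContDiffOn.sum fun l _ => (h.gInv_smooth k l).mul
    (((hd i j l).add (hd j i l)).sub (hd l i j)))

theorem IsLocalG2.connection_smooth (h : IsLocalG2 U φ) (i : Fin 7) :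
    ContDiffOn ℝ ∞ (connection φ i) U :=
  contDiffOn_toEuclideanCLM fun k j => h.christoffel_smooth k i j

theorem IsLocalG2.covDeriv_smooth (h : IsLocalG2 U φ) {k : ℕ} {α : LocalForm (k + 1)}
    (hα : ContDiffOn ℝ ∞ α U) (i : Fin 7) : ContDiffOn ℝ ∞ (covDeriv φ α i) U :=
  ((hα.fderiv_of_isOpen h.isOpen (by norm_num)).clm_apply contDiffOn_const).sub
    (contDiffOn_act (h.connection_smooth i) hα)

/-! ### The Levi-Civita connection -/

/-- The matrix of the connection in the direction `∂ᵢ`. -/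
def connMat (φ : LocalForm 3) (i : Fin 7) (y : R7) : Matrix (Fin 7) (Fin 7) ℝ :=
  Matrix.of fun k j => christoffel φ k i j y

theorem mat_connection (i : Fin 7) (y : R7) : mat (connection φ i y) = connMat φ i y :=
  mat_toEuclideanCLM _

theorem IsLocalG2.pderiv_gMat_symm (h : IsLocalG2 U φ) {y : R7} (hy : y ∈ U) (a b c : Fin 7) :
    pderiv a (fun z => gMat φ z b c) y = pderiv a (fun z => gMat φ z c b) y := by
  have e : (fun z => gMat φ z b c) =ᶠ[𝓝 y] fun z => gMat φ z c b := by
    filter_upwards [h.isOpen.mem_nhds hy] with z hz using h.gMat_symm hz b c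
  rw [pderiv, pderiv, e.fderiv_eq]

theorem IsLocalG2.christoffel_symm (h : IsLocalG2 U φ) {y : R7} (hy : y ∈ U) (k i j : Fin 7) :
    christoffel φ k i j y = christoffel φ k j i y := by
  rw [christoffel, christoffel]
  congr 1
  refine Finset.sum_congr rfl fun l _ => ?_
  rw [h.pderiv_gMat_symm hy l i j]; ring

/-- The Koszul formula with the upper index lowered. -/
theorem IsLocalG2.gMat_mul_connMat (h : IsLocalG2 U φ) {y : R7} (hy : y ∈ U) (k i j : Fin 7) :
    (gMat φ y * connMat φ i y) k j = 1 / 2 * (pderiv i (fun z => gMat φ z j k) y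
      + pderiv j (fun z => gMat φ z i k) y - pderiv k (fun z => gMat φ z i j) y) := by
  have e : connMat φ i y = gInv φ y * Matrix.of fun l j => 1 / 2 * (pderiv i (fun z => gMat φ z j l) y
      + pderiv j (fun z => gMat φ z i l) y - pderiv l (fun z => gMat φ z i j) y) := by
    ext k j
    simp only [connMat, christoffel, Matrix.mul_apply, Matrix.of_apply, Finset.mul_sum]
    exact Finset.sum_congr rfl fun l _ => by ring
  rw [e, ← Matrix.mul_assoc, h.gMat_mul_gInv hy, Matrix.one_mul]; rfl

/-- The Levi-Civita connection is metric. -/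
theorem IsLocalG2.pderiv_gMat (h : IsLocalG2 U φ) {y : R7} (hy : y ∈ U) (i j k : Fin 7) :
    pderiv i (fun z => gMat φ z j k) y =
      ((connMat φ i y).transpose * gMat φ y + gMat φ y * connMat φ i y) j k := by
  have e : (connMat φ i y).transpose * gMat φ y = (gMat φ y * connMat φ i y).transpose := by
    rw [Matrix.transpose_mul]
    congr 1
    ext a b; exact h.gMat_symm hy a b
  rw [e, Matrix.add_apply, Matrix.transpose_apply, h.gMat_mul_connMat hy, h.gMat_mul_connMat hy,
    h.pderiv_gMat_symm hy i k j, h.pderiv_gMat_symm hy j i k]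
  ring

theorem fderiv_eq_sum_pderiv (f : R7 → ℝ) (y w : R7) :
    fderiv ℝ f y w = ∑ i, w i * pderiv i f y := by
  conv_lhs => rw [← sum_basisVec w, map_sum]
  exact Finset.sum_congr rfl fun i _ => by rw [map_smul]; rfl

theorem mat_add (A B : R7 →L[ℝ] R7) : mat (A + B) = mat A + mat B := rfl

theorem mat_smul (c : ℝ) (A : R7 →L[ℝ] R7) : mat (c • A) = c • mat A := rfl

/-- The endomorphism `v ↦ ∇_w v` for constant vectors. -/
def conn (φ : LocalForm 3) (w : R7) (y : R7) : R7 →L[ℝ] R7 := ∑ i, w i • connection φ i y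

theorem mat_conn (w y : R7) : mat (conn φ w y) = ∑ i, w i • connMat φ i y := by
  ext a b
  simp only [mat_apply, conn, sum_apply, smul_apply,
    WithLp.ofLp_sum, Finset.sum_apply, PiLp.smul_apply, smul_eq_mul, Matrix.sum_apply,
    Matrix.smul_apply, ← mat_connection]

theorem conn_basisVec (i : Fin 7) (y : R7) : conn φ (basisVec i) y = connection φ i y := by
  refine mat_injective ?_
  rw [mat_conn, mat_connection]
  simp [basisVec_apply, dl, ite_smul]

theorem IsLocalG2.conn_smooth (h : IsLocalG2 U φ) (w : R7) : ContDiffOn ℝ ∞ (conn φ w) U :=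
  ContDiffOn.sum fun i _ => (h.connection_smooth i).const_smul (w i)

theorem conn_apply (u v y : R7) (k : Fin 7) :
    conn φ u y v k = ∑ i, ∑ j, u i * v j * christoffel φ k i j y := by
  rw [apply_coord, mat_conn]
  simp only [Matrix.sum_apply, Matrix.smul_apply, connMat, Matrix.of_apply, smul_eq_mul,
    Finset.sum_mul]
  rw [Finset.sum_comm]
  exact Finset.sum_congr rfl fun i _ => Finset.sum_congr rfl fun j _ => by ring

/-- The Levi-Civita connection is torsion-free. -/
theorem IsLocalG2.conn_comm (h : IsLocalG2 U φ) {y : R7} (hy : y ∈ U) (u v : R7) :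
    conn φ u y v = conn φ v y u := by
  ext k
  rw [conn_apply, conn_apply, Finset.sum_comm]
  exact Finset.sum_congr rfl fun i _ => Finset.sum_congr rfl fun j _ => by
    rw [h.christoffel_symm hy k j i]; ring

theorem conn_add (u v y : R7) : conn φ (u + v) y = conn φ u y + conn φ v y := by
  refine mat_injective ?_
  rw [mat_add]
  simp only [mat_conn, ← Finset.sum_add_distrib, ← add_smul]
  rfl

theorem conn_smul (c : ℝ) (u y : R7) : conn φ (c • u) y = c • conn φ u y := by
  refine mat_injective ?_
  rw [mat_smul]
  simp only [mat_conn, Finset.smul_sum, ← mul_smul]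
  rfl

theorem IsLocalG2.hasMatDeriv_gMat (h : IsLocalG2 U φ) {y : R7} (hy : y ∈ U) (w : R7) :
    HasMatDeriv (fun t => gMat φ (y + t • w))
      ((mat (conn φ w y)).transpose * gMat φ y + gMat φ y * mat (conn φ w y)) 0 := fun j k => by
  refine (hasDerivAt_line h.isOpen (h.gMat_smooth j k) hy w).congr_deriv ?_
  rw [fderiv_eq_sum_pderiv, mat_conn]
  simp only [h.pderiv_gMat hy, Matrix.transpose_sum, Matrix.transpose_smul, Matrix.sum_mul,
    Matrix.mul_sum, Matrix.smul_mul, Matrix.mul_smul, Matrix.add_apply, Matrix.sum_apply,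
    Matrix.smul_apply, smul_eq_mul, mul_add, Finset.sum_add_distrib]

theorem IsLocalG2.eventually_line (h : IsLocalG2 U φ) {y : R7} (hy : y ∈ U) (w : R7) :
    ∀ᶠ t : ℝ in 𝓝 0, y + t • w ∈ U := by
  have hc : ContinuousAt (fun t : ℝ => y + t • w) 0 := by fun_prop
  exact hc (h.isOpen.mem_nhds (by simpa using hy))

/-- Obtained by differentiating g g⁻¹ = 1 along the line. -/
theorem IsLocalG2.hasMatDeriv_gInv (h : IsLocalG2 U φ) {y : R7} (hy : y ∈ U) (w : R7) :
    HasMatDeriv (fun t => gInv φ (y + t • w))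
      (-(mat (conn φ w y) * gInv φ y + gInv φ y * (mat (conn φ w y)).transpose)) 0 := by
  have hd : HasMatDeriv (fun t => gInv φ (y + t • w))
      (Matrix.of fun j k => fderiv ℝ (fun z => gInv φ z j k) y (w)) 0 := fun j k =>
    hasDerivAt_line h.isOpen (h.gInv_smooth j k) hy _
  have hm := (h.hasMatDeriv_gMat hy w).mul hd
  have hc : HasMatDeriv (fun t => gMat φ (y + t • w) * gInv φ (y + t • w)) 0 0 := by
    intro a b
    refine (hasDerivAt_const (0 : ℝ) ((1 : Matrix (Fin 7) (Fin 7) ℝ) a b)).congr_of_eventuallyEq ?_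
    filter_upwards [h.eventually_line hy (w)] with t ht
    rw [h.gMat_mul_gInv ht]
  have e := hm.unique hc
  simp only [zero_smul, add_zero] at e
  have e2 := congrArg (gInv φ y * ·) e
  simp only [Matrix.mul_add, Matrix.add_mul, ← Matrix.mul_assoc, h.gInv_mul_gMat hy,
    Matrix.one_mul, Matrix.mul_zero] at e2
  rw [Matrix.mul_assoc (gInv φ y * _), h.gMat_mul_gInv hy, Matrix.mul_one] at e2
  convert hd using 1
  rw [neg_eq_iff_add_eq_zero, add_comm (mat (conn φ w y) * _)]
  exact e2

end

/-! ### Covariant derivatives of `3`-forms -/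

theorem tri_act (A : R7 →L[ℝ] R7) (α : R7 [⋀^Fin 3]→L[ℝ] ℝ) (u v w : R7) :
    tri (act A α) u v w = tri α (A u) v w + tri α u (A v) w + tri α u v (A w) := by
  rw [tri_eq, act_apply, Fin.sum_univ_three, apply_eq_tri, apply_eq_tri, apply_eq_tri]
  rfl

theorem tri_add (α β : R7 [⋀^Fin 3]→L[ℝ] ℝ) (u v w : R7) :
    tri (α + β) u v w = tri α u v w + tri β u v w := rfl

theorem tri_sub (α β : R7 [⋀^Fin 3]→L[ℝ] ℝ) (u v w : R7) :
    tri (α - β) u v w = tri α u v w - tri β u v w := rfl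

theorem tri_smul (c : ℝ) (α : R7 [⋀^Fin 3]→L[ℝ] ℝ) (u v w : R7) :
    tri (c • α) u v w = c * tri α u v w := rfl

theorem ext_tri {α β : R7 [⋀^Fin 3]→L[ℝ] ℝ} (h : ∀ u v w, tri α u v w = tri β u v w) : α = β :=
  ext_arr fun _ _ _ => h _ _ _

/-- The covariant derivative `∇_w α` in the direction of a constant vector. -/
def nabla (φ : LocalForm 3) (α : LocalForm 3) (w : R7) : LocalForm 3 :=
  fun y => fderiv ℝ α y w - act (conn φ w y) (α y)

/-- The second covariant derivative. -/
def hess (φ : LocalForm 3) (u v y : R7) : R7 [⋀^Fin 3]→L[ℝ] ℝ :=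
  nabla φ (nabla φ φ v) u y - nabla φ φ (conn φ u y v) y

/-- The curvature endomorphism. -/
def curvEnd (φ : LocalForm 3) (u v y : R7) : R7 →L[ℝ] R7 :=
  fderiv ℝ (conn φ v) y u - fderiv ℝ (conn φ u) y v
    + ((conn φ u y).comp (conn φ v y) - (conn φ v y).comp (conn φ u y))

section
variable {U : Set R7} {φ α : LocalForm 3} {y : R7}

theorem nabla_basisVec (i : Fin 7) : nabla φ α (basisVec i) = covDeriv φ α i := by
  funext y; rw [nabla, covDeriv, conn_basisVec]

theorem tri_nabla (w u v x : R7) : tri (nabla φ α w y) u v x = tri (fderiv ℝ α y w) u v x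
    - (tri (α y) (conn φ w y u) v x + tri (α y) u (conn φ w y v) x
      + tri (α y) u v (conn φ w y x)) := by
  rw [nabla, tri_sub, tri_act]

theorem nabla_add (u v : R7) : nabla φ α (u + v) y = nabla φ α u y + nabla φ α v y := by
  refine ext_tri fun a b c => ?_
  simp only [tri_add, tri_nabla, conn_add, map_add, add_apply, tri_add_left,
    tri_add_mid, tri_add_right]
  ring

theorem nabla_smul (c : ℝ) (u : R7) : nabla φ α (c • u) y = c • nabla φ α u y := by
  refine ext_tri fun a b d => ?_
  simp only [tri_smul, tri_nabla, conn_smul, map_smul, smul_apply,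
    tri_smul_left, tri_smul_mid, tri_smul_right]
  ring

theorem nabla_sum {ι : Type*} (s : Finset ι) (c : ι → ℝ) (f : ι → R7) :
    nabla φ α (∑ i ∈ s, c i • f i) y = ∑ i ∈ s, c i • nabla φ α (f i) y := by
  let L : R7 →ₗ[ℝ] (R7 [⋀^Fin 3]→L[ℝ] ℝ) :=
    { toFun := fun u => nabla φ α u y, map_add' := nabla_add, map_smul' := nabla_smul }
  refine (map_sum L (fun i => c i • f i) s).trans ?_
  exact Finset.sum_congr rfl fun i _ => map_smul L _ _

theorem nabla_eq_sum (w : R7) : nabla φ α w y = ∑ i, w i • covDeriv φ α i y := by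
  conv_lhs => rw [← sum_basisVec w, nabla_sum]
  simp only [nabla_basisVec]

theorem IsLocalG2.nabla_smooth (h : IsLocalG2 U φ) (hα : ContDiffOn ℝ ∞ α U) (w : R7) :
    ContDiffOn ℝ ∞ (nabla φ α w) U :=
  ((hα.fderiv_of_isOpen h.isOpen (by norm_num)).clm_apply contDiffOn_const).sub
    (contDiffOn_act (h.conn_smooth w) hα)

/-- The Leibniz rule for the evaluation of a form on constant vectors. -/
theorem IsLocalG2.hasDerivAt_tri (h : IsLocalG2 U φ) (hα : ContDiffOn ℝ ∞ α U) (hy : y ∈ U)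
    (w u v x : R7) : HasDerivAt (fun t : ℝ => tri (α (y + t • w)) u v x)
      (tri (nabla φ α w y) u v x + tri (α y) (conn φ w y u) v x + tri (α y) u (conn φ w y v) x
        + tri (α y) u v (conn φ w y x)) 0 :=
  (tri_fderiv h.isOpen hα hy w u v x).congr_deriv (by rw [tri_nabla]; ring)

theorem tri_apply_basisVec_left (A : R7 →L[ℝ] R7) (β : R7 [⋀^Fin 3]→L[ℝ] ℝ) (i : Fin 7) (u v : R7) :
    tri β (A (basisVec i)) u v = ∑ m, mat A m i * tri β (basisVec m) u v := by
  rw [apply_basisVec, tri_sum_left]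

theorem slice_act (A : R7 →L[ℝ] R7) (β : R7 [⋀^Fin 3]→L[ℝ] ℝ) (i : Fin 7) :
    slice (act A β) i = (∑ m, mat A m i • slice β m) + (mat A).transpose * slice β i
      + slice β i * mat A := by
  ext p q
  simp only [slice, Matrix.of_apply, arr, tri_act, apply_basisVec, tri_sum_left, tri_sum_mid,
    tri_sum_right, Matrix.add_apply, Matrix.sum_apply, Matrix.smul_apply, Matrix.mul_apply,
    Matrix.transpose_apply, smul_eq_mul]
  simp only [mul_comm]

theorem IsLocalG2.hasMatDeriv_slice (h : IsLocalG2 U φ) (hα : ContDiffOn ℝ ∞ α U) (hy : y ∈ U)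
    (w : R7) (i : Fin 7) : HasMatDeriv (fun t : ℝ => slice (α (y + t • w)) i)
      (slice (nabla φ α w y) i + (∑ m, mat (conn φ w y) m i • slice (α y) m)
        + (mat (conn φ w y)).transpose * slice (α y) i + slice (α y) i * mat (conn φ w y)) 0 := by
  intro p q
  refine (tri_fderiv h.isOpen hα hy w (basisVec i) (basisVec p) (basisVec q)).congr_deriv ?_
  have e := slice_act (conn φ w y) (α y) i
  have e2 : slice (fderiv ℝ α y w) i = slice (nabla φ α w y) i + slice (act (conn φ w y) (α y)) i := by
    ext p q
    simp only [slice, Matrix.of_apply, arr, Matrix.add_apply]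
    rw [nabla, tri_sub]; ring
  have e3 : slice (fderiv ℝ α y w) i = slice (nabla φ α w y) i
      + (∑ m, mat (conn φ w y) m i • slice (α y) m)
      + (mat (conn φ w y)).transpose * slice (α y) i + slice (α y) i * mat (conn φ w y) := by
    rw [e2, e]; simp only [add_assoc]
  exact congrFun (congrFun e3 p) q

theorem IsLocalG2.hasMatDeriv_contraction (h : IsLocalG2 U φ) {β : LocalForm 3}
    (hα : ContDiffOn ℝ ∞ α U) (hβ : ContDiffOn ℝ ∞ β U) (hy : y ∈ U) (w : R7) :
    HasMatDeriv (fun t : ℝ => contraction (gInv φ (y + t • w)) (α (y + t • w)) (β (y + t • w)))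
      (contraction (gInv φ y) (nabla φ α w y) (β y) + contraction (gInv φ y) (α y) (nabla φ β w y)
        + (mat (conn φ w y)).transpose * contraction (gInv φ y) (α y) (β y)
        + contraction (gInv φ y) (α y) (β y) * mat (conn φ w y)) 0 := by
  have h0 : y + (0 : ℝ) • w = y := by simp
  have := G2.hasMatDeriv_contraction (Γ := mat (conn φ w y)) (h := fun t : ℝ => gInv φ (y + t • w))
    (a := fun t : ℝ => α (y + t • w)) (b := fun t : ℝ => β (y + t • w)) (a' := nabla φ α w y)
    (b' := nabla φ β w y) (t := 0) ?_ ?_ ?_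
  · simpa only [h0] using this
  · simpa only [h0] using h.hasMatDeriv_gInv hy w
  · simpa only [h0] using h.hasMatDeriv_slice hα hy w
  · simpa only [h0] using h.hasMatDeriv_slice hβ hy w

/-- The derivative of the identity that recovers the metric from the form. -/
theorem IsLocalG2.contraction_nabla (h : IsLocalG2 U φ) (hy : y ∈ U) (w : R7) :
    contraction (gInv φ y) (nabla φ φ w y) (φ y) + contraction (gInv φ y) (φ y) (nabla φ φ w y)
      = 0 := by
  have e : ∀ z ∈ U, contraction (gInv φ z) (φ z) (φ z) = (6 : ℝ) • gMat φ z := by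
    intro z hz
    obtain ⟨A, hA⟩ := h.positive z hz
    exact hA.contraction_eq
  have h1 := h.hasMatDeriv_contraction h.smooth h.smooth hy w
  have h2 : HasMatDeriv (fun t : ℝ => contraction (gInv φ (y + t • w)) (φ (y + t • w))
      (φ (y + t • w))) ((6 : ℝ) • ((mat (conn φ w y)).transpose * gMat φ y
        + gMat φ y * mat (conn φ w y))) 0 := by
    intro i j
    refine ((h.hasMatDeriv_gMat hy w i j).const_mul 6).congr_of_eventuallyEq ?_
    filter_upwards [h.eventually_line hy w] with t ht
    rw [e _ ht]; rfl
  have h3 := h1.unique h2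
  rw [e y hy, smul_add, ← Matrix.smul_mul, ← Matrix.mul_smul, add_assoc] at h3
  rw [Matrix.mul_smul, Matrix.smul_mul, Matrix.smul_mul, Matrix.mul_smul] at h3
  exact add_eq_right.mp h3

/-- The derivative of `IsLocalG2.contraction_nabla` along u; the connection terms drop out because
they multiply that same vanishing sum. -/
theorem IsLocalG2.contraction_nabla_nabla (h : IsLocalG2 U φ) (hy : y ∈ U) (u v : R7) :
    contraction (gInv φ y) (nabla φ (nabla φ φ v) u y) (φ y)
      + contraction (gInv φ y) (φ y) (nabla φ (nabla φ φ v) u y)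
      = -(contraction (gInv φ y) (nabla φ φ u y) (nabla φ φ v y)
        + contraction (gInv φ y) (nabla φ φ v y) (nabla φ φ u y)) := by
  have hn := h.nabla_smooth h.smooth v
  have h1 := h.hasMatDeriv_contraction hn h.smooth hy u
  have h2 := h.hasMatDeriv_contraction h.smooth hn hy u
  have h3 : HasMatDeriv (fun t : ℝ =>
      contraction (gInv φ (y + t • u)) (nabla φ φ v (y + t • u)) (φ (y + t • u))
      + contraction (gInv φ (y + t • u)) (φ (y + t • u)) (nabla φ φ v (y + t • u))) 0 0 := by
    intro i j
    refine (hasDerivAt_const (0 : ℝ) (0 : ℝ)).congr_of_eventuallyEq ?_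
    filter_upwards [h.eventually_line hy u] with t ht
    rw [h.contraction_nabla ht]; rfl
  have h4 := HasMatDeriv.unique (fun i j => (h1 i j).add (h2 i j)) h3
  have h5 := h.contraction_nabla hy v
  have h6 := congrArg ((mat (conn φ u y)).transpose * ·) h5
  have h7 := congrArg (· * mat (conn φ u y)) h5
  simp only [Matrix.mul_add, Matrix.add_mul, Matrix.mul_zero, Matrix.zero_mul] at h6 h7
  rw [eq_neg_iff_add_eq_zero]
  ext i j
  have a4 := congrFun (congrFun h4 i) j
  have a6 := congrFun (congrFun h6 i) j
  have a7 := congrFun (congrFun h7 i) j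
  simp only [Matrix.add_apply, Matrix.zero_apply] at a4 a6 a7 ⊢
  linarith

end

theorem alternatizeUncurryFin_tri (f : R7 →L[ℝ] R7 [⋀^Fin 3]→L[ℝ] ℝ) (u v w x : R7) :
    ContinuousAlternatingMap.alternatizeUncurryFin f ![u, v, w, x]
      = tri (f u) v w x - tri (f v) u w x + tri (f w) u v x - tri (f x) u v w := by
  rw [ContinuousAlternatingMap.alternatizeUncurryFin_apply, Fin.sum_univ_four, apply_eq_tri,
    apply_eq_tri, apply_eq_tri, apply_eq_tri]
  have e0 : ((-1 : ℤ) ^ ((0 : Fin 4) : ℕ)) = 1 := by norm_num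
  have e1 : ((-1 : ℤ) ^ ((1 : Fin 4) : ℕ)) = -1 := by norm_num
  have e2 : ((-1 : ℤ) ^ ((2 : Fin 4) : ℕ)) = 1 := by norm_num
  have e3 : ((-1 : ℤ) ^ ((3 : Fin 4) : ℕ)) = -1 := by norm_num
  rw [e0, e1, e2, e3, one_smul, one_smul, neg_one_smul, neg_one_smul, sub_eq_add_neg, sub_eq_add_neg]
  rfl

section
variable {U : Set R7} {φ α : LocalForm 3} {y : R7}

theorem IsLocalG2.fderiv_closed (h : IsLocalG2 U φ) (hy : y ∈ U) (u v w x : R7) :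
    tri (fderiv ℝ φ y u) v w x - tri (fderiv ℝ φ y v) u w x + tri (fderiv ℝ φ y w) u v x
      - tri (fderiv ℝ φ y x) u v w = 0 := by
  rw [← alternatizeUncurryFin_tri]
  have : extDeriv φ y ![u, v, w, x] = 0 := by rw [h.closed y hy]; rfl
  exact this

/-- The alternation of the covariant derivative of a closed form vanishes. -/
theorem IsLocalG2.nabla_closed (h : IsLocalG2 U φ) (hy : y ∈ U) (u v w x : R7) :
    tri (nabla φ φ u y) v w x - tri (nabla φ φ v y) u w x + tri (nabla φ φ w y) u v x
      - tri (nabla φ φ x y) u v w = 0 := by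
  have h0 := h.fderiv_closed hy u v w x
  simp only [tri_nabla]
  rw [h.conn_comm hy v u, h.conn_comm hy w u, h.conn_comm hy x u, h.conn_comm hy w v,
    h.conn_comm hy x v, h.conn_comm hy x w]
  rw [tri_swap (φ y) v (conn φ u y w), tri_swap' (φ y) v w (conn φ u y x),
    tri_swap (φ y) v (conn φ u y x) w, tri_swap (φ y) u (conn φ v y w),
    tri_swap' (φ y) u w (conn φ v y x), tri_swap (φ y) u (conn φ v y x) w,
    tri_swap' (φ y) u v (conn φ w y x), tri_swap (φ y) u (conn φ w y x) v]
  linarith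

/-- Differentiating `IsLocalG2.nabla_closed` in the direction p produces one connection term for
each argument, and each of these is again an instance of `IsLocalG2.nabla_closed`. -/
theorem IsLocalG2.hess_closed (h : IsLocalG2 U φ) (hy : y ∈ U) (p u v w x : R7) :
    tri (hess φ p u y) v w x - tri (hess φ p v y) u w x + tri (hess φ p w y) u v x
      - tri (hess φ p x y) u v w = 0 := by
  have hd := fun a b c d => h.hasDerivAt_tri (h.nabla_smooth h.smooth a) hy p b c d
  have h1 := (((hd u v w x).sub (hd v u w x)).add (hd w u v x)).sub (hd x u v w)
  have h2 : HasDerivAt (fun t : ℝ => tri (nabla φ φ u (y + t • p)) v w x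
      - tri (nabla φ φ v (y + t • p)) u w x + tri (nabla φ φ w (y + t • p)) u v x
      - tri (nabla φ φ x (y + t • p)) u v w) 0 0 := by
    refine (hasDerivAt_const (0 : ℝ) (0 : ℝ)).congr_of_eventuallyEq ?_
    filter_upwards [h.eventually_line hy p] with t ht
    exact h.nabla_closed ht u v w x
  have h3 := h1.unique h2
  have c1 := h.nabla_closed hy (conn φ p y u) v w x
  have c2 := h.nabla_closed hy u (conn φ p y v) w x
  have c3 := h.nabla_closed hy u v (conn φ p y w) x
  have c4 := h.nabla_closed hy u v w (conn φ p y x)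
  simp only [hess, tri_sub]
  linarith

/-! ### The Ricci identity -/

theorem minSmoothness_two_le : minSmoothness ℝ 2 ≤ (∞ : ℕ∞ω) := by
  rw [minSmoothness_of_isRCLikeNormedField]
  exact WithTop.coe_le_coe.2 (le_top : (2 : ℕ∞) ≤ ⊤)

theorem tri_mid (β : R7 [⋀^Fin 3]→L[ℝ] ℝ) (u v w : R7) : tri β u v w = -tri β v u w := tri_swap β u v w

theorem tri_rot (β : R7 [⋀^Fin 3]→L[ℝ] ℝ) (u v w : R7) : tri β u v w = tri β w u v := by
  rw [tri_swap', tri_swap]; ring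

/-- Expanding the moving vector in the standard basis reduces the claim to the scalar product rule.
The other slots follow by permuting arguments. -/
theorem hasDerivAt_tri_left {a : ℝ → R7 [⋀^Fin 3]→L[ℝ] ℝ} {a' : R7 [⋀^Fin 3]→L[ℝ] ℝ} {b : ℝ → R7}
    {b' : R7} {t : ℝ} (ha : HasDerivAt a a' t) (hb : HasDerivAt b b' t) (v w : R7) :
    HasDerivAt (fun s => tri (a s) (b s) v w) (tri a' (b t) v w + tri (a t) b' v w) t := by
  have h1 : HasDerivAt (fun s => ∑ i, b s i * tri (a s) (basisVec i) v w)
      (∑ i, (b' i * tri (a t) (basisVec i) v w + b t i * tri a' (basisVec i) v w)) t :=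
    HasDerivAt.fun_sum fun i _ =>
      ((EuclideanSpace.proj i : R7 →L[ℝ] ℝ).hasFDerivAt.comp_hasDerivAt t hb).mul
        ((triCLM (basisVec i) v w).hasFDerivAt.comp_hasDerivAt t ha)
  have e : ∀ (β : R7 [⋀^Fin 3]→L[ℝ] ℝ) (u : R7),
      tri β u v w = ∑ i, u i * tri β (basisVec i) v w := by
    intro β u
    conv_lhs => rw [← sum_basisVec u, tri_sum_left]
  rw [Finset.sum_add_distrib, ← e, ← e, add_comm] at h1
  refine h1.congr_of_eventuallyEq (Filter.Eventually.of_forall fun s => e _ _)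

theorem IsLocalG2.hasDerivAt_conn (h : IsLocalG2 U φ) (hy : y ∈ U) (u v a : R7) :
    HasDerivAt (fun t : ℝ => conn φ v (y + t • u) a) (fderiv ℝ (conn φ v) y u a) 0 := by
  have h1 := (hasDerivAt_line h.isOpen (h.conn_smooth v) hy u).clm_apply (hasDerivAt_const (0 : ℝ) a)
  simpa using h1

theorem IsLocalG2.fderiv_fderiv_comm (h : IsLocalG2 U φ) (hy : y ∈ U) (u v : R7) :
    fderiv ℝ (fun z => fderiv ℝ φ z v) y u = fderiv ℝ (fun z => fderiv ℝ φ z u) y v := by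
  have hs := h.smooth.contDiffAt (h.isOpen.mem_nhds hy)
  have hsym := hs.isSymmSndFDerivAt minSmoothness_two_le
  have hd : DifferentiableAt ℝ (fderiv ℝ φ) y :=
    ((h.smooth.fderiv_of_isOpen h.isOpen (m := ∞) (by norm_num)).contDiffAt
      (h.isOpen.mem_nhds hy)).differentiableAt (by simp)
  have e : ∀ u v, fderiv ℝ (fun z => fderiv ℝ φ z v) y u = fderiv ℝ (fderiv ℝ φ) y u v := by
    intro u v
    have := (hd.hasFDerivAt.clm_apply (hasFDerivAt_const v y)).fderiv
    rw [this]; simp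
  rw [e, e, hsym u v]

theorem IsLocalG2.tri_fderiv_nabla (h : IsLocalG2 U φ) (hy : y ∈ U) (u v a b c : R7) :
    tri (fderiv ℝ (nabla φ φ v) y u) a b c = tri (fderiv ℝ (fun z => fderiv ℝ φ z v) y u) a b c
      - (tri (fderiv ℝ φ y u) (conn φ v y a) b c + tri (φ y) (fderiv ℝ (conn φ v) y u a) b c)
      - (tri (fderiv ℝ φ y u) a (conn φ v y b) c + tri (φ y) a (fderiv ℝ (conn φ v) y u b) c)
      - (tri (fderiv ℝ φ y u) a b (conn φ v y c) + tri (φ y) a b (fderiv ℝ (conn φ v) y u c)) := by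
  have hφ := hasDerivAt_line h.isOpen h.smooth hy u
  have h1 := tri_fderiv h.isOpen (h.nabla_smooth h.smooth v) hy u a b c
  have hs : ContDiffOn ℝ ∞ (fun z => fderiv ℝ φ z v) U :=
    (h.smooth.fderiv_of_isOpen h.isOpen (by norm_num)).clm_apply contDiffOn_const
  have h2 := tri_fderiv h.isOpen hs hy u a b c
  have ha := hasDerivAt_tri_left hφ (h.hasDerivAt_conn hy u v a) b c
  have hb := hasDerivAt_tri_left hφ (h.hasDerivAt_conn hy u v b) a c
  have hc := hasDerivAt_tri_left hφ (h.hasDerivAt_conn hy u v c) a b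
  have h3 := ((h2.sub ha).add hb).sub hc
  have h4 := h3.congr_of_eventuallyEq (f₁ := fun t : ℝ => tri (nabla φ φ v (y + t • u)) a b c)
    (Filter.Eventually.of_forall fun t => by
      simp only [tri_nabla, Pi.sub_apply, Pi.add_apply]
      rw [tri_mid _ a (conn φ v _ b), tri_rot _ a b (conn φ v _ c)]
      ring)
  rw [h1.unique h4, tri_mid _ a (conn φ v y b), tri_mid _ a (fderiv ℝ (conn φ v) y u b),
    tri_rot _ a b (conn φ v y c), tri_rot _ a b (fderiv ℝ (conn φ v) y u c)]
  simp only [zero_smul, add_zero]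
  ring

/-- The Ricci identity. -/
theorem IsLocalG2.hess_comm (h : IsLocalG2 U φ) (hy : y ∈ U) (u v : R7) :
    hess φ u v y - hess φ v u y = -act (curvEnd φ u v y) (φ y) := by
  refine ext_tri fun a b c => ?_
  have e : tri (-act (curvEnd φ u v y) (φ y)) a b c = -tri (act (curvEnd φ u v y) (φ y)) a b c := rfl
  have e2 : ∀ a, curvEnd φ u v y a = fderiv ℝ (conn φ v) y u a + (-1 : ℝ) • fderiv ℝ (conn φ u) y v a
    + (conn φ u y (conn φ v y a) + (-1 : ℝ) • conn φ v y (conn φ u y a)) := by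
    intro a; simp only [neg_one_smul, ← sub_eq_add_neg]; rfl
  rw [e, tri_act, tri_sub, hess, hess, tri_sub, tri_sub, h.conn_comm hy u v,
    tri_nabla u a b c (α := nabla φ φ v), tri_nabla v a b c (α := nabla φ φ u),
    h.tri_fderiv_nabla hy, h.tri_fderiv_nabla hy, h.fderiv_fderiv_comm hy u v]
  simp only [tri_nabla, e2, tri_add_left, tri_add_mid, tri_add_right, tri_smul_left, tri_smul_mid,
    tri_smul_right]
  ring

theorem curvEnd_swap (u v : R7) : curvEnd φ v u y = -curvEnd φ u v y := by
  rw [curvEnd, curvEnd]; abel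

/-- Symmetry of the connection on constant vectors, and of its derivative, makes the terms cancel in
pairs. -/
theorem IsLocalG2.curvEnd_bianchi (h : IsLocalG2 U φ) (hy : y ∈ U) (u v w : R7) :
    curvEnd φ u v y w + curvEnd φ v w y u + curvEnd φ w u y v = 0 := by
  have e : ∀ p a b, fderiv ℝ (conn φ a) y p b = fderiv ℝ (conn φ b) y p a := by
    intro p a b
    refine (h.hasDerivAt_conn hy p a b).unique ((h.hasDerivAt_conn hy p b a).congr_of_eventuallyEq ?_)
    filter_upwards [h.eventually_line hy p] with t ht
    exact h.conn_comm ht a b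
  have e2 : ∀ u v w, curvEnd φ u v y w = fderiv ℝ (conn φ v) y u w - fderiv ℝ (conn φ u) y v w
    + (conn φ u y (conn φ v y w) - conn φ v y (conn φ u y w)) := fun _ _ _ => rfl
  rw [e2, e2, e2, e u w v, e v w u, e w v u, h.conn_comm hy w v, h.conn_comm hy w u,
    h.conn_comm hy v u]
  abel

/-- The curvature endomorphism is skew-adjoint. -/
theorem IsLocalG2.curvEnd_skew (h : IsLocalG2 U φ) (hy : y ∈ U) (u v : R7) :
    (mat (curvEnd φ u v y)).transpose * gMat φ y + gMat φ y * mat (curvEnd φ u v y) = 0 := by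
  have hK : ∀ u v, HasMatDeriv (fun t : ℝ => mat (conn φ v (y + t • u)))
      (mat (fderiv ℝ (conn φ v) y u)) 0 := by
    intro u v i j
    exact (EuclideanSpace.proj i : R7 →L[ℝ] ℝ).hasFDerivAt.comp_hasDerivAt (0 : ℝ)
      (h.hasDerivAt_conn hy u v (basisVec j))
  have hg : ∀ u i j, ContDiffOn ℝ ∞ (fun z => fderiv ℝ (fun z => gMat φ z i j) z u) U :=
    fun u i j => ((h.gMat_smooth i j).fderiv_of_isOpen h.isOpen (by norm_num)).clm_apply
      contDiffOn_const
  -- The second derivative of g in terms of Γ, by using metric compatibility twice. Its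
  -- antisymmetrization in u and v vanishes, and what remains is the skewness of the curvature.
  have h1 : ∀ u v, Matrix.of (fun i j =>
      fderiv ℝ (fun z => fderiv ℝ (fun z => gMat φ z i j) z v) y u)
      = (mat (fderiv ℝ (conn φ v) y u)).transpose * gMat φ y + (mat (conn φ v y)).transpose *
        ((mat (conn φ u y)).transpose * gMat φ y + gMat φ y * mat (conn φ u y))
        + (((mat (conn φ u y)).transpose * gMat φ y + gMat φ y * mat (conn φ u y)) * mat (conn φ v y)
          + gMat φ y * mat (fderiv ℝ (conn φ v) y u)) := by
    intro u v
    have a1 := (hK u v).transpose.mul (h.hasMatDeriv_gMat hy u)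
    have a2 := (h.hasMatDeriv_gMat hy u).mul (hK u v)
    have a3 := HasMatDeriv.unique (M' := _) (M'' := Matrix.of (fun i j =>
      fderiv ℝ (fun z => fderiv ℝ (fun z => gMat φ z i j) z v) y u))
      (fun i j => (a1 i j).add (a2 i j)) ?_
    · rw [← a3]
      simp only [zero_smul, add_zero]
      rfl
    · intro i j
      refine (hasDerivAt_line h.isOpen (hg v i j) hy u).congr_of_eventuallyEq ?_
      filter_upwards [h.eventually_line hy u] with t ht
      have := h.hasMatDeriv_gMat ht v i j
      rw [(hasDerivAt_line h.isOpen (h.gMat_smooth i j) ht v).unique this]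
      rfl
  have h2 : Matrix.of (fun i j => fderiv ℝ (fun z => fderiv ℝ (fun z => gMat φ z i j) z v) y u)
      = Matrix.of (fun i j => fderiv ℝ (fun z => fderiv ℝ (fun z => gMat φ z i j) z u) y v) := by
    ext i j
    have hs := (h.gMat_smooth i j).contDiffAt (h.isOpen.mem_nhds hy)
    have hsym := hs.isSymmSndFDerivAt minSmoothness_two_le
    have hd : DifferentiableAt ℝ (fderiv ℝ (fun z => gMat φ z i j)) y :=
      (((h.gMat_smooth i j).fderiv_of_isOpen h.isOpen (m := ∞) (by norm_num)).contDiffAt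
        (h.isOpen.mem_nhds hy)).differentiableAt (by simp)
    have e : ∀ u v, fderiv ℝ (fun z => fderiv ℝ (fun z => gMat φ z i j) z v) y u
        = fderiv ℝ (fderiv ℝ (fun z => gMat φ z i j)) y u v := by
      intro u v
      rw [(hd.hasFDerivAt.clm_apply (hasFDerivAt_const v y)).fderiv]; simp
    rw [Matrix.of_apply, Matrix.of_apply, e, e, hsym u v]
  rw [h1, h1, ← sub_eq_zero] at h2
  rw [← h2]
  have e3 : mat (curvEnd φ u v y) = mat (fderiv ℝ (conn φ v) y u) - mat (fderiv ℝ (conn φ u) y v)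
      + (mat (conn φ u y) * mat (conn φ v y) - mat (conn φ v y) * mat (conn φ u y)) := by
    rw [← mat_comp, ← mat_comp]; rfl
  rw [e3]
  simp only [Matrix.transpose_add, Matrix.transpose_sub, Matrix.transpose_mul, Matrix.mul_add,
    Matrix.add_mul, Matrix.mul_sub, Matrix.sub_mul, Matrix.mul_assoc]
  abel

end

/-! ### The second jet in a frame -/

/-- The components of `∇φ` in a frame. -/
def jetF (φ : LocalForm 3) (A : R7 ≃L[ℝ] R7) (y : R7) (i a b c : Fin 7) : ℝ :=
  tri (nabla φ φ (frameVec A i) y) (frameVec A a) (frameVec A b) (frameVec A c)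

/-- The components of `∇∇φ` in a frame. -/
def jetW (φ : LocalForm 3) (A : R7 ≃L[ℝ] R7) (y : R7) (i j a b c : Fin 7) : ℝ :=
  tri (hess φ (frameVec A i) (frameVec A j) y) (frameVec A a) (frameVec A b) (frameVec A c)

/-- The components of the curvature in a frame. -/
def jetR (φ : LocalForm 3) (A : R7 ≃L[ℝ] R7) (y : R7) (i j k l : Fin 7) : ℝ :=
  A (curvEnd φ (frameVec A i) (frameVec A j) y (frameVec A l)) k

/-- The matrix of an endomorphism in a frame. -/
def frameEnd (A : R7 ≃L[ℝ] R7) (D : R7 →L[ℝ] R7) (m a : Fin 7) : ℝ := A (D (frameVec A a)) m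

theorem apply_frameVec (A : R7 ≃L[ℝ] R7) (D : R7 →L[ℝ] R7) (a : Fin 7) :
    D (frameVec A a) = ∑ m, frameEnd A D m a • frameVec A m := by
  have h := congrArg A.symm (sum_basisVec (A (D (frameVec A a))))
  rw [ContinuousLinearEquiv.symm_apply_apply, map_sum] at h
  rw [← h]
  exact Finset.sum_congr rfl fun j _ => by rw [map_smul]; rfl

theorem frameEnd_eq (A : R7 ≃L[ℝ] R7) (D : R7 →L[ℝ] R7) (m a : Fin 7) :
    frameEnd A D m a = (mat (A : R7 →L[ℝ] R7) * mat D * frameMat A) m a := by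
  rw [frameMat, ← mat_comp, ← mat_comp]; rfl

section
variable {U : Set R7} {φ : LocalForm 3} {y : R7} {A : R7 ≃L[ℝ] R7}

theorem IsFrame.tri_act {α : R7 [⋀^Fin 3]→L[ℝ] ℝ} (h : IsFrame α A) (D : R7 →L[ℝ] R7)
    (a b c : Fin 7) : G2.tri (act D α) (frameVec A a) (frameVec A b) (frameVec A c)
      = actArr (frameEnd A D) a b c := by
  rw [G2.tri_act, apply_frameVec, apply_frameVec, apply_frameVec, tri_sum_left, tri_sum_mid,
    tri_sum_right, actArr, ← Finset.sum_add_distrib, ← Finset.sum_add_distrib]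
  simp only [h.tri]

theorem alt3_tri (β : R7 [⋀^Fin 3]→L[ℝ] ℝ) (e : Fin 7 → R7) :
    Alt3 fun a b c => tri β (e a) (e b) (e c) :=
  ⟨fun _ _ _ => tri_swap _ _ _ _, fun _ _ _ => tri_swap' _ _ _ _⟩

theorem IsFrame.ctr_eq {α : R7 [⋀^Fin 3]→L[ℝ] ℝ} (h : IsFrame α A) (β : R7 [⋀^Fin 3]→L[ℝ] ℝ)
    (k d : Fin 7) :
    ctr (fun a b c => G2.tri β (frameVec A a) (frameVec A b) (frameVec A c)) k d
      = frameContraction A β α (frameVec A k) (frameVec A d) := by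
  simp only [ctr, frameContraction, h.tri]

theorem frameContraction_sub_left (β β' γ : R7 [⋀^Fin 3]→L[ℝ] ℝ) (u v : R7) :
    frameContraction A (β - β') γ u v = frameContraction A β γ u v - frameContraction A β' γ u v := by
  simp only [frameContraction, tri_sub, sub_mul, Finset.sum_sub_distrib]

theorem IsLocalG2.frameContraction_nabla (h : IsLocalG2 U φ) (hy : y ∈ U) (hA : IsFrame (φ y) A)
    (w u v : R7) : frameContraction A (nabla φ φ w y) (φ y) u v
      + frameContraction A (nabla φ φ w y) (φ y) v u = 0 := by
  have h1 := h.contraction_nabla hy w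
  rw [gInv, gMat, hA.inv_metricOf] at h1
  rw [frameContraction_comm A (nabla φ φ w y) (φ y) v u, frameContraction_eq, frameContraction_eq,
    ← Finset.sum_add_distrib]
  refine Finset.sum_eq_zero fun i _ => ?_
  rw [← Finset.sum_add_distrib]
  refine Finset.sum_eq_zero fun k _ => ?_
  have h2 := congrFun (congrFun h1 i) k
  rw [Matrix.add_apply, Matrix.zero_apply] at h2
  linear_combination (u i * v k) * h2

theorem IsLocalG2.frameContraction_nabla_nabla (h : IsLocalG2 U φ) (hy : y ∈ U)
    (hA : IsFrame (φ y) A) (p q u v : R7) :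
    frameContraction A (nabla φ (nabla φ φ q) p y) (φ y) u v
      + frameContraction A (nabla φ (nabla φ φ q) p y) (φ y) v u
      = -(frameContraction A (nabla φ φ p y) (nabla φ φ q y) u v
        + frameContraction A (nabla φ φ p y) (nabla φ φ q y) v u) := by
  have h1 := h.contraction_nabla_nabla hy p q
  rw [gInv, gMat, hA.inv_metricOf] at h1
  rw [frameContraction_comm A _ _ v u, frameContraction_comm A _ _ v u, ← sub_eq_zero,
    sub_neg_eq_add]
  simp only [frameContraction_eq A _ _ u v, ← Finset.sum_add_distrib]
  refine Finset.sum_eq_zero fun i _ => Finset.sum_eq_zero fun k _ => ?_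
  have h2 := congrFun (congrFun h1 i) k
  rw [Matrix.add_apply, Matrix.neg_apply, Matrix.add_apply] at h2
  linear_combination (u i * v k) * h2

/-- The bridge from analysis to algebra. The frame is used only at y, so it is never differentiated.
-/
theorem IsLocalG2.isSecondJet (h : IsLocalG2 U φ) (hy : y ∈ U) (hA : IsFrame (φ y) A) :
    IsSecondJet (jetF φ A y) (jetW φ A y) (jetR φ A y) where
  closed := ⟨fun x => alt3_tri _ _, fun x a b c => by
    have := h.nabla_closed hy (frameVec A x) (frameVec A a) (frameVec A b) (frameVec A c)
    simp only [jetF]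
    rw [tri_swap' _ _ (frameVec A c) (frameVec A a)]
    linarith⟩
  metric i k d := by
    have := h.frameContraction_nabla hy hA (frameVec A i) (frameVec A k) (frameVec A d)
    rw [← hA.ctr_eq, ← hA.ctr_eq] at this
    exact this
  closed' i := ⟨fun x => alt3_tri _ _, fun x a b c => by
    have := h.hess_closed hy (frameVec A i) (frameVec A x) (frameVec A a) (frameVec A b)
      (frameVec A c)
    simp only [jetW]
    rw [tri_swap' _ _ (frameVec A c) (frameVec A a)]
    linarith⟩
  metric' i j k d := by
    have e : ∀ k d, ctr (jetW φ A y i j) k d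
        = frameContraction A (hess φ (frameVec A i) (frameVec A j) y) (φ y) (frameVec A k)
          (frameVec A d) := fun k d => hA.ctr_eq _ k d
    have h1 := h.frameContraction_nabla_nabla hy hA (frameVec A i) (frameVec A j) (frameVec A k)
      (frameVec A d)
    -- The correction term -∇_{∇_u v} φ of the Hessian contributes nothing, being a first
    -- derivative.
    have h2 := h.frameContraction_nabla hy hA (conn φ (frameVec A i) y (frameVec A j))
      (frameVec A k) (frameVec A d)
    rw [e, e, hess, frameContraction_sub_left, frameContraction_sub_left]
    have h3 : ∀ k d, ∑ b, ∑ c, jetF φ A y i k b c * jetF φ A y j d b c = frameContraction A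
      (nabla φ φ (frameVec A i) y) (nabla φ φ (frameVec A j) y) (frameVec A k) (frameVec A d) :=
      fun _ _ => rfl
    rw [h3, h3]
    linarith
  comm i j a b c := by
    have h1 := h.hess_comm hy (frameVec A i) (frameVec A j)
    have h2 := congrArg (fun β => tri β (frameVec A a) (frameVec A b) (frameVec A c)) h1
    exact h2.trans (congrArg Neg.neg (hA.tri_act _ a b c))
  curv := by
    refine ⟨fun i j k l => ?_, fun i j k l => ?_, fun i j k l => ?_⟩
    · rw [jetR, jetR, curvEnd_swap (frameVec A j)]
      simp
    -- Conjugating by the orthonormal frame turns skewness with respect to g into skewness of a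
    -- matrix.
    · have h1 := h.curvEnd_skew hy (frameVec A i) (frameVec A j)
      rw [gMat, hA.metricOf] at h1
      have e : ∀ k l, jetR φ A y i j k l = (mat (A : R7 →L[ℝ] R7) *
          mat (curvEnd φ (frameVec A i) (frameVec A j) y) * frameMat A) k l :=
        fun k l => frameEnd_eq A _ k l
      rw [e, e]
      generalize mat (curvEnd φ (frameVec A i) (frameVec A j) y) = R at h1
      have h2 := congrArg (fun M => (frameMat A).transpose * M * frameMat A) h1
      have t1 : (frameMat A).transpose * (mat (A : R7 →L[ℝ] R7)).transpose = 1 := by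
        rw [← Matrix.transpose_mul, mul_frameMat, Matrix.transpose_one]
      simp only [Matrix.mul_add, Matrix.add_mul, Matrix.mul_zero, Matrix.zero_mul,
        Matrix.mul_assoc, mul_frameMat, Matrix.mul_one] at h2
      rw [← Matrix.mul_assoc (frameMat A).transpose (mat _).transpose, t1, Matrix.one_mul] at h2
      have h3 := congrFun (congrFun h2 k) l
      have e4 : (frameMat A).transpose * (R.transpose * (mat (A : R7 →L[ℝ] R7)).transpose)
          = (mat (A : R7 →L[ℝ] R7) * R * frameMat A).transpose := by
        simp only [Matrix.transpose_mul, Matrix.mul_assoc]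
      rw [e4, Matrix.add_apply, Matrix.transpose_apply, Matrix.zero_apply, ← Matrix.mul_assoc] at h3
      linarith
    · have h1 := congrArg (fun v => A v k)
        (h.curvEnd_bianchi hy (frameVec A i) (frameVec A j) (frameVec A l))
      simpa [jetR] using h1

end

/-! ### The tensors of a `G₂` structure in a frame -/

/-- The endomorphism `v ↦ ∇_v X`. -/
def covField (φ : LocalForm 3) (X : R7 → R7) (y : R7) : R7 →L[ℝ] R7 :=
  fderiv ℝ X y + conn φ (X y) y

section
variable {U : Set R7} {φ : LocalForm 3} {y : R7} {A : R7 ≃L[ℝ] R7} {X : R7 → R7}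

theorem transpose_mul_mul_apply (P M : Matrix (Fin 7) (Fin 7) ℝ) (a b : Fin 7) :
    (P.transpose * M * P) a b = ∑ i, ∑ j, P i a * P j b * M i j := by
  simp only [Matrix.mul_apply, Matrix.transpose_apply, Finset.sum_mul]
  rw [Finset.sum_comm]
  exact Finset.sum_congr rfl fun i _ => Finset.sum_congr rfl fun j _ => by ring

theorem nabla_frameVec (w : Fin 7) : nabla φ φ (frameVec A w) y
    = ∑ i, frameMat A i w • covDeriv φ φ i y := nabla_eq_sum (frameVec A w)

theorem tri_form_sum {ι : Type*} (s : Finset ι) (c : ι → ℝ) (β : ι → R7 [⋀^Fin 3]→L[ℝ] ℝ)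
    (u v w : R7) : tri (∑ i ∈ s, c i • β i) u v w = ∑ i ∈ s, c i * tri (β i) u v w := by
  rw [← triCLM_apply, map_sum]
  exact Finset.sum_congr rfl fun i _ => map_smul _ _ _

theorem IsFrame.torsion (hA : IsFrame (φ y) A) (a b : Fin 7) :
    ((frameMat A).transpose * torsion φ y * frameMat A) a b = tor (jetF φ A y) a b := by
  have h1 : ∀ i j, G2.torsion φ y i j = 1 / 24 * ∑ q : Fin 3 → Fin 7,
      contract (frameMat A) (comp (covDeriv φ φ i y)) q *
        contract (frameMat A) (fun a : Fin 3 → Fin 7 => psi (φ y) ![j, a 0, a 1, a 2]) q := by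
    intro i j
    rw [← contract_mul_transpose, G2.torsion, Matrix.of_apply]
    have : gInv φ y = frameMat A * (frameMat A).transpose := hA.inv_metricOf
    rw [this]
  have h2 : ∀ q : Fin 3 → Fin 7, ∑ i, frameMat A i a * contract (frameMat A)
      (comp (covDeriv φ φ i y)) q = jetF φ A y a (q 0) (q 1) (q 2) := by
    intro q
    simp only [sum_tri_frame, jetF]
    rw [nabla_frameVec, tri_form_sum]
  have h3 : ∀ q : Fin 3 → Fin 7, ∑ j, frameMat A j b * contract (frameMat A)
      (fun a : Fin 3 → Fin 7 => psi (φ y) ![j, a 0, a 1, a 2]) q = psi0 b (q 0) (q 1) (q 2) := by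
    intro q
    have := hA.contract_psi (Matrix.vecCons b q)
    refine Eq.trans ?_ this
    rw [contract, sum_fin_succ_arrow]
    refine Finset.sum_congr rfl fun j _ => ?_
    rw [contract, Finset.mul_sum]
    refine Finset.sum_congr rfl fun x _ => ?_
    have e : (![j, x 0, x 1, x 2] : Fin 4 → Fin 7) = Matrix.vecCons j x := by
      ext i; fin_cases i <;> rfl
    rw [Fin.prod_univ_succ, e]
    exact (mul_assoc _ _ _).symm
  have h4 : ((frameMat A).transpose * G2.torsion φ y * frameMat A) a b
      = 1 / 24 * ∑ q : Fin 3 → Fin 7, jetF φ A y a (q 0) (q 1) (q 2) * psi0 b (q 0) (q 1) (q 2) := by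
    rw [transpose_mul_mul_apply]
    simp only [h1, ← h2, ← h3, Finset.sum_mul_sum]
    simp only [Finset.mul_sum]
    conv_rhs => rw [Finset.sum_comm]
    refine Finset.sum_congr rfl fun i _ => ?_
    conv_rhs => rw [Finset.sum_comm]
    exact Finset.sum_congr rfl fun j _ => Finset.sum_congr rfl fun q _ => by ring
  rw [h4, tor, ctrPsi]
  simp only [sum_fin_succ_arrow, sum_fin_zero_arrow]
  rw [one_div, inv_mul_eq_div]
  rfl

theorem IsFrame.torsionSq (hA : IsFrame (φ y) A) (a b : Fin 7) :
    ((frameMat A).transpose * torsionSq φ y * frameMat A) a b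
      = ∑ k, tor (jetF φ A y) a k * tor (jetF φ A y) k b := by
  have h : (frameMat A).transpose * G2.torsionSq φ y * frameMat A
      = ((frameMat A).transpose * G2.torsion φ y * frameMat A)
        * ((frameMat A).transpose * G2.torsion φ y * frameMat A) := by
    have : gInv φ y = frameMat A * (frameMat A).transpose := hA.inv_metricOf
    rw [G2.torsionSq, this]
    simp only [Matrix.mul_assoc]
  rw [h, Matrix.mul_apply]
  simp only [hA.torsion]

theorem IsFrame.torsionNormSq (hA : IsFrame (φ y) A) :
    torsionNormSq φ y = ∑ i, ip (tor (jetF φ A y)) i i := by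
  have h : G2.torsionNormSq φ y = (((frameMat A).transpose * G2.torsion φ y * frameMat A)
      * ((frameMat A).transpose * G2.torsion φ y * frameMat A).transpose).trace := by
    have hi : gInv φ y = frameMat A * (frameMat A).transpose := hA.inv_metricOf
    have e : G2.torsionNormSq φ y
        = (G2.torsion φ y * (gInv φ y) * (G2.torsion φ y).transpose * (gInv φ y).transpose).trace := by
      simp only [G2.torsionNormSq, Matrix.trace, Matrix.diag_apply, Matrix.mul_apply,
        Matrix.transpose_apply, Finset.sum_mul]
      refine Finset.sum_congr rfl fun i _ => Finset.sum_congr rfl fun j _ => ?_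
      rw [Finset.sum_comm]
      exact Finset.sum_congr rfl fun k _ => Finset.sum_congr rfl fun l _ => by ring
    rw [e, hi]
    simp only [Matrix.transpose_mul, Matrix.transpose_transpose, Matrix.mul_assoc]
    conv_rhs => rw [Matrix.trace_mul_comm]
    simp only [Matrix.mul_assoc]
  rw [h, Matrix.trace]
  simp only [Matrix.diag_apply, Matrix.mul_apply (N := Matrix.transpose _), Matrix.transpose_apply,
    hA.torsion]
  rfl

theorem IsLocalG2.mat_fderiv_conn (h : IsLocalG2 U φ) (hy : y ∈ U) (u v : R7) (m l : Fin 7) :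
    mat (fderiv ℝ (conn φ v) y u) m l
      = ∑ i, ∑ j, u i * v j * pderiv i (christoffel φ m j l) y := by
  have h1 := (EuclideanSpace.proj m : R7 →L[ℝ] ℝ).hasFDerivAt.comp_hasDerivAt (0 : ℝ)
      (h.hasDerivAt_conn hy u v (basisVec l))
  have h2 : HasDerivAt (fun t : ℝ => ∑ j, v j * christoffel φ m j l (y + t • u))
      (∑ j, v j * fderiv ℝ (christoffel φ m j l) y u) 0 :=
    HasDerivAt.fun_sum fun j _ =>
      (hasDerivAt_line h.isOpen (h.christoffel_smooth m j l) hy u).const_mul (v j)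
  have h3 := h1.unique (h2.congr_of_eventuallyEq (Filter.Eventually.of_forall fun t => ?_))
  · refine h3.trans ?_
    rw [Finset.sum_comm]
    refine Finset.sum_congr rfl fun j _ => ?_
    rw [fderiv_eq_sum_pderiv, Finset.mul_sum]
    exact Finset.sum_congr rfl fun i _ => by ring
  · have := congrFun (congrFun (mat_conn (φ := φ) v (y + t • u)) m) l
    refine this.trans ?_
    simp only [Matrix.sum_apply, Matrix.smul_apply, smul_eq_mul]
    rfl

theorem IsLocalG2.mat_curvEnd (h : IsLocalG2 U φ) (hy : y ∈ U) (u v : R7) (m l : Fin 7) :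
    mat (curvEnd φ u v y) m l = ∑ i, ∑ j, u i * v j * riemannUp φ i j l m y := by
  have e3 : mat (curvEnd φ u v y) = mat (fderiv ℝ (conn φ v) y u) - mat (fderiv ℝ (conn φ u) y v)
      + (mat (conn φ u y) * mat (conn φ v y) - mat (conn φ v y) * mat (conn φ u y)) := by
    rw [← mat_comp, ← mat_comp]; rfl
  have e4 : ∀ u v : R7, (mat (conn φ u y) * mat (conn φ v y)) m l
      = ∑ i, ∑ j, u i * v j * ∑ p, christoffel φ m i p y * christoffel φ p j l y := by
    intro u v
    rw [Matrix.mul_apply]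
    simp only [mat_conn, Matrix.sum_apply, Matrix.smul_apply, smul_eq_mul, Finset.sum_mul_sum]
    rw [sum3_rot]
    refine Finset.sum_congr rfl fun i _ => Finset.sum_congr rfl fun j _ => ?_
    rw [Finset.mul_sum]
    refine Finset.sum_congr rfl fun p _ => ?_
    simp only [connMat, Matrix.of_apply]
    ring
  have e5 : (mat (conn φ v y) * mat (conn φ u y)) m l
      = ∑ i, ∑ j, u i * v j * ∑ p, christoffel φ m j p y * christoffel φ p i l y := by
    rw [e4, Finset.sum_comm]
    exact Finset.sum_congr rfl fun i _ => Finset.sum_congr rfl fun j _ => by ring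
  have e6 : mat (fderiv ℝ (conn φ u) y v) m l
      = ∑ i, ∑ j, u i * v j * pderiv j (christoffel φ m i l) y := by
    rw [h.mat_fderiv_conn hy, Finset.sum_comm]
    exact Finset.sum_congr rfl fun i _ => Finset.sum_congr rfl fun j _ => by ring
  rw [e3, Matrix.add_apply, Matrix.sub_apply, Matrix.sub_apply, e4, e5, e6, h.mat_fderiv_conn hy]
  simp only [← Finset.sum_sub_distrib, ← Finset.sum_add_distrib]
  refine Finset.sum_congr rfl fun i _ => Finset.sum_congr rfl fun j _ => ?_
  rw [riemannUp, Finset.sum_sub_distrib]; ring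

theorem transpose_frameMat_mul_metricOf {α : R7 [⋀^Fin 3]→L[ℝ] ℝ} (hA : IsFrame α A) :
    (frameMat A).transpose * metricOf α = mat (A : R7 →L[ℝ] R7) := by
  rw [hA.metricOf, ← Matrix.mul_assoc, ← Matrix.transpose_mul, mul_frameMat,
    Matrix.transpose_one, Matrix.one_mul]

theorem IsLocalG2.ricci_frame (h : IsLocalG2 U φ) (hy : y ∈ U) (hA : IsFrame (φ y) A)
    (a b : Fin 7) :
    ((frameMat A).transpose * ricci φ y * frameMat A) a b = ric (jetR φ A y) a b := by
  have e1 : ∀ c, jetR φ A y a c b c = ((frameMat A).transpose * (gMat φ y *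
      mat (curvEnd φ (frameVec A a) (frameVec A c) y)) * frameMat A) b c := by
    intro c
    rw [← Matrix.mul_assoc, gMat, transpose_frameMat_mul_metricOf hA, ← frameEnd_eq]
    rfl
  have e2 : ∀ (u v : R7) k l, (gMat φ y * mat (curvEnd φ u v y)) k l
      = ∑ i, ∑ j, u i * v j * riemann φ i j k l y := by
    intro u v k l
    rw [Matrix.mul_apply]
    simp only [h.mat_curvEnd hy, riemann, Finset.mul_sum]
    conv_rhs => enter [2, i]; rw [Finset.sum_comm]
    conv_rhs => rw [Finset.sum_comm]
    exact Finset.sum_congr rfl fun i _ => Finset.sum_congr rfl fun j _ =>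
      Finset.sum_congr rfl fun k _ => by ring
  have hi : gInv φ y = frameMat A * (frameMat A).transpose := hA.inv_metricOf
  rw [ric, transpose_mul_mul_apply]
  simp only [e1, e2, ricci, Matrix.of_apply, hi, Matrix.mul_apply,
    Matrix.transpose_apply, Finset.mul_sum, Finset.sum_mul, ← frameMat_apply]
  conv_rhs => enter [2, c]; rw [Finset.sum_comm]
  conv_rhs => rw [Finset.sum_comm]
  rw [Finset.sum_comm]
  refine Finset.sum_congr rfl fun k _ => ?_
  conv_rhs =>
    enter [2, c]; rw [Finset.sum_comm]
  conv_rhs =>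
    enter [2, c, 2, i]; rw [Finset.sum_comm]
  conv_rhs => rw [Finset.sum_comm]
  refine Finset.sum_congr rfl fun i _ => ?_
  conv_rhs => rw [Finset.sum_comm]
  refine Finset.sum_congr rfl fun j _ => ?_
  conv_rhs => rw [Finset.sum_comm]
  exact Finset.sum_congr rfl fun l _ => Finset.sum_congr rfl fun c _ => by ring

/-- Metric compatibility rewrites the transport term through Γ(X, ·), which joins DX to form ∇X. -/
theorem IsLocalG2.lieMetric_eq (h : IsLocalG2 U φ) (hX : ContDiffOn ℝ ∞ X U) (hy : y ∈ U) :
    lieMetric φ X y = (mat (covField φ X y)).transpose * gMat φ y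
      + gMat φ y * mat (covField φ X y) := by
  have e : mat (covField φ X y) = mat (fderiv ℝ X y) + mat (conn φ (X y) y) := mat_add _ _
  have e2 : ∀ k i, pderiv i (fun z => X z k) y = mat (fderiv ℝ X y) k i :=
    fun k i => fderiv_coord h.isOpen hX hy _ _
  ext i j
  have e3 : ∑ k, X y k * pderiv k (fun z => gMat φ z i j) y
      = ((mat (conn φ (X y) y)).transpose * gMat φ y + gMat φ y * mat (conn φ (X y) y)) i j := by
    rw [← fderiv_eq_sum_pderiv]
    exact (hasDerivAt_line h.isOpen (h.gMat_smooth i j) hy _).unique (h.hasMatDeriv_gMat hy _ i j)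
  rw [lieMetric, Matrix.of_apply, Finset.sum_add_distrib, Finset.sum_add_distrib, e3, e,
    Matrix.transpose_add, Matrix.add_mul, Matrix.mul_add]
  simp only [Matrix.add_apply, e2]
  have e4 : ∑ k, gMat φ y k j * mat (fderiv ℝ X y) k i
      = ((mat (fderiv ℝ X y)).transpose * gMat φ y) i j := by
    rw [Matrix.mul_apply]; exact Finset.sum_congr rfl fun k _ => mul_comm _ _
  have e5 : ∑ k, gMat φ y i k * mat (fderiv ℝ X y) k j
      = (gMat φ y * mat (fderiv ℝ X y)) i j := by rw [Matrix.mul_apply]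
  rw [e4, e5]; ring

theorem IsLocalG2.lieMetric_frame (h : IsLocalG2 U φ) (hX : ContDiffOn ℝ ∞ X U) (hy : y ∈ U)
    (hA : IsFrame (φ y) A) (a b : Fin 7) :
    ((frameMat A).transpose * lieMetric φ X y * frameMat A) a b
      = frameEnd A (covField φ X y) a b + frameEnd A (covField φ X y) b a := by
  rw [h.lieMetric_eq hX hy, frameEnd_eq, frameEnd_eq, ← Matrix.transpose_apply (mat _ * _ * _) a b,
    ← Matrix.add_apply, gMat]
  have e1 := transpose_frameMat_mul_metricOf hA
  have e2 := congrArg Matrix.transpose e1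
  rw [Matrix.transpose_mul, Matrix.transpose_transpose, hA.transpose_metricOf] at e2
  have e3 : (frameMat A).transpose * ((mat (covField φ X y)).transpose * metricOf (φ y)
      + metricOf (φ y) * mat (covField φ X y)) * frameMat A
      = mat (A : R7 →L[ℝ] R7) * mat (covField φ X y) * frameMat A
        + (mat (A : R7 →L[ℝ] R7) * mat (covField φ X y) * frameMat A).transpose := by
    rw [Matrix.mul_add, Matrix.add_mul, add_comm, ← Matrix.mul_assoc, e1]
    simp only [Matrix.transpose_mul, Matrix.mul_assoc, e2]
  rw [e3]

theorem IsLocalG2.divergence_frame (h : IsLocalG2 U φ) (hX : ContDiffOn ℝ ∞ X U) (hy : y ∈ U) :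
    divergence φ X y = ∑ a, frameEnd A (covField φ X y) a a := by
  have e1 : ∑ a, frameEnd A (covField φ X y) a a = (mat (covField φ X y)).trace := by
    simp only [frameEnd_eq]
    have : (mat (A : R7 →L[ℝ] R7) * mat (covField φ X y) * frameMat A).trace
        = (mat (covField φ X y)).trace := by
      rw [Matrix.trace_mul_comm, ← Matrix.mul_assoc, frameMat_mul, Matrix.one_mul]
    exact this
  rw [e1, Matrix.trace, divergence]
  refine Finset.sum_congr rfl fun i _ => ?_
  have e2 : pderiv i (fun z => X z i) y = fderiv ℝ X y (basisVec i) i :=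
    fderiv_coord h.isOpen hX hy _ _
  have e3 : ∑ k, christoffel φ i i k y * X y k = conn φ (X y) y (basisVec i) i := by
    rw [conn_apply]
    refine Finset.sum_congr rfl fun k _ => ?_
    simp only [basisVec_apply]
    have := sum_dl_mul i fun j => X y k * christoffel φ i k j y
    rw [h.christoffel_symm hy i i k, mul_comm, ← this]
    exact Finset.sum_congr rfl fun j _ => by ring
  rw [e2, e3]; rfl

theorem field_eq_sum (A : R7 ≃L[ℝ] R7) (x : R7) : ∑ m, A x m • frameVec A m = x := by
  have h := congrArg A.symm (sum_basisVec (A x))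
  rw [ContinuousLinearEquiv.symm_apply_apply, map_sum] at h
  refine Eq.trans ?_ h
  exact Finset.sum_congr rfl fun j _ => by rw [map_smul]; rfl

/-- L_X φ is ∇_X φ plus the derivation defined by ∇X: the connection terms of the two parts cancel.
-/
theorem tri_lieForm (hA : IsFrame (φ y) A) (a b c : Fin 7) :
    tri (lieForm X φ y) (frameVec A a) (frameVec A b) (frameVec A c)
      = ∑ m, A (X y) m * jetF φ A y m a b c + actArr (frameEnd A (covField φ X y)) a b c := by
  have e : tri (nabla φ φ (X y) y) (frameVec A a) (frameVec A b) (frameVec A c)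
      = ∑ m, A (X y) m * jetF φ A y m a b c := by
    conv_lhs => rw [← field_eq_sum A (X y), nabla_sum, tri_form_sum]
    rfl
  rw [← e, ← hA.tri_act, lieForm, tri_add, tri_nabla, tri_act, tri_act]
  have e2 : ∀ v, covField φ X y v = fderiv ℝ X y v + conn φ (X y) y v := fun _ => rfl
  simp only [e2, tri_add_left, tri_add_mid, tri_add_right]
  ring

end

/-! ### The Hodge Laplacian in a frame -/

theorem alternatizeUncurryFin_two (f : R7 →L[ℝ] R7 [⋀^Fin 2]→L[ℝ] ℝ) (u v w : R7) :
    tri (ContinuousAlternatingMap.alternatizeUncurryFin f) u v w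
      = f u ![v, w] - f v ![u, w] + f w ![u, v] := by
  rw [tri_eq, ContinuousAlternatingMap.alternatizeUncurryFin_apply, Fin.sum_univ_three]
  have e0 : ((-1 : ℤ) ^ ((0 : Fin 3) : ℕ)) = 1 := by norm_num
  have e1 : ((-1 : ℤ) ^ ((1 : Fin 3) : ℕ)) = -1 := by norm_num
  have e2 : ((-1 : ℤ) ^ ((2 : Fin 3) : ℕ)) = 1 := by norm_num
  rw [e0, e1, e2, one_smul, one_smul, neg_one_smul, sub_eq_add_neg]
  have r0 : (0 : Fin 3).removeNth ![u, v, w] = ![v, w] := by ext i; fin_cases i <;> rfl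
  have r1 : (1 : Fin 3).removeNth ![u, v, w] = ![u, w] := by ext i; fin_cases i <;> rfl
  have r2 : (2 : Fin 3).removeNth ![u, v, w] = ![u, v] := by ext i; fin_cases i <;> rfl
  rw [r0, r1, r2]; rfl

section
variable {U : Set R7} {φ : LocalForm 3} {y : R7} {A : R7 ≃L[ℝ] R7} {X : R7 → R7}

theorem codiff_apply_two (α : LocalForm 3) (y v w : R7) : codiff φ α y ![v, w]
    = -∑ i, ∑ j, gInv φ y i j * tri (covDeriv φ α i y) (basisVec j) v w := by
  simp only [codiff, ContinuousAlternatingMap.neg_apply, ContinuousAlternatingMap.sum_apply,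
    ContinuousAlternatingMap.smul_apply, smul_eq_mul]
  rfl

theorem codiff_apply_one (α : LocalForm 2) (y v : R7) : codiff φ α y ![v]
    = -∑ i, ∑ j, gInv φ y i j * covDeriv φ α i y ![basisVec j, v] := by
  simp only [codiff, ContinuousAlternatingMap.neg_apply, ContinuousAlternatingMap.sum_apply,
    ContinuousAlternatingMap.smul_apply, smul_eq_mul]
  rfl

theorem IsLocalG2.codiff_smooth (h : IsLocalG2 U φ) : ContDiffOn ℝ ∞ (codiff φ φ) U := by
  refine ContDiffOn.neg (ContDiffOn.sum fun i _ => ContDiffOn.sum fun j _ =>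
    (h.gInv_smooth i j).smul ?_)
  exact (contDiffOn_curryLeft (h.covDeriv_smooth h.smooth i)).clm_apply contDiffOn_const

theorem sum_mul_add_mul_transpose (K M f : Matrix (Fin 7) (Fin 7) ℝ) :
    ∑ i, ∑ j, (K * M + M * K.transpose) i j * f i j
      = ∑ i, ∑ j, M i j * (∑ m, K m i * f m j + ∑ m, K m j * f i m) := by
  have e : ∀ M f : Matrix (Fin 7) (Fin 7) ℝ, ∑ i, ∑ j, M i j * f i j = (M * f.transpose).trace :=
    fun M f => by simp [Matrix.trace, Matrix.mul_apply]
  have e2 : ∀ i j, ∑ m, K m i * f m j + ∑ m, K m j * f i m = (K.transpose * f + f * K) i j := by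
    intro i j
    simp only [Matrix.add_apply, Matrix.mul_apply, Matrix.transpose_apply, mul_comm]
  simp only [e2, e]
  rw [Matrix.add_mul, Matrix.transpose_add, Matrix.mul_add, Matrix.transpose_mul,
    Matrix.transpose_mul, Matrix.transpose_transpose, Matrix.trace_add, Matrix.trace_add,
    Matrix.mul_assoc, Matrix.trace_mul_comm, Matrix.mul_assoc, Matrix.mul_assoc]

/-- Linearity in the second direction lets the trace over coordinate vectors with g⁻¹ become a trace
over the frame. -/
theorem IsLocalG2.hess_sum (h : IsLocalG2 U φ) (hy : y ∈ U) {ι : Type*} (s : Finset ι) (u : R7)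
    (c : ι → ℝ) (f : ι → R7) : hess φ u (∑ i ∈ s, c i • f i) y = ∑ i ∈ s, c i • hess φ u (f i) y := by
  refine ext_tri fun p q r => ?_
  have hd := fun v => h.hasDerivAt_tri (h.nabla_smooth h.smooth v) hy u p q r
  have h1 : HasDerivAt (fun t : ℝ => ∑ i ∈ s, c i * tri (nabla φ φ (f i) (y + t • u)) p q r) _ 0 :=
    HasDerivAt.fun_sum fun i _ => (hd (f i)).const_mul (c i)
  have h2 := (hd (∑ i ∈ s, c i • f i)).unique (h1.congr_of_eventuallyEq
    (Filter.Eventually.of_forall fun t => by simp only [nabla_sum, tri_form_sum]))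
  rw [tri_form_sum]
  simp only [hess, tri_sub, mul_sub, Finset.sum_sub_distrib]
  have h3 : tri (nabla φ φ (conn φ u y (∑ i ∈ s, c i • f i)) y) p q r
      = ∑ i ∈ s, c i * tri (nabla φ φ (conn φ u y (f i)) y) p q r := by
    rw [map_sum]; simp only [map_smul]; rw [nabla_sum, tri_form_sum]
  rw [h3]
  simp only [nabla_sum, tri_form_sum, mul_add, Finset.sum_add_distrib] at h2
  linarith

theorem IsFrame.sum_gInv (hA : IsFrame (φ y) A) (f : Fin 7 → Fin 7 → ℝ) :
    ∑ i, ∑ j, gInv φ y i j * f i j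
      = ∑ c, ∑ i, ∑ j, frameMat A i c * (frameMat A j c * f i j) := by
  have hi : gInv φ y = frameMat A * (frameMat A).transpose := hA.inv_metricOf
  rw [hi]
  simp only [Matrix.mul_apply, Matrix.transpose_apply, Finset.sum_mul]
  conv_rhs => rw [sum3_rot]
  simp only [mul_assoc]

theorem IsLocalG2.sum_hess (h : IsLocalG2 U φ) (hy : y ∈ U) (hA : IsFrame (φ y) A) (u v w : R7) :
    ∑ i, ∑ j, gInv φ y i j * tri (hess φ u (basisVec i) y) (basisVec j) v w
      = ∑ c, tri (hess φ u (frameVec A c) y) (frameVec A c) v w := by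
  rw [hA.sum_gInv]
  refine Finset.sum_congr rfl fun c _ => ?_
  conv_rhs => rw [← sum_frameMat A c, h.hess_sum hy, tri_form_sum]
  simp only [tri_sum_left, Finset.mul_sum]

theorem IsLocalG2.fderiv_codiff (h : IsLocalG2 U φ) (hy : y ∈ U) (hA : IsFrame (φ y) A)
    (u v w : R7) : fderiv ℝ (codiff φ φ) y u ![v, w]
      = -∑ c, tri (hess φ u (frameVec A c) y) (frameVec A c) v w
        + codiff φ φ y ![conn φ u y v, w] + codiff φ φ y ![v, conn φ u y w] := by
  have h1 : HasDerivAt (fun t : ℝ => codiff φ φ (y + t • u) ![v, w])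
      (fderiv ℝ (codiff φ φ) y u ![v, w]) 0 :=
    (ContinuousAlternatingMap.apply ℝ R7 ℝ ![v, w]).hasFDerivAt.comp_hasDerivAt (0 : ℝ)
      (hasDerivAt_line h.isOpen h.codiff_smooth hy u)
  have h2 : HasDerivAt (fun t : ℝ => -∑ i, ∑ j, gInv φ (y + t • u) i j *
      tri (covDeriv φ φ i (y + t • u)) (basisVec j) v w) _ 0 :=
    (HasDerivAt.fun_sum fun i _ => HasDerivAt.fun_sum fun j _ =>
      (h.hasMatDeriv_gInv hy u i j).mul
        (h.hasDerivAt_tri (h.covDeriv_smooth h.smooth i) hy u (basisVec j) v w)).neg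
  rw [h1.unique (h2.congr_of_eventuallyEq (Filter.Eventually.of_forall fun t =>
    codiff_apply_two φ _ v w)), ← h.sum_hess hy hA, codiff_apply_two, codiff_apply_two]
  have e1 : ∀ i p q r, tri (hess φ u (basisVec i) y) p q r = tri (nabla φ (covDeriv φ φ i) u y) p q r
      - ∑ m, mat (conn φ u y) m i * tri (covDeriv φ φ m y) p q r := by
    intro i p q r
    rw [hess, nabla_basisVec, nabla_eq_sum (conn φ u y (basisVec i)), tri_sub, tri_form_sum]; rfl
  -- Matches the derivative of g⁻¹ with the connection terms on the two traced indices, so that they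
  -- cancel; only those on v and w survive.
  have key := sum_mul_add_mul_transpose (mat (conn φ u y)) (gInv φ y)
    (Matrix.of fun i j => tri (covDeriv φ φ i y) (basisVec j) v w)
  simp only [Matrix.of_apply] at key
  have e2 : ∀ i j, tri (covDeriv φ φ i y) (conn φ u y (basisVec j)) v w
      = ∑ m, mat (conn φ u y) m j * tri (covDeriv φ φ i y) (basisVec m) v w := fun i j =>
    tri_apply_basisVec_left _ _ _ _ _
  simp only [e1, e2, zero_smul, add_zero, Matrix.neg_apply]
  simp only [mul_add, mul_sub, Finset.sum_add_distrib, Finset.sum_sub_distrib, neg_mul,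
    Finset.sum_neg_distrib] at key ⊢
  linarith

theorem two_form_swap (β : R7 [⋀^Fin 2]→L[ℝ] ℝ) (u v : R7) : β ![u, v] = -β ![v, u] := by
  have := β.toAlternatingMap.map_swap ![v, u] (i := 0) (j := 1) (by decide)
  refine Eq.trans ?_ this
  exact congrArg β (by ext i; fin_cases i <;> rfl)

/-- The surviving connection terms cancel in the alternation because the connection has no torsion.
-/
theorem IsLocalG2.tri_extDeriv_codiff (h : IsLocalG2 U φ) (hy : y ∈ U) (hA : IsFrame (φ y) A)
    (u v w : R7) : tri (extDeriv (codiff φ φ) y) u v w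
      = -∑ c, (tri (hess φ u (frameVec A c) y) (frameVec A c) v w
        + tri (hess φ v (frameVec A c) y) (frameVec A c) w u
        + tri (hess φ w (frameVec A c) y) (frameVec A c) u v) := by
  have e : tri (extDeriv (codiff φ φ) y) u v w = fderiv ℝ (codiff φ φ) y u ![v, w]
      - fderiv ℝ (codiff φ φ) y v ![u, w] + fderiv ℝ (codiff φ φ) y w ![u, v] :=
    alternatizeUncurryFin_two _ u v w
  rw [e, h.fderiv_codiff hy hA, h.fderiv_codiff hy hA, h.fderiv_codiff hy hA, h.conn_comm hy v u,
    h.conn_comm hy w u, h.conn_comm hy w v, two_form_swap _ v (conn φ u y w)]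
  simp only [Finset.sum_add_distrib]
  have e2 : ∑ c, tri (hess φ v (frameVec A c) y) (frameVec A c) w u
      = -∑ c, tri (hess φ v (frameVec A c) y) (frameVec A c) u w := by
    rw [← Finset.sum_neg_distrib]
    exact Finset.sum_congr rfl fun c _ => tri_swap' _ _ _ _
  rw [e2]; ring

theorem act_zero {k : ℕ} (D : R7 →L[ℝ] R7) : act D (0 : R7 [⋀^Fin (k + 1)]→L[ℝ] ℝ) = 0 := by
  ext v; rw [act_apply]; simp

theorem IsLocalG2.codiff_extDeriv (h : IsLocalG2 U φ) (hy : y ∈ U) :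
    codiff φ (extDeriv φ) y = 0 := by
  have e : extDeriv φ =ᶠ[𝓝 y] fun _ => 0 := by
    filter_upwards [h.isOpen.mem_nhds hy] with z hz using h.closed z hz
  have e2 : ∀ i, covDeriv φ (extDeriv φ) i y = 0 := by
    intro i
    rw [covDeriv, h.closed y hy, act_zero, e.fderiv_eq]
    simp
  ext v
  simp [codiff, e2]

theorem IsLocalG2.tri_hodgeLaplacian (h : IsLocalG2 U φ) (hy : y ∈ U) (hA : IsFrame (φ y) A)
    (a b c : Fin 7) :
    tri (hodgeLaplacian φ φ y) (frameVec A a) (frameVec A b) (frameVec A c)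
      = lapArr (jetW φ A y) a b c := by
  rw [hodgeLaplacian, h.codiff_extDeriv hy, add_zero, h.tri_extDeriv_codiff hy hA]
  rfl

/-! ### The codifferential of the interior product -/

theorem interior_apply (z v w : R7) : interior X φ z ![v, w] = tri (φ z) (X z) v w := rfl

theorem IsLocalG2.interior_smooth (h : IsLocalG2 U φ) (hX : ContDiffOn ℝ ∞ X U) :
    ContDiffOn ℝ ∞ (interior X φ) U :=
  (contDiffOn_curryLeft h.smooth).clm_apply hX

theorem IsLocalG2.covDeriv_interior (h : IsLocalG2 U φ) (hX : ContDiffOn ℝ ∞ X U) (hy : y ∈ U)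
    (i : Fin 7) (v w : R7) : covDeriv φ (interior X φ) i y ![v, w]
      = tri (covDeriv φ φ i y) (X y) v w + tri (φ y) (covField φ X y (basisVec i)) v w := by
  have h1 : HasDerivAt (fun t : ℝ => tri (φ (y + t • basisVec i)) (X (y + t • basisVec i)) v w)
      (fderiv ℝ (interior X φ) y (basisVec i) ![v, w]) 0 :=
    (ContinuousAlternatingMap.apply ℝ R7 ℝ ![v, w]).hasFDerivAt.comp_hasDerivAt (0 : ℝ)
      (hasDerivAt_line h.isOpen (h.interior_smooth hX) hy (basisVec i))
  have h2 := hasDerivAt_tri_left (hasDerivAt_line h.isOpen h.smooth hy (basisVec i))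
    (hasDerivAt_line h.isOpen hX hy (basisVec i)) v w
  have h3 := h1.unique h2
  have e : covDeriv φ (interior X φ) i y ![v, w] = fderiv ℝ (interior X φ) y (basisVec i) ![v, w]
      - act (connection φ i y) (interior X φ y) ![v, w] := rfl
  have u0 : Function.update ![v, w] 0 (connection φ i y (![v, w] 0))
      = ![connection φ i y v, w] := by ext j; fin_cases j <;> rfl
  have u1 : Function.update ![v, w] 1 (connection φ i y (![v, w] 1))
      = ![v, connection φ i y w] := by ext j; fin_cases j <;> rfl
  have e2 : covField φ X y (basisVec i) = fderiv ℝ X y (basisVec i) + connection φ i y (X y) := by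
    rw [← conn_basisVec, h.conn_comm hy]; rfl
  rw [e, act_apply, Fin.sum_univ_two, u0, u1, interior_apply, interior_apply, h3, e2, tri_add_left,
    ← nabla_basisVec, tri_nabla, conn_basisVec, zero_smul, add_zero]
  ring

theorem IsLocalG2.codiff_interior (h : IsLocalG2 U φ) (hX : ContDiffOn ℝ ∞ X U) (hy : y ∈ U)
    (hA : IsFrame (φ y) A) (n : Fin 7) : codiff φ (interior X φ) y ![frameVec A n]
      = -∑ c, (∑ m, A (X y) m * jetF φ A y c m c n
        + ∑ m, frameEnd A (covField φ X y) m c * phi0 m c n) := by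
  rw [codiff_apply_one, hA.sum_gInv]
  congr 1
  refine Finset.sum_congr rfl fun c _ => ?_
  have e1 : ∑ m, A (X y) m * jetF φ A y c m c n
      = tri (nabla φ φ (frameVec A c) y) (X y) (frameVec A c) (frameVec A n) := by
    conv_rhs => rw [← field_eq_sum A (X y), tri_sum_left]
    rfl
  have e2 : ∑ m, frameEnd A (covField φ X y) m c * phi0 m c n
      = tri (φ y) (covField φ X y (frameVec A c)) (frameVec A c) (frameVec A n) := by
    rw [apply_frameVec, tri_sum_left]
    simp only [hA.tri]
  rw [e1, e2, nabla_frameVec, tri_form_sum]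
  have e3 : ∀ i, tri (covDeriv φ φ i y) (X y) (frameVec A c) (frameVec A n)
      = ∑ j, frameMat A j c * tri (covDeriv φ φ i y) (X y) (basisVec j) (frameVec A n) := by
    intro i
    conv_lhs => rw [← sum_frameMat A c, tri_sum_mid]
  have e4 : tri (φ y) (covField φ X y (frameVec A c)) (frameVec A c) (frameVec A n)
      = ∑ i, frameMat A i c * ∑ j, frameMat A j c *
        tri (φ y) (covField φ X y (basisVec i)) (basisVec j) (frameVec A n) := by
    conv_lhs => rw [← sum_frameMat A c, map_sum]
    simp only [map_smul, tri_sum_left, tri_sum_mid, Finset.mul_sum]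
    rw [Finset.sum_comm]
    exact Finset.sum_congr rfl fun i _ => Finset.sum_congr rfl fun j _ => by ring
  rw [e4]
  simp only [e3, h.covDeriv_interior hX hy, mul_add, Finset.sum_add_distrib, Finset.mul_sum]

end

/-! ### The soliton equation at a point -/

theorem actArr_add_smul_dl (L : Fin 7 → Fin 7 → ℝ) (c : ℝ) (p q r : Fin 7) :
    actArr (fun i j => L i j + c * dl i j) p q r = actArr L p q r + 3 * c * phi0 p q r := by
  have e : ∀ (f : Fin 7 → ℝ) a, ∑ m, c * dl m a * f m = c * f a := by
    intro f a
    rw [← sum_dl_mul a f, Finset.mul_sum]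
    exact Finset.sum_congr rfl fun m _ => by rw [dl_comm]; ring
  simp only [actArr, add_mul, Finset.sum_add_distrib, e]
  ring

section
variable {F : Fin 7 → Fin 7 → Fin 7 → Fin 7 → ℝ}
  {W : Fin 7 → Fin 7 → Fin 7 → Fin 7 → Fin 7 → ℝ} {R : Fin 7 → Fin 7 → Fin 7 → Fin 7 → ℝ}
  {x : Fin 7 → ℝ} {L : Fin 7 → Fin 7 → ℝ}

/-- The symmetric part of `ctr` kills ∇_X φ and sees only the symmetric part of L, so the equation
determines Ricci. -/
theorem IsSecondJet.ric_of_lapArr (h : IsSecondJet F W R)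
    (e : ∀ a b c, lapArr W a b c = ∑ m, x m * F m a b c + actArr L a b c) (a d : Fin 7) :
    -8 * ric R a d + 16 * ip (tor F) a d
      = 4 * (L a d + L d a) + 4 * (∑ m, L m m) * dl a d := by
  have e1 : ∀ k d, ctr (lapArr W) k d = ∑ m, x m * ctr (F m) k d + ctr (actArr L) k d := by
    intro k d
    simp only [ctr, e, add_mul, Finset.sum_add_distrib, Finset.sum_mul, Finset.mul_sum]
    rw [← sum3_rot]
    congr 1
    exact sum_congr3 fun m b c => by ring
  have e2 : ∀ k d, ∑ m, ∑ b, L m b * psi0 k m d b = -∑ m, ∑ b, L m b * psi0 d m k b := by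
    intro k d
    simp only [← Finset.sum_neg_distrib]
    exact sum_congr2 fun m b => by
      rw [psi0_swap, psi0_swap' m k d b, psi0_swap m d k b]; ring
  have e3 : ∑ m, x m * ctr (F m) a d + ∑ m, x m * ctr (F m) d a = 0 := by
    rw [← Finset.sum_add_distrib]
    refine Finset.sum_eq_zero fun m _ => ?_
    rw [← mul_add, h.metric, mul_zero]
  rw [← h.ctr_lapArr, e1, e1, ctr_actArr, ctr_actArr, e2 a d, dl_comm d a]
  linarith

/-- The component of dimension 7 of the equation, whose left side is zero by
`IsSecondJet.ctrPsi_lapArr`. -/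
theorem IsSecondJet.tor_of_lapArr (h : IsSecondJet F W R)
    (e : ∀ a b c, lapArr W a b c = ∑ m, x m * F m a b c + actArr L a b c) (n : Fin 7) :
    2 * ∑ m, x m * tor F m n + ∑ m, ∑ p, L m p * phi0 m n p = 0 := by
  have e1 : ctrPsi (lapArr W) n = ∑ m, x m * ctrPsi (F m) n + ctrPsi (actArr L) n := by
    rw [← ctrPsi_sum]
    simp only [ctrPsi, e, add_mul, Finset.sum_add_distrib]
  have e2 : ∑ m, x m * ctrPsi (F m) n = 24 * ∑ m, x m * tor F m n := by
    rw [Finset.mul_sum]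
    exact Finset.sum_congr rfl fun m _ => by rw [tor]; ring
  rw [h.ctrPsi_lapArr, e2, ctrPsi_actArr] at e1
  linarith

/-- Substituting ∇φ = Tψ makes this the eigenvalue relation `IsLambda14.psi`. -/
theorem IsSecondJet.sum_trace (h : IsSecondJet F W R) (m n : Fin 7) :
    ∑ c, F c m c n = -2 * tor F m n := by
  rw [← h.lambda14.psi]
  refine Finset.sum_congr rfl fun c _ => ?_
  rw [eq_tor h.closed.alt h.metric]
  exact Finset.sum_congr rfl fun p _ => by rw [psi0_swap' p m c n, psi0_swap p c m n]; ring

theorem IsSecondJet.codiff_of_lapArr (h : IsSecondJet F W R)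
    (e : ∀ a b c, lapArr W a b c = ∑ m, x m * F m a b c + actArr L a b c) (n : Fin 7) :
    ∑ c, (∑ m, x m * F c m c n + ∑ m, L m c * phi0 m c n) = 0 := by
  have h1 := h.tor_of_lapArr e n
  rw [Finset.sum_add_distrib, Finset.sum_comm]
  simp only [← Finset.mul_sum, h.sum_trace]
  have e2 : ∑ c, ∑ m, L m c * phi0 m c n = -∑ m, ∑ p, L m p * phi0 m n p := by
    rw [Finset.sum_comm]
    simp only [← Finset.sum_neg_distrib]
    exact sum_congr2 fun m p => by rw [phi0_swap' m p n]; ring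
  have e3 : ∑ m, x m * (-2 * tor F m n) = -2 * ∑ m, x m * tor F m n := by
    rw [Finset.mul_sum]; exact Finset.sum_congr rfl fun m _ => by ring
  rw [e2, e3]; linarith

theorem IsSecondJet.trace_of_lapArr (h : IsSecondJet F W R)
    (e : ∀ a b c, lapArr W a b c = ∑ m, x m * F m a b c + actArr L a b c) :
    2 * ∑ i, ip (tor F) i i = 3 * ∑ m, L m m := by
  have h1 : ∑ a, (-8 * ric R a a + 16 * ip (tor F) a a)
      = ∑ a, (4 * (L a a + L a a) + 4 * (∑ m, L m m) * dl a a) :=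
    Finset.sum_congr rfl fun a _ => h.ric_of_lapArr e a a
  simp only [Finset.sum_add_distrib, ← Finset.mul_sum, h.scal] at h1
  have h2 : ∑ a : Fin 7, dl a a = 7 := by simp [dl]
  rw [h2] at h1
  linarith

end

section
variable {U : Set R7} {φ : LocalForm 3} {y : R7} {A : R7 ≃L[ℝ] R7} {X : R7 → R7} {lam : ℝ}

theorem matrix_eq_of_frame {M N : Matrix (Fin 7) (Fin 7) ℝ} (A : R7 ≃L[ℝ] R7)
    (h : ∀ a b, ((frameMat A).transpose * M * frameMat A) a b
      = ((frameMat A).transpose * N * frameMat A) a b) : M = N := by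
  have h1 : (frameMat A).transpose * M * frameMat A = (frameMat A).transpose * N * frameMat A := by
    ext a b; exact h a b
  have h2 := congrArg (fun K => (mat (A : R7 →L[ℝ] R7)).transpose * K * mat (A : R7 →L[ℝ] R7)) h1
  simp only [Matrix.mul_assoc, frameMat_mul, Matrix.mul_one] at h2
  rwa [← Matrix.mul_assoc, ← Matrix.mul_assoc, ← Matrix.transpose_mul, frameMat_mul,
    Matrix.transpose_one, Matrix.one_mul, Matrix.one_mul] at h2

/-- The identity acts on a 3-form as 3, so λφ is absorbed as λ/3 on the diagonal of L and the
soliton equation has the same shape for every λ. -/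
theorem IsLocalG2.lapArr_of_equation (h : IsLocalG2 U φ) (hy : y ∈ U) (hA : IsFrame (φ y) A)
    (heq : hodgeLaplacian φ φ y = lam • φ y + lieForm X φ y) (a b c : Fin 7) :
    lapArr (jetW φ A y) a b c = ∑ m, A (X y) m * jetF φ A y m a b c
      + actArr (fun i j => frameEnd A (covField φ X y) i j + lam / 3 * dl i j) a b c := by
  rw [← h.tri_hodgeLaplacian hy hA, heq, tri_add, tri_smul, hA.tri, tri_lieForm hA,
    actArr_add_smul_dl]
  ring

theorem IsLocalG2.divergence_eq (h : IsLocalG2 U φ) (hX : ContDiffOn ℝ ∞ X U) (hy : y ∈ U)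
    (heq : hodgeLaplacian φ φ y = lam • φ y + lieForm X φ y) :
    7 * lam + 3 * divergence φ X y = 2 * torsionNormSq φ y := by
  obtain ⟨A, hA⟩ := h.positive y hy
  have h1 := (h.isSecondJet hy hA).trace_of_lapArr (h.lapArr_of_equation hy hA heq)
  have h2 : ∑ a : Fin 7, dl a a = 7 := by simp [dl]
  rw [hA.torsionNormSq, h.divergence_frame (A := A) hX hy, h1, Finset.sum_add_distrib,
    ← Finset.mul_sum, h2]
  ring

theorem IsLocalG2.ricci_eq (h : IsLocalG2 U φ) (hX : ContDiffOn ℝ ∞ X U) (hy : y ∈ U)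
    (heq : hodgeLaplacian φ φ y = lam • φ y + lieForm X φ y) :
    -ricci φ y - ((1 / 3 : ℝ) * torsionNormSq φ y) • gMat φ y - (2 : ℝ) • torsionSq φ y
      = ((1 / 3 : ℝ) * lam) • gMat φ y + (1 / 2 : ℝ) • lieMetric φ X y := by
  obtain ⟨A, hA⟩ := h.positive y hy
  have hJ := h.isSecondJet hy hA
  have hE := h.lapArr_of_equation hy hA heq
  refine matrix_eq_of_frame A fun a b => ?_
  have h1 := hJ.ric_of_lapArr hE a b
  have h3 := h.divergence_eq hX hy heq
  rw [h.divergence_frame (A := A) hX hy] at h3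
  have h4 : ∑ k, tor (jetF φ A y) a k * tor (jetF φ A y) k b = -ip (tor (jetF φ A y)) a b := by
    rw [ip, ← Finset.sum_neg_distrib]
    exact Finset.sum_congr rfl fun k _ => by rw [hJ.lambda14.skew k b]; ring
  have hg : ((frameMat A).transpose * gMat φ y * frameMat A) a b = dl a b := by
    rw [gMat, hA.transpose_mul_metricOf_mul, Matrix.one_apply, dl]
  have h2 : ∑ a : Fin 7, dl a a = 7 := by simp [dl]
  simp only [Matrix.mul_sub, Matrix.sub_mul, Matrix.mul_add, Matrix.add_mul, Matrix.mul_neg,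
    Matrix.neg_mul, Matrix.mul_smul, Matrix.smul_mul, Matrix.sub_apply, Matrix.add_apply,
    Matrix.neg_apply, Matrix.smul_apply, smul_eq_mul, hA.torsionSq, h.ricci_frame hy hA, hg,
    h.lieMetric_frame hX hy hA, h4]
  rw [Finset.sum_add_distrib, ← Finset.mul_sum, h2, dl_comm b a] at h1
  -- The trace of L in h1 is traded for |T|² by the divergence identity; this produces the term |T|²
  -- g/3.
  linear_combination (1 / 8 : ℝ) * h1 + (1 / 6 : ℝ) * dl a b * h3

theorem IsLocalG2.codiff_interior_eq_zero (h : IsLocalG2 U φ) (hX : ContDiffOn ℝ ∞ X U)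
    (hy : y ∈ U) (heq : hodgeLaplacian φ φ y = lam • φ y + lieForm X φ y) :
    codiff φ (interior X φ) y = 0 := by
  obtain ⟨A, hA⟩ := h.positive y hy
  have hE := h.lapArr_of_equation hy hA heq
  have h0 : ∀ n, codiff φ (interior X φ) y ![frameVec A n] = 0 := by
    intro n
    rw [h.codiff_interior hX hy hA, neg_eq_zero,
      ← (h.isSecondJet hy hA).codiff_of_lapArr hE n]
    refine Finset.sum_congr rfl fun c _ => congrArg₂ (· + ·) rfl
      (Finset.sum_congr rfl fun m _ => ?_)
    -- The diagonal part λ/3 of L does not enter the codifferential, since φ_{ccn} = 0.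
    have : dl m c * phi0 m c n = 0 := by
      by_cases hmc : m = c
      · have := phi0_swap m c n
        rw [hmc] at this ⊢
        rw [show phi0 c c n = 0 by linarith, mul_zero]
      · rw [dl, if_neg hmc, zero_mul]
    linear_combination (-lam / 3) * this
  ext v
  have e : v = ![∑ n, A (v 0) n • frameVec A n] := by
    rw [field_eq_sum]; ext i; fin_cases i; rfl
  have e2 : ∀ v, codiff φ (interior X φ) y ![v] = (codiff φ (interior X φ) y).curryLeft v ![] :=
    fun _ => rfl
  rw [e, e2, map_sum, ContinuousAlternatingMap.sum_apply]
  refine Finset.sum_eq_zero fun n _ => ?_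
  rw [map_smul, ContinuousAlternatingMap.smul_apply, ← e2, h0, smul_zero]

theorem IsLocalG2.nabla_eq_zero_iff (h : IsLocalG2 U φ) (hy : y ∈ U) :
    torsionNormSq φ y = 0 ↔ ∀ i, covDeriv φ φ i y = 0 := by
  obtain ⟨A, hA⟩ := h.positive y hy
  have hJ := h.isSecondJet hy hA
  rw [hA.torsionNormSq]
  constructor
  · intro h0 i
    have hT : ∀ a b, tor (jetF φ A y) a b = 0 := by
      intro a b
      have hn : ∀ i k, 0 ≤ tor (jetF φ A y) i k * tor (jetF φ A y) i k := fun i k =>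
        mul_self_nonneg _
      have h1 := (Finset.sum_eq_zero_iff_of_nonneg (fun i _ => Finset.sum_nonneg fun k _ => hn i k)).1
        h0 a (Finset.mem_univ a)
      have h2 := (Finset.sum_eq_zero_iff_of_nonneg (fun k _ => hn a k)).1 h1 b (Finset.mem_univ b)
      exact mul_self_eq_zero.1 h2
    have hF : ∀ i a b c, jetF φ A y i a b c = 0 := by
      intro i a b c
      rw [eq_tor hJ.closed.alt hJ.metric]
      simp [hT]
    rw [← nabla_basisVec, ← field_eq_sum A (basisVec i), nabla_sum]
    refine ext_tri fun u v w => ?_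
    rw [tri_form_sum, ← field_eq_sum A u, ← field_eq_sum A v, ← field_eq_sum A w]
    simp only [tri_sum_left, tri_sum_mid, tri_sum_right]
    have hF' : ∀ i a b c, tri (nabla φ φ (frameVec A i) y) (frameVec A a) (frameVec A b)
      (frameVec A c) = 0 := hF
    have t0 : ∀ u v w, tri 0 u v w = 0 := fun _ _ _ => rfl
    simp only [hF', t0, mul_zero, Finset.sum_const_zero]
  · intro h0
    have hF : ∀ i a b c, jetF φ A y i a b c = 0 := by
      intro i a b c
      rw [jetF, nabla_eq_sum, tri_form_sum]
      refine Finset.sum_eq_zero fun k _ => ?_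
      rw [h0]; exact mul_zero _
    have hT : ∀ a b, tor (jetF φ A y) a b = 0 := by
      intro a b; simp [tor, ctrPsi, hF]
    simp [ip, hT]

end

/-! ### The volume density and the divergence -/

theorem HasMatDeriv.det_of_zero {n : Type*} [Fintype n] [DecidableEq n] {N : ℝ → Matrix n n ℝ}
    {t : ℝ} (h : HasMatDeriv N 0 t) : HasDerivAt (fun s => (N s).det) 0 t := by
  simp only [Matrix.det_apply']
  refine (HasDerivAt.fun_sum fun σ _ => (HasDerivAt.fun_finsetProd (u := Finset.univ)
    fun i _ => h (σ i) i).const_mul _).congr_deriv ?_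
  simp

theorem hasDerivAt_det_one_add_smul {n : Type*} [Fintype n] [DecidableEq n] (K : Matrix n n ℝ) :
    HasDerivAt (fun t : ℝ => (1 + t • K).det) K.trace 0 := by
  have e : (fun t : ℝ => (1 + t • K).det) = fun t => 1 + K.trace * t
      + (Matrix.det (1 + (Polynomial.X : Polynomial ℝ) • K.map Polynomial.C)).divX.divX.eval t
        * t ^ 2 := funext fun t => Matrix.det_one_add_smul t K
  rw [e]
  have h1 : HasDerivAt (fun t : ℝ => 1 + K.trace * t) (K.trace * 1) 0 :=
    ((hasDerivAt_id (0 : ℝ)).const_mul K.trace).const_add 1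
  have h2 := (Polynomial.hasDerivAt
    (Matrix.det (1 + (Polynomial.X : Polynomial ℝ) • K.map Polynomial.C)).divX.divX (0 : ℝ)).mul
    (hasDerivAt_pow 2 (0 : ℝ))
  refine (h1.add h2).congr_deriv ?_
  simp

section
variable {U : Set R7} {φ : LocalForm 3} {X : R7 → R7} {y : R7}

theorem IsLocalG2.abs_volCoeff_smooth (h : IsLocalG2 U φ) :
    ContDiffOn ℝ ∞ (fun z => |volCoeff (φ z)|) U :=
  h.volCoeff_smooth.abs fun _ hz => h.volCoeff_ne_zero hz

/-- Conjugating g along the line by 1 - tK gives a matrix with zero derivative at t = 0, hence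
stationary determinant. That determinant is (det(1 - tK) · |vol|)², whose derivative yields the
logarithmic derivative of the density. -/
theorem IsLocalG2.fderiv_abs_volCoeff (h : IsLocalG2 U φ) (hy : y ∈ U) (w : R7) :
    fderiv ℝ (fun z => |volCoeff (φ z)|) y w
      = |volCoeff (φ y)| * (mat (conn φ w y)).trace := by
  set K := mat (conn φ w y) with hK
  set v : R7 → ℝ := fun z => |volCoeff (φ z)| with hv
  have hv0 : v y ≠ 0 := abs_ne_zero.2 (h.volCoeff_ne_zero hy)
  have hB : HasMatDeriv (fun t : ℝ => 1 + t • -K) (-K) 0 := fun a b => by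
    have := ((hasDerivAt_id (0 : ℝ)).mul_const (-K a b)).const_add
      ((1 : Matrix (Fin 7) (Fin 7) ℝ) a b)
    simpa using this
  have hN := (hB.transpose.mul (h.hasMatDeriv_gMat hy w)).mul hB
  have hN0 : HasMatDeriv (fun t : ℝ => (1 + t • -K).transpose * gMat φ (y + t • w)
      * (1 + t • -K)) 0 0 := by
    convert hN using 1
    simp only [zero_smul, add_zero, Matrix.transpose_one, Matrix.one_mul, Matrix.mul_one,
      Matrix.transpose_neg, Matrix.neg_mul, Matrix.mul_neg]
    abel
  have hd := hN0.det_of_zero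
  have hl := ((hasDerivAt_det_one_add_smul (-K)).mul
    (hasDerivAt_line h.isOpen h.abs_volCoeff_smooth hy w)).pow 2
  have he : (fun t : ℝ => ((1 + t • -K).transpose * gMat φ (y + t • w) * (1 + t • -K)).det)
      =ᶠ[𝓝 0] ((fun t : ℝ => (1 + t • -K).det) * fun t : ℝ => v (y + t • w)) ^ 2 := by
    filter_upwards [h.eventually_line hy w] with t ht
    obtain ⟨A, hA⟩ := h.positive _ ht
    have := hA.det_metricOf
    simp only [Matrix.det_mul, Matrix.det_transpose, gMat, this, Pi.pow_apply, Pi.mul_apply, hv,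
      mul_pow, sq_abs]
    ring
  have hu := (hl.congr_of_eventuallyEq he).unique hd
  simp only [Pi.mul_apply, zero_smul, add_zero, Matrix.det_one, one_mul, Matrix.trace_neg,
    Nat.cast_ofNat, Nat.add_one_sub_one, pow_one] at hu
  have h2 : 2 * v y ≠ 0 := mul_ne_zero two_ne_zero hv0
  have := (mul_eq_zero.1 hu).resolve_left h2
  linarith

theorem trace_conn (φ : LocalForm 3) (w y : R7) :
    (mat (conn φ w y)).trace = ∑ i, ∑ k, christoffel φ i k i y * w k := by
  simp only [mat_conn, Matrix.trace, Matrix.diag_apply, Matrix.sum_apply, Matrix.smul_apply,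
    smul_eq_mul, connMat, Matrix.of_apply]
  exact Finset.sum_congr rfl fun i _ => Finset.sum_congr rfl fun k _ => mul_comm _ _

/-- The divergence in terms of the volume density. -/
theorem IsLocalG2.sum_pderiv_abs_volCoeff_mul (h : IsLocalG2 U φ) (hX : ContDiffOn ℝ ∞ X U)
    (hy : y ∈ U) : ∑ k, pderiv k (fun z => |volCoeff (φ z)| * X z k) y
      = |volCoeff (φ y)| * divergence φ X y := by
  have hXk := contDiffOn_euclidean.1 hX
  simp only [pderiv_mul h.isOpen h.abs_volCoeff_smooth (hXk _) hy]
  have e1 : ∑ k, pderiv k (fun z => |volCoeff (φ z)|) y * X y k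
      = |volCoeff (φ y)| * (mat (conn φ (X y) y)).trace := by
    rw [← h.fderiv_abs_volCoeff hy, fderiv_eq_sum_pderiv]
    exact Finset.sum_congr rfl fun k _ => mul_comm _ _
  rw [Finset.sum_add_distrib, e1, trace_conn, divergence, Finset.sum_add_distrib, mul_add,
    add_comm, Finset.mul_sum (f := fun k => pderiv k (fun z => X z k) y)]
  simp only [h.christoffel_symm hy]

theorem IsLocalG2.divergence_mul (h : IsLocalG2 U φ) {f : R7 → ℝ} (hf : ContDiffOn ℝ ∞ f U)
    (hX : ContDiffOn ℝ ∞ X U) (hy : y ∈ U) :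
    divergence φ (fun z => f z • X z) y = fderiv ℝ f y (X y) + f y * divergence φ X y := by
  have hXk := contDiffOn_euclidean.1 hX
  simp only [divergence, PiLp.smul_apply, smul_eq_mul, pderiv_mul h.isOpen hf (hXk _) hy]
  rw [fderiv_eq_sum_pderiv, Finset.mul_sum, ← Finset.sum_add_distrib]
  refine Finset.sum_congr rfl fun i _ => ?_
  rw [mul_add, Finset.mul_sum, mul_comm (pderiv i f y), add_assoc]
  congr 2
  exact Finset.sum_congr rfl fun k _ => by ring

theorem IsLocalG2.torsionNormSq_nonneg (h : IsLocalG2 U φ) (hy : y ∈ U) :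
    0 ≤ torsionNormSq φ y := by
  obtain ⟨A, hA⟩ := h.positive y hy
  rw [hA.torsionNormSq]
  exact Finset.sum_nonneg fun i _ => Finset.sum_nonneg fun k _ => mul_self_nonneg _

theorem IsLocalG2.divergence_smooth (h : IsLocalG2 U φ) (hX : ContDiffOn ℝ ∞ X U) :
    ContDiffOn ℝ ∞ (divergence φ X) U :=
  ContDiffOn.sum fun i _ => (contDiffOn_pderiv h.isOpen (contDiffOn_euclidean.1 hX i) i).add
    (ContDiffOn.sum fun k _ => (h.christoffel_smooth i i k).mul (contDiffOn_euclidean.1 hX k))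

end

/-! ### Tensors in the charts of a manifold -/

section
variable {M : Type*} [TopologicalSpace M] [ChartedSpace R7 M]
  {e e' : OpenPartialHomeomorph M R7} {y : R7}
  {φ : ∀ x : M, TangentSpace (𝓡 7) x [⋀^Fin 3]→L[ℝ] ℝ} {X : ∀ x : M, TangentSpace (𝓡 7) x}
  {lam : ℝ}

theorem mdifferentiable_of_mem_charts (he : e ∈ charts M) : e.MDifferentiable (𝓡 7) (𝓡 7) :=
  ⟨(contMDiffOn_of_mem_maximalAtlas he).mdifferentiableOn (by simp),
    (contMDiffOn_symm_of_mem_maximalAtlas he).mdifferentiableOn (by simp)⟩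

/-- The derivative of the inverse of a chart, as an isomorphism. -/
def chartIso (he : e ∈ charts M) (hy : y ∈ e.target) : R7 ≃L[ℝ] TangentSpace (𝓡 7) (e.symm y) :=
  (mdifferentiable_of_mem_charts he).symm.mfderiv (x := y) hy

theorem fieldInChart_eq (he : e ∈ charts M) (hy : y ∈ e.target) :
    fieldInChart e X y = (chartIso he hy).symm (X (e.symm y)) := by
  rw [fieldInChart, VectorField.mpullback_apply]
  exact congrFun (congrArg _ (ContinuousLinearMap.inverse_equiv (chartIso he hy))) _

theorem mfderiv_symm_fieldInChart (he : e ∈ charts M) (hy : y ∈ e.target) :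
    mfderiv (𝓡 7) (𝓡 7) e.symm y (fieldInChart e X y) = X (e.symm y) := by
  rw [fieldInChart_eq he hy]
  exact (chartIso he hy).apply_symm_apply _

theorem IsG2Structure.isPositive (h : IsG2Structure φ) (he : e ∈ charts M) (hy : y ∈ e.target) :
    IsPositive (formInChart e φ y) := by
  obtain ⟨u, hu⟩ := h.positive (e.symm y)
  exact ⟨(chartIso he hy).trans u, fun v => hu _⟩

theorem formInChart_comp_mfderiv (he : e ∈ charts M) {x : M} (hx : x ∈ e.source)
    (v : Fin 3 → TangentSpace (𝓡 7) x) :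
    formInChart e φ (e x) (fun i => mfderiv (𝓡 7) (𝓡 7) e x (v i)) = φ x v := by
  have h4 := (mdifferentiable_of_mem_charts he).symm_comp_deriv hx
  have h5 : ∀ w : R7, mfderiv (𝓡 7) (𝓡 7) e.symm (e x) (mfderiv (𝓡 7) (𝓡 7) e x w) = w :=
    fun w => DFunLike.congr_fun h4 w
  have key : ∀ x' : M, x' = x → ∀ w : Fin 3 → R7,
      (φ x' : R7 [⋀^Fin 3]→L[ℝ] ℝ) w = (φ x : R7 [⋀^Fin 3]→L[ℝ] ℝ) w := by
    rintro _ rfl _; rfl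
  refine (key _ (e.left_inv hx) _).trans ?_
  exact congrArg (φ x) (funext fun i => h5 (v i))

/-- The transition between two charts. -/
theorem formInChart_eq_comp (he : e ∈ charts M) (he' : e' ∈ charts M) (hy : y ∈ e'.target)
    (hy' : e'.symm y ∈ e.source) :
    formInChart e' φ y = (formInChart e φ (e (e'.symm y))).compContinuousLinearMap
      (fderiv ℝ (e ∘ e'.symm) y) := by
  have h1 : MDifferentiableAt (𝓡 7) (𝓡 7) e'.symm y :=
    (mdifferentiable_of_mem_charts he').mdifferentiableAt_symm hy
  have h2 : MDifferentiableAt (𝓡 7) (𝓡 7) e (e'.symm y) :=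
    (mdifferentiable_of_mem_charts he).mdifferentiableAt hy'
  have h3 := mfderiv_comp y h2 h1
  rw [mfderiv_eq_fderiv] at h3
  ext v
  rw [ContinuousAlternatingMap.compContinuousLinearMap_apply, h3]
  exact (formInChart_comp_mfderiv he hy' _).symm

theorem hasFDerivAt_transition (he : e ∈ charts M) (he' : e' ∈ charts M) (hy : y ∈ e'.target)
    (hy' : e'.symm y ∈ e.source) :
    HasFDerivAt (e ∘ e'.symm) (fderiv ℝ (e ∘ e'.symm) y) y := by
  have h1 : MDifferentiableAt (𝓡 7) (𝓡 7) e'.symm y :=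
    (mdifferentiable_of_mem_charts he').mdifferentiableAt_symm hy
  have h2 : MDifferentiableAt (𝓡 7) (𝓡 7) e (e'.symm y) :=
    (mdifferentiable_of_mem_charts he).mdifferentiableAt hy'
  exact (mdifferentiableAt_iff_differentiableAt.1 (h2.comp y h1)).hasFDerivAt

/-- The volume density of a `G₂` structure is a density. -/
theorem IsG2Structure.abs_volCoeff_transition (h : IsG2Structure φ) (he : e ∈ charts M)
    (he' : e' ∈ charts M) (hy : y ∈ e'.target) (hy' : e'.symm y ∈ e.source) :
    |volCoeff (formInChart e' φ y)| = |(fderiv ℝ (e ∘ e'.symm) y).det|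
      * |volCoeff (formInChart e φ (e (e'.symm y)))| := by
  obtain ⟨A, hA⟩ := h.isPositive he (e.map_source hy')
  let B : R7 ≃L[ℝ] R7 := (chartIso he' hy).trans
    ((mdifferentiable_of_mem_charts he).mfderiv hy')
  have hB : fderiv ℝ (e ∘ e'.symm) y = (B : R7 →L[ℝ] R7) := by
    have h1 : MDifferentiableAt (𝓡 7) (𝓡 7) e'.symm y :=
      (mdifferentiable_of_mem_charts he').mdifferentiableAt_symm hy
    have h2 : MDifferentiableAt (𝓡 7) (𝓡 7) e (e'.symm y) :=
      (mdifferentiable_of_mem_charts he).mdifferentiableAt hy'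
    have h3 := mfderiv_comp y h2 h1
    rw [mfderiv_eq_fderiv] at h3
    exact h3
  rw [formInChart_eq_comp he he' hy hy', hB, hA.volCoeff_comp B, det_mat, abs_mul]

/-- The derivative of a function along a vector field, in a chart. -/
theorem fderiv_comp_symm_fieldInChart (he : e ∈ charts M) (hy : y ∈ e.target) {f : M → ℝ}
    (hf : MDifferentiableAt (𝓡 7) 𝓘(ℝ, ℝ) f (e.symm y)) :
    fderiv ℝ (f ∘ e.symm) y (fieldInChart e X y)
      = mfderiv (𝓡 7) 𝓘(ℝ, ℝ) f (e.symm y) (X (e.symm y)) := by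
  have h1 : MDifferentiableAt (𝓡 7) (𝓡 7) e.symm y :=
    (mdifferentiable_of_mem_charts he).mdifferentiableAt_symm hy
  have h3 := mfderiv_comp y hf h1
  rw [mfderiv_eq_fderiv] at h3
  rw [h3, ← mfderiv_symm_fieldInChart (X := X) he hy]
  rfl

theorem contDiffOn_comp_symm (he : e ∈ charts M) {f : M → ℝ}
    (hf : ContMDiff (𝓡 7) 𝓘(ℝ, ℝ) ∞ f) : ContDiffOn ℝ ∞ (f ∘ e.symm) e.target :=
  contMDiffOn_iff_contDiffOn.1 (hf.comp_contMDiffOn (contMDiffOn_symm_of_mem_maximalAtlas he))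

variable [IsManifold (𝓡 7) ∞ M]

theorem contDiffOn_fieldInChart (he : e ∈ charts M)
    (hX : ContMDiff (𝓡 7) (𝓡 7).tangent ∞ fun x : M => (⟨x, X x⟩ : TangentBundle (𝓡 7) M)) :
    ContDiffOn ℝ ∞ (fieldInChart e X) e.target := by
  intro y hy
  have h1 : (mfderiv (𝓡 7) (𝓡 7) e.symm y).IsInvertible := ⟨chartIso he hy, rfl⟩
  have h2 := ContMDiffAt.mpullback_vectorField_preimage (m := ∞) (n := ∞) (hX (e.symm y))
    (contMDiffAt_symm_of_mem_maximalAtlas he hy) h1 (by simp)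
  exact (contMDiffAt_vectorSpace_iff_contDiffAt.1 h2).contDiffWithinAt

theorem IsLaplacianSoliton.isLocalG2 (h : IsLaplacianSoliton φ X lam) (he : e ∈ charts M) :
    IsLocalG2 e.target (formInChart e φ) where
  isOpen := e.open_target
  smooth := h.isG2.smooth e he
  positive _ hy := h.isG2.isPositive he hy
  closed := h.closed e he

end

open MeasureTheory Set

/-! ### The divergence theorem for fields with compact support -/

section
variable {U K : Set R7} {g : R7 → ℝ}

theorem integrableOn_of_eq_zero (hU : IsOpen U) (hg : ContinuousOn g U) (hK : IsCompact K)
    (hKU : K ⊆ U) (h0 : ∀ z ∈ U, z ∉ K → g z = 0) : IntegrableOn g U :=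
  ((hg.mono hKU).integrableOn_compact hK).of_forall_sdiff_eq_zero hU.measurableSet
    fun z hz => h0 z hz.1 hz.2

theorem integral_fderiv_eq_zero {G : R7 → ℝ} (hG : ContDiff ℝ ∞ G) (hc : HasCompactSupport G)
    (v : R7) : ∫ z, fderiv ℝ G z v = 0 := by
  have hd : Continuous fun z => fderiv ℝ G z v :=
    (hG.continuous_fderiv (by simp)).clm_apply continuous_const
  have hcd : HasCompactSupport fun z => fderiv ℝ G z v := hc.fderiv_apply ℝ v
  have h := integral_mul_fderiv_eq_neg_fderiv_mul_of_integrable (μ := (volume : Measure R7))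
    (f := fun _ : R7 => (1 : ℝ)) (g := G) (v := v) (by simp)
    (by simpa using hd.integrable_of_hasCompactSupport hcd)
    (by simpa using hG.continuous.integrable_of_hasCompactSupport hc)
    (fun x _ => differentiableAt_const _) (fun x _ => hG.differentiable (by simp) x)
  simpa using h

/-- Extension by zero is smooth because g vanishes on U outside the compact K, so integration by
parts on the whole space applies. -/
theorem setIntegral_pderiv_eq_zero (hU : IsOpen U) (hg : ContDiffOn ℝ ∞ g U) (hK : IsCompact K)
    (hKU : K ⊆ U) (h0 : ∀ z ∈ U, z ∉ K → g z = 0) (k : Fin 7) : ∫ z in U, pderiv k g z = 0 := by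
  have e1 : ∀ y ∈ U, U.indicator g =ᶠ[𝓝 y] g := fun y hy => by
    filter_upwards [hU.mem_nhds hy] with z hz using indicator_of_mem hz g
  have e2 : ∀ y ∉ K, U.indicator g =ᶠ[𝓝 y] 0 := fun y hy => by
    filter_upwards [hK.isClosed.isOpen_compl.mem_nhds hy] with z hz
    exact indicator_apply_eq_zero.2 fun hzU => h0 z hzU hz
  have hG : ContDiff ℝ ∞ (U.indicator g) := contDiff_iff_contDiffAt.2 fun y => by
    by_cases hy : y ∈ K
    · exact (hg.contDiffAt (hU.mem_nhds (hKU hy))).congr_of_eventuallyEq (e1 y (hKU hy))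
    · exact contDiffAt_const.congr_of_eventuallyEq (e2 y hy)
  have hc : HasCompactSupport (U.indicator g) := HasCompactSupport.intro hK fun y hy =>
    (e2 y hy).eq_of_nhds
  have h1 : ∫ z in U, pderiv k g z = ∫ z in U, fderiv ℝ (U.indicator g) z (basisVec k) :=
    setIntegral_congr_fun hU.measurableSet fun y hy => by simp only [pderiv, (e1 y hy).fderiv_eq]
  rw [h1, setIntegral_eq_integral_of_forall_compl_eq_zero, integral_fderiv_eq_zero hG hc]
  intro y hy
  rw [(e2 y fun h => hy (hKU h)).fderiv_eq]
  simp

theorem IsLocalG2.setIntegral_divergence {φ : LocalForm 3} {X : R7 → R7} {f : R7 → ℝ}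
    (h : IsLocalG2 U φ) (hX : ContDiffOn ℝ ∞ X U) (hf : ContDiffOn ℝ ∞ f U) (hK : IsCompact K)
    (hKU : K ⊆ U) (h0 : ∀ z ∈ U, z ∉ K → f z = 0) :
    ∫ z in U, |volCoeff (φ z)| * (f z * divergence φ X z)
      = -∫ z in U, |volCoeff (φ z)| * fderiv ℝ f z (X z) := by
  have hv := h.abs_volCoeff_smooth
  have hfX : ContDiffOn ℝ ∞ (fun z => f z • X z) U := hf.smul hX
  have hcomp := fun k => hv.mul (contDiffOn_euclidean.1 hfX k)
  have hz : ∀ k, ∀ z ∈ U, z ∉ K → |volCoeff (φ z)| * (f z • X z) k = 0 := fun k z hz hzK => by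
    simp [h0 z hz hzK]
  have hz' : ∀ z ∈ U, z ∉ K → f =ᶠ[𝓝 z] 0 := fun z hz hzK => by
    filter_upwards [h.isOpen.mem_nhds hz, hK.isClosed.isOpen_compl.mem_nhds hzK] with w hw hwK
      using h0 w hw hwK
  have hi1 : IntegrableOn (fun z => |volCoeff (φ z)| * (f z * divergence φ X z)) U :=
    integrableOn_of_eq_zero h.isOpen
      (hv.mul (hf.mul (h.divergence_smooth hX))).continuousOn hK hKU
      fun z hz hzK => by rw [h0 z hz hzK]; ring
  have hi2 : IntegrableOn (fun z => |volCoeff (φ z)| * fderiv ℝ f z (X z)) U :=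
    integrableOn_of_eq_zero h.isOpen
      (hv.mul ((hf.fderiv_of_isOpen h.isOpen (by norm_num)).clm_apply hX)).continuousOn hK hKU
      fun z hz hzK => by rw [(hz' z hz hzK).fderiv_eq]; simp
  rw [eq_neg_iff_add_eq_zero, ← integral_add hi1 hi2]
  have e : ∀ z ∈ U, |volCoeff (φ z)| * (f z * divergence φ X z)
      + |volCoeff (φ z)| * fderiv ℝ f z (X z)
      = ∑ k, pderiv k (fun z => |volCoeff (φ z)| * (f z • X z) k) z := fun z hz => by
    rw [h.sum_pderiv_abs_volCoeff_mul hfX hz, h.divergence_mul hf hX hz]; ring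
  rw [setIntegral_congr_fun h.isOpen.measurableSet e, integral_finsetSum]
  · exact Finset.sum_eq_zero fun k _ =>
      setIntegral_pderiv_eq_zero h.isOpen (hcomp k) hK hKU (hz k) k
  · intro k _
    refine integrableOn_of_eq_zero h.isOpen
      (contDiffOn_pderiv h.isOpen (hcomp k) k).continuousOn hK hKU fun z hz hzK => ?_
    have : (fun z => |volCoeff (φ z)| * (f z • X z) k) =ᶠ[𝓝 z] 0 := by
      filter_upwards [hz' z hz hzK] with w hw
      simp [hw]
    rw [pderiv, this.fderiv_eq]
    simp

end

/-! ### Integration on a manifold with a `G₂` structure -/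

section
variable {M : Type*} [TopologicalSpace M] [ChartedSpace R7 M]
  {e e' : OpenPartialHomeomorph M R7}
  {φ : ∀ x : M, TangentSpace (𝓡 7) x [⋀^Fin 3]→L[ℝ] ℝ} {X : ∀ x : M, TangentSpace (𝓡 7) x}

/-- The integral over the domain of a chart of a function, for the volume of a `G₂` structure. -/
def chartIntegral (φ : ∀ x : M, TangentSpace (𝓡 7) x [⋀^Fin 3]→L[ℝ] ℝ)
    (e : OpenPartialHomeomorph M R7) (F : M → ℝ) : ℝ :=
  ∫ y in e.target, |volCoeff (formInChart e φ y)| * F (e.symm y)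

theorem chartIntegral_eq_inter (e e' : OpenPartialHomeomorph M R7) {F : M → ℝ}
    (hF : ∀ x ∈ e.source, x ∉ e'.source → F x = 0) :
    chartIntegral φ e F = ∫ y in e.target ∩ e.symm ⁻¹' e'.source,
      |volCoeff (formInChart e φ y)| * F (e.symm y) := by
  refine (setIntegral_eq_of_subset_of_forall_sdiff_eq_zero e.open_target.measurableSet
    inter_subset_left fun y hy => ?_)
  rw [hF _ (e.map_target hy.1) fun h => hy.2 ⟨hy.1, h⟩, mul_zero]

/-- Both integrals live on the overlap, where |vol| scales by the absolute Jacobian of the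
transition map, as the change of variables requires. -/
theorem IsG2Structure.chartIntegral_eq (h : IsG2Structure φ) (he : e ∈ charts M)
    (he' : e' ∈ charts M) {F : M → ℝ} (hF : ∀ x, x ∉ e.source → F x = 0)
    (hF' : ∀ x, x ∉ e'.source → F x = 0) :
    chartIntegral φ e F = chartIntegral φ e' F := by
  rw [chartIntegral_eq_inter e e' fun x _ hx => hF' x hx,
    chartIntegral_eq_inter e' e fun x _ hx => hF x hx]
  have hW' : IsOpen (e'.target ∩ e'.symm ⁻¹' e.source) :=
    e'.symm.isOpen_inter_preimage e.open_source
  have himg : (e ∘ e'.symm) '' (e'.target ∩ e'.symm ⁻¹' e.source)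
      = e.target ∩ e.symm ⁻¹' e'.source := by
    ext y
    constructor
    · rintro ⟨z, ⟨hz, hz'⟩, rfl⟩
      refine ⟨e.map_source hz', ?_⟩
      rw [mem_preimage, Function.comp_apply, e.left_inv hz']
      exact e'.map_target hz
    · rintro ⟨hy, hy'⟩
      refine ⟨e' (e.symm y), ⟨e'.map_source hy', ?_⟩, ?_⟩
      · rw [mem_preimage, e'.left_inv hy']; exact e.map_target hy
      · rw [Function.comp_apply, e'.left_inv hy', e.right_inv hy]
  have hinj : InjOn (e ∘ e'.symm) (e'.target ∩ e'.symm ⁻¹' e.source) := by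
    rintro y ⟨hy, hy'⟩ z ⟨hz, hz'⟩ hyz
    exact e'.symm.injOn hy hz (e.injOn hy' hz' hyz)
  rw [← himg, integral_image_eq_integral_abs_det_fderiv_smul volume hW'.measurableSet
    (fun y hy => (hasFDerivAt_transition he he' hy.1 hy.2).hasFDerivWithinAt) hinj]
  refine setIntegral_congr_fun hW'.measurableSet fun y hy => ?_
  simp only [Function.comp_apply, smul_eq_mul]
  rw [e.left_inv hy.2, h.abs_volCoeff_transition he he' hy.1 hy.2, mul_assoc]

end

open MeasureTheory Set

/-! ### The divergence theorem on a compact manifold -/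

section
variable {M : Type*} [TopologicalSpace M] {e : OpenPartialHomeomorph M R7} {f : M → ℝ} {y : R7}

theorem isCompact_image_tsupport [CompactSpace M] (hs : tsupport f ⊆ e.source) :
    IsCompact (e '' tsupport f) :=
  (isClosed_tsupport f).isCompact.image_of_continuousOn (e.continuousOn.mono hs)

theorem image_tsupport_subset (hs : tsupport f ⊆ e.source) :
    e '' tsupport f ⊆ e.target := by
  rintro _ ⟨x, hx, rfl⟩
  exact e.map_source (hs hx)

theorem symm_notMem_tsupport (hy : y ∈ e.target)
    (hy' : y ∉ e '' tsupport f) : e.symm y ∉ tsupport f :=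
  fun h => hy' ⟨_, h, e.right_inv hy⟩

theorem eq_zero_of_notMem_image_tsupport (hy : y ∈ e.target)
    (hy' : y ∉ e '' tsupport f) : f (e.symm y) = 0 :=
  image_eq_zero_of_notMem_tsupport (symm_notMem_tsupport hy hy')

end

section
variable {M : Type*} [TopologicalSpace M] [ChartedSpace R7 M]
  {e : OpenPartialHomeomorph M R7}
  {φ : ∀ x : M, TangentSpace (𝓡 7) x [⋀^Fin 3]→L[ℝ] ℝ} {X : ∀ x : M, TangentSpace (𝓡 7) x}

/-- The derivative of a function along a vector field. -/
def dirDeriv (X : ∀ x : M, TangentSpace (𝓡 7) x) (f : M → ℝ) (x : M) : ℝ :=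
  mfderiv (𝓡 7) 𝓘(ℝ, ℝ) f x (X x)

/-- The divergence of a vector field in a chart, as a function on the manifold. -/
def chartDiv (φ : ∀ x : M, TangentSpace (𝓡 7) x [⋀^Fin 3]→L[ℝ] ℝ)
    (X : ∀ x : M, TangentSpace (𝓡 7) x) (e : OpenPartialHomeomorph M R7) (x : M) : ℝ :=
  divergence (formInChart e φ) (fieldInChart e X) (e x)

theorem fderiv_comp_symm_eq_dirDeriv (he : e ∈ charts M) {f : M → ℝ}
    (hf : ContMDiff (𝓡 7) 𝓘(ℝ, ℝ) ∞ f) {y : R7} (hy : y ∈ e.target) :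
    fderiv ℝ (f ∘ e.symm) y (fieldInChart e X y) = dirDeriv X f (e.symm y) :=
  fderiv_comp_symm_fieldInChart he hy ((hf _).mdifferentiableAt (by simp))

theorem dirDeriv_eq_zero {f : M → ℝ} {x : M} (hx : x ∉ tsupport f) : dirDeriv X f x = 0 := by
  rw [dirDeriv, (notMem_tsupport_iff_eventuallyEq.1 hx).mfderiv_eq]
  erw [mfderiv_const]
  rfl

theorem sum_partition {ι : Type*} [Fintype ι] (ρ : SmoothPartitionOfUnity ι (𝓡 7) M univ)
    (x : M) : ∑ i, ρ i x = 1 := by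
  rw [← finsum_eq_sum_of_fintype]
  exact ρ.sum_eq_one (mem_univ x)

theorem sum_dirDeriv {ι : Type*} [Fintype ι] (ρ : SmoothPartitionOfUnity ι (𝓡 7) M univ)
    (he : e ∈ charts M) {y : R7} (hy : y ∈ e.target) :
    ∑ i, dirDeriv X (ρ i) (e.symm y) = 0 := by
  have h1 : ∀ i, DifferentiableAt ℝ (ρ i ∘ e.symm) y := fun i =>
    ((contDiffOn_comp_symm he (ρ i).contMDiff).contDiffAt
      (e.open_target.mem_nhds hy)).differentiableAt (by simp)
  have h2 : fderiv ℝ (fun z => ∑ i, (ρ i ∘ e.symm) z) y = 0 := by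
    have : (fun z => ∑ i, (ρ i ∘ e.symm) z) = fun _ => (1 : ℝ) :=
      funext fun z => sum_partition ρ (e.symm z)
    rw [this, fderiv_fun_const]; rfl
  rw [fderiv_fun_sum fun i _ => h1 i] at h2
  have h3 := DFunLike.congr_fun h2 (fieldInChart e X y)
  rw [sum_apply] at h3
  refine Eq.trans (Finset.sum_congr rfl fun i _ => ?_) h3
  exact (fderiv_comp_symm_eq_dirDeriv he (ρ i).contMDiff hy).symm

variable [CompactSpace M] {f h : M → ℝ}

theorem chartIntegral_mul_div (hφ : IsLocalG2 e.target (formInChart e φ)) (he : e ∈ charts M)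
    (hX : ContDiffOn ℝ ∞ (fieldInChart e X) e.target) (hf : ContMDiff (𝓡 7) 𝓘(ℝ, ℝ) ∞ f)
    (hs : tsupport f ⊆ e.source) :
    chartIntegral φ e (fun x => f x * chartDiv φ X e x) = -chartIntegral φ e (dirDeriv X f) := by
  have h1 := hφ.setIntegral_divergence hX (contDiffOn_comp_symm he hf)
    (isCompact_image_tsupport hs) (image_tsupport_subset hs)
    fun z hz hzK => eq_zero_of_notMem_image_tsupport hz hzK
  rw [chartIntegral, chartIntegral]
  refine Eq.trans (setIntegral_congr_fun e.open_target.measurableSet fun y hy => ?_)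
    (h1.trans (congrArg Neg.neg (setIntegral_congr_fun e.open_target.measurableSet fun y hy => ?_)))
  · simp only [chartDiv, e.right_inv hy, Function.comp_apply]
  · simp only [fderiv_comp_symm_eq_dirDeriv he hf hy]

theorem integrableOn_mul_dirDeriv (hφ : IsLocalG2 e.target (formInChart e φ)) (he : e ∈ charts M)
    (hX : ContDiffOn ℝ ∞ (fieldInChart e X) e.target) (hf : ContMDiff (𝓡 7) 𝓘(ℝ, ℝ) ∞ f)
    (hh : ContMDiff (𝓡 7) 𝓘(ℝ, ℝ) ∞ h) {r : M → ℝ} (hr : r = f ∨ r = h)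
    (hs : tsupport r ⊆ e.source) :
    IntegrableOn (fun y => |volCoeff (formInChart e φ y)|
      * (h (e.symm y) * dirDeriv X f (e.symm y))) e.target := by
  have hf' := contDiffOn_comp_symm he hf
  have hh' := contDiffOn_comp_symm he hh
  refine integrableOn_of_eq_zero e.open_target ?_ (isCompact_image_tsupport hs)
    (image_tsupport_subset hs) fun y hy hyK => ?_
  · refine (hφ.abs_volCoeff_smooth.mul (hh'.mul ((hf'.fderiv_of_isOpen e.open_target
      (by norm_num)).clm_apply hX))).continuousOn.congr fun y hy => ?_
    rw [← fderiv_comp_symm_eq_dirDeriv he hf hy]; rfl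
  · have h0 := symm_notMem_tsupport hy hyK
    rcases hr with rfl | rfl
    · rw [dirDeriv_eq_zero h0]; ring
    · rw [image_eq_zero_of_notMem_tsupport h0]; ring

variable {ι : Type*} [Fintype ι] {E : ι → OpenPartialHomeomorph M R7}
  (ρ : SmoothPartitionOfUnity ι (𝓡 7) M univ)

/-- Inserting 1 = Σ ρ_j and moving the (i, j) term from chart i to chart j lets the sum over i act
inside one integral, where Σ Xρ_i = X(1) = 0. -/
theorem IsG2Structure.sum_chartIntegral_dirDeriv (hφ : IsG2Structure φ)
    (hloc : ∀ e ∈ charts M, IsLocalG2 e.target (formInChart e φ))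
    (hX : ∀ e ∈ charts M, ContDiffOn ℝ ∞ (fieldInChart e X) e.target)
    (hE : ∀ i, E i ∈ charts M) (hs : ∀ i, tsupport (ρ i) ⊆ (E i).source) :
    ∑ i, chartIntegral φ (E i) (dirDeriv X (ρ i)) = 0 := by
  have h1 : ∀ i, chartIntegral φ (E i) (dirDeriv X (ρ i))
      = ∑ j, chartIntegral φ (E i) (fun x => ρ j x * dirDeriv X (ρ i) x) := fun i => by
    simp only [chartIntegral]
    rw [← integral_finsetSum _ fun j _ => integrableOn_mul_dirDeriv (hloc _ (hE i)) (hE i)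
      (hX _ (hE i)) (ρ i).contMDiff (ρ j).contMDiff (Or.inl rfl) (hs i)]
    refine setIntegral_congr_fun (E i).open_target.measurableSet fun y hy => ?_
    simp only [← Finset.mul_sum, ← Finset.sum_mul, sum_partition, one_mul]
  have h2 : ∀ i j, chartIntegral φ (E i) (fun x => ρ j x * dirDeriv X (ρ i) x)
      = chartIntegral φ (E j) (fun x => ρ j x * dirDeriv X (ρ i) x) := fun i j =>
    hφ.chartIntegral_eq (hE i) (hE j)
      (fun x hx => by rw [dirDeriv_eq_zero fun h => hx (hs i h), mul_zero])
      (fun x hx => by rw [image_eq_zero_of_notMem_tsupport fun h => hx (hs j h), zero_mul])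
  rw [Finset.sum_congr rfl fun i _ => (h1 i).trans (Finset.sum_congr rfl fun j _ => h2 i j),
    Finset.sum_comm]
  refine Finset.sum_eq_zero fun j _ => ?_
  simp only [chartIntegral]
  rw [← integral_finsetSum _ fun i _ => integrableOn_mul_dirDeriv (hloc _ (hE j)) (hE j)
    (hX _ (hE j)) (ρ i).contMDiff (ρ j).contMDiff (Or.inr rfl) (hs j)]
  refine setIntegral_eq_zero_of_forall_eq_zero fun y hy => ?_
  rw [← Finset.mul_sum, ← Finset.mul_sum, sum_dirDeriv ρ (hE j) hy, mul_zero, mul_zero]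

theorem IsG2Structure.sum_chartIntegral_div (hφ : IsG2Structure φ)
    (hloc : ∀ e ∈ charts M, IsLocalG2 e.target (formInChart e φ))
    (hX : ∀ e ∈ charts M, ContDiffOn ℝ ∞ (fieldInChart e X) e.target)
    (hE : ∀ i, E i ∈ charts M) (hs : ∀ i, tsupport (ρ i) ⊆ (E i).source) :
    ∑ i, chartIntegral φ (E i) (fun x => ρ i x * chartDiv φ X (E i) x) = 0 := by
  simp only [fun i => chartIntegral_mul_div (hloc _ (hE i)) (hE i) (hX _ (hE i))
    (ρ i).contMDiff (hs i), Finset.sum_neg_distrib,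
    hφ.sum_chartIntegral_dirDeriv ρ hloc hX hE hs, neg_zero]

/-- A divergence of constant sign on a compact manifold vanishes. -/
theorem IsG2Structure.divergence_eq_zero [T2Space M] [IsManifold (𝓡 7) ∞ M]
    (hφ : IsG2Structure φ)
    (hloc : ∀ e ∈ charts M, IsLocalG2 e.target (formInChart e φ))
    (hX : ∀ e ∈ charts M, ContDiffOn ℝ ∞ (fieldInChart e X) e.target) (c : ℝ)
    (hc : ∀ e ∈ charts M, ∀ y ∈ e.target,
      0 ≤ c * divergence (formInChart e φ) (fieldInChart e X) y)
    (he : e ∈ charts M) {y : R7} (hy : y ∈ e.target) :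
    c * divergence (formInChart e φ) (fieldInChart e X) y = 0 := by
  classical
  set x := e.symm y with hx
  obtain ⟨t, ht⟩ := isCompact_univ.elim_nhds_subcover (fun p : M => (chartAt R7 p).source)
    fun p _ => chart_source_mem_nhds R7 p
  let E : Option t → OpenPartialHomeomorph M R7 := fun o => o.elim e fun p => chartAt R7 (p : M)
  -- All sets but the first omit x, so the function subordinate to the given chart equals 1 at x.
  let V : Option t → Set M := fun o => o.elim e.source fun p => (chartAt R7 (p : M)).source \ {x}
  have hE : ∀ i, E i ∈ charts M := by
    rintro (_ | p)
    · exact he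
    · exact IsManifold.chart_mem_maximalAtlas _
  have hV : ∀ i, IsOpen (V i) := by
    rintro (_ | p)
    · exact e.open_source
    · exact (chartAt R7 (p : M)).open_source.sdiff isClosed_singleton
  have hVE : ∀ i, V i ⊆ (E i).source := by
    rintro (_ | p)
    · exact subset_rfl
    · exact sdiff_subset
  have hcov : (univ : Set M) ⊆ ⋃ i, V i := by
    intro z _
    by_cases hz : z = x
    · exact mem_iUnion.2 ⟨none, hz ▸ e.map_target hy⟩
    · obtain ⟨p, hp, hzp⟩ := mem_iUnion₂.1 (ht.2 (mem_univ z))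
      exact mem_iUnion.2 ⟨some ⟨p, hp⟩, hzp, hz⟩
  obtain ⟨ρ, hρ⟩ := SmoothPartitionOfUnity.exists_isSubordinate (𝓡 7) isClosed_univ V hV hcov
  have hs : ∀ i, tsupport (ρ i) ⊆ (E i).source := fun i => (hρ i).trans (hVE i)
  have hρx : ρ none x = 1 := by
    rw [← sum_partition ρ x, Fintype.sum_option, Finset.sum_eq_zero, add_zero]
    intro p _
    exact image_eq_zero_of_notMem_tsupport fun h => (hρ (some p) h).2 rfl
  have hsum := congrArg (c * ·) (hφ.sum_chartIntegral_div ρ hloc hX hE hs)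
  simp only [Finset.mul_sum, mul_zero, chartIntegral, ← integral_const_mul] at hsum
  have hpos : ∀ i, ∀ z ∈ (E i).target, 0 ≤ c * (|volCoeff (formInChart (E i) φ z)|
      * (ρ i ((E i).symm z) * chartDiv φ X (E i) ((E i).symm z))) := by
    intro i z hz
    have h1 := hc _ (hE i) z hz
    have h2 : 0 ≤ |volCoeff (formInChart (E i) φ z)| * ρ i ((E i).symm z) :=
      mul_nonneg (abs_nonneg _) (ρ.nonneg i _)
    rw [chartDiv, (E i).right_inv hz]
    nlinarith [mul_nonneg h1 h2]
  -- Each chart integral is nonnegative and their sum is zero. The one in the chart e has a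
  -- continuous integrand, which therefore vanishes everywhere, in particular at y.
  have hz := (Finset.sum_eq_zero_iff_of_nonneg fun i _ =>
    setIntegral_nonneg (E i).open_target.measurableSet (hpos i)).1 hsum none (Finset.mem_univ _)
  have hcont : ContinuousOn (fun z => c * (|volCoeff (formInChart e φ z)|
      * (ρ none (e.symm z) * chartDiv φ X e (e.symm z)))) e.target := by
    refine ((contDiffOn_const (c := c)).mul ((hloc e he).abs_volCoeff_smooth.mul
      ((contDiffOn_comp_symm he (ρ none).contMDiff).mul
        ((hloc e he).divergence_smooth (hX e he))))).continuousOn.congr fun z hz => ?_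
    rw [chartDiv, e.right_inv hz]; rfl
  have hint : IntegrableOn (fun z => c * (|volCoeff (formInChart e φ z)|
      * (ρ none (e.symm z) * chartDiv φ X e (e.symm z)))) e.target :=
    integrableOn_of_eq_zero e.open_target hcont (isCompact_image_tsupport (hs none))
      (image_tsupport_subset (hs none)) fun z hz hzK => by
        rw [eq_zero_of_notMem_image_tsupport (f := ρ none) hz hzK]; ring
  have hae := (setIntegral_eq_zero_iff_of_nonneg_ae
    (ae_restrict_of_forall_mem e.open_target.measurableSet (hpos none)) hint).1 hz
  have h0 : c * (|volCoeff (formInChart e φ y)| * (ρ none x * chartDiv φ X e x)) = 0 :=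
    Measure.eqOn_open_of_ae_eq hae e.open_target hcont continuousOn_const hy
  have hv : |volCoeff (formInChart e φ y)| ≠ 0 := abs_ne_zero.2 ((hloc e he).volCoeff_ne_zero hy)
  rw [hρx, chartDiv, one_mul, hx, e.right_inv hy, mul_left_comm] at h0
  exact (mul_eq_zero.1 h0).resolve_left hv

end

end G2

end

open G2 in
theorem proposition9p4 {M : Type*} [TopologicalSpace M] [T2Space M] [ChartedSpace R7 M]
    [IsManifold (𝓡 7) ∞ M]
    (φ : ∀ x : M, TangentSpace (𝓡 7) x [⋀^Fin 3]→L[ℝ] ℝ)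
    (X : ∀ x : M, TangentSpace (𝓡 7) x) (lam : ℝ)
    (hsol : IsLaplacianSoliton φ X lam) :
    (∀ e ∈ charts M, ∀ y ∈ e.target,
      (-ricci (formInChart e φ) y
          - ((1 / 3 : ℝ) * torsionNormSq (formInChart e φ) y) • gMat (formInChart e φ) y
          - (2 : ℝ) • torsionSq (formInChart e φ) y
        = ((1 / 3 : ℝ) * lam) • gMat (formInChart e φ) y
          + (1 / 2 : ℝ) • lieMetric (formInChart e φ) (fieldInChart e X) y) ∧
      codiff (formInChart e φ) (interior (fieldInChart e X) (formInChart e φ)) y = 0 ∧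
      7 * lam + 3 * divergence (formInChart e φ) (fieldInChart e X) y
        = 2 * torsionNormSq (formInChart e φ) y) ∧
    (CompactSpace M → Nonempty M →
      ¬ lam < 0 ∧ (lam = 0 ↔ IsTorsionFree φ)) := by
  have hloc : ∀ e ∈ charts M, IsLocalG2 e.target (formInChart e φ) := fun _ he =>
    hsol.isLocalG2 he
  have hX : ∀ e ∈ charts M, ContDiffOn ℝ ∞ (fieldInChart e X) e.target := fun _ he =>
    contDiffOn_fieldInChart he hsol.smooth_field
  have hdiv : ∀ e ∈ charts M, ∀ y ∈ e.target,
      7 * lam + 3 * divergence (formInChart e φ) (fieldInChart e X) y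
        = 2 * torsionNormSq (formInChart e φ) y := fun e he y hy =>
    (hloc e he).divergence_eq (hX e he) hy (hsol.equation e he y hy)
  refine ⟨fun e he y hy => ⟨(hloc e he).ricci_eq (hX e he) hy (hsol.equation e he y hy),
    (hloc e he).codiff_interior_eq_zero (hX e he) hy (hsol.equation e he y hy),
    hdiv e he y hy⟩, fun _ hne => ?_⟩
  have hT : ∀ e ∈ charts M, ∀ y ∈ e.target, 0 ≤ torsionNormSq (formInChart e φ) y :=
    fun e he y hy => (hloc e he).torsionNormSq_nonneg hy
  obtain ⟨p⟩ := hne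
  have hp : chartAt R7 p ∈ charts M := IsManifold.chart_mem_maximalAtlas p
  have hpy : chartAt R7 p p ∈ (chartAt R7 p).target := mem_chart_target R7 p
  have hp1 := hdiv _ hp _ hpy
  refine ⟨fun hneg => ?_, fun h0 e he y hy => ?_, fun htf => ?_⟩
  -- If λ < 0, the trace identity makes the divergence positive, whereas it must vanish.
  · have hz := hsol.isG2.divergence_eq_zero hloc hX 1 (fun e he y hy => by
      linarith [hdiv e he y hy, hT e he y hy]) hp hpy
    linarith [hT _ hp _ hpy]
  · have hz := hsol.isG2.divergence_eq_zero hloc hX 1 (fun e he y hy => by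
      linarith [hdiv e he y hy, hT e he y hy]) he hy
    exact ((hloc e he).nabla_eq_zero_iff hy).1 (by linarith [hdiv e he y hy])
  · have hz : ∀ e ∈ charts M, ∀ y ∈ e.target, torsionNormSq (formInChart e φ) y = 0 :=
      fun e he y hy => ((hloc e he).nabla_eq_zero_iff hy).2 (htf e he y hy)
    have hd : ∀ e ∈ charts M, ∀ y ∈ e.target,
        divergence (formInChart e φ) (fieldInChart e X) y = -(7 * lam) / 3 := fun e he y hy => by
      linarith [hdiv e he y hy, hz e he y hy]
    -- The divergence is constant of unknown sign; multiplying it by its own value makes the product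
    -- a square.
    have h1 := hsol.isG2.divergence_eq_zero hloc hX (-(7 * lam) / 3) (fun e he y hy => by
      rw [hd e he y hy]; exact mul_self_nonneg _) hp hpy
    rw [hd _ hp _ hpy] at h1
    linarith [mul_self_eq_zero.1 h1]
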